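/- **Tile systems.** A *tile type* is an unrotatable unit square each of whose four sides carries a glue, consisting of a label (a finite string) and a strength in $\mathbb{N}$. An *assembly* is a partial function from $\mathbb{Z}^2$ to tile types; the *supertile* of an assembly $\alpha$ is the set $\tilde\alpha$ of all its translates. Two adjacent tiles are bound with strength $s$ if their abutting glues are equal and have strength $s>0$; an assembly is *$\tau$-stable* if every cut of the resulting weighted binding graph has weight at least $\tau$. For supertiles $\tilde\alpha,\tilde\beta$ let $C^\tau_{\tilde\alpha,\tilde\beta}$ be the set of supertiles of all $\tau$-stable disjoint unions of a member of $\tilde\alpha$ with a member of $\tilde\beta$. A *two-handed (2HAM) system* $\mathcal{T}=(T,S,\tau)$ consists of a finite set $T$ of tile types, a set $S$ of nonempty $\tau$-stable supertiles over $T$, each available initially in infinitely many copies, and a temperature $\tau\in\mathbb{N}$. Its set $\mathcal{A}[\mathcal{T}]$ of *producible* supertiles consists of the results of all finite or infinite sequences of attachments that start from a supertile in $S$, where every attached supertile has itself been assembled from $S$ in finitely many attachments. Write $\tilde\alpha\to^1_{\mathcal T}\tilde\beta$ if $\tilde\beta\in C^\tau_{\tilde\alpha,\tilde\gamma}$ for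 some $\tilde\gamma\in\mathcal{A}[\mathcal{T}]$, write $\tilde\alpha\to^{\le1}_{\mathcal T}\tilde\beta$ if $\tilde\alpha=\tilde\beta$ or $\tilde\alpha\to^1_{\mathcal T}\tilde\beta$, and write $\tilde\alpha\to_{\mathcal T}\tilde\beta$ if $\tilde\beta$ is the result of a finite (possibly empty) or infinite sequence of attachments of producible supertiles starting from $\tilde\alpha$. **Simulation.** Let $\mathcal{U}=(U,S',\tau')$ and $\mathcal{T}=(T,S,\tau)$ be 2HAM systems, $m\ge1$, and let $R$ be a partial function from $m\times m$ blocks over $U$ (partial functions $\{0,\dots,m-1\}^2\dashrightarrow U$) to $T$. For an assembly $\alpha$ over $U$ let $R^*(\alpha)$ be the assembly obtained by applying $R$ to each block of the division of $\mathbb{Z}^2$ into $m\times m$ blocks, and let $\tilde R(\tilde\alpha)=\{R^*(\alpha)\mid\alpha\in\tilde\alpha\}$. Say that $\tilde\alpha$ *maps cleanly* if $\tilde R(\tilde\alpha)$ is a supertile over $T$ and, for every $\alpha\in\tilde\alpha$, either $\alpha$ has at most one nonempty block, or every nonempty block of $\alpha$ is at, or directly north, south, east or west of, a position of the domain of $R^*(\alpha)$.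 The system $\mathcal{U}$ *simulates* $\mathcal{T}$ if for some such $m$ and $R$: 1. $\{\tilde R(\tilde\alpha)\mid\tilde\alpha\in\mathcal{A}[\mathcal{U}]\}=\mathcal{A}[\mathcal{T}]$, and every $\tilde\alpha\in\mathcal{A}[\mathcal{U}]$ maps cleanly; 2. for all $\tilde\alpha,\tilde\beta\in\mathcal{A}[\mathcal{U}]$ with $\tilde\alpha\to^1_{\mathcal U}\tilde\beta$, one has $\tilde R(\tilde\alpha)\to^{\le1}_{\mathcal T}\tilde R(\tilde\beta)$; 3. for all $\tilde\alpha,\tilde\beta\in\mathcal{A}[\mathcal{T}]$ with $\tilde\alpha\to^1_{\mathcal T}\tilde\beta$ and all $\tilde\alpha'\in\mathcal{A}[\mathcal{U}]$ with $\tilde R(\tilde\alpha')=\tilde\alpha$, there are $\tilde\alpha'',\tilde\beta'\in\mathcal{A}[\mathcal{U}]$ with $\tilde R(\tilde\alpha'')=\tilde\alpha$, $\tilde R(\tilde\beta')=\tilde\beta$ and $\tilde\alpha'\to_{\mathcal U}\tilde\alpha''\to^1_{\mathcal U}\tilde\beta'$. Let $\mathrm{2HAM}(k)$ be the class of all 2HAM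 systems at temperature $k$. A class $\mathfrak{A}$ *can simulate* a class $\mathfrak{B}$ if every system in $\mathfrak{B}$ is simulated by some system in $\mathfrak{A}$. An *infinite hierarchy* is a sequence $(H_i)_{i\ge0}$ with $H_i=\mathrm{2HAM}(k_i)$ for some temperatures $0<k_0<k_1<\cdots$ such that for all $j<i$ the class $H_j$ cannot simulate $H_i$, and for all $j\le i$ the class $H_i$ can simulate $H_j$. **Theorem.** There are infinitely many infinite hierarchies of 2HAM classes. More precisely, for every integer $c\ge4$ the sequence $\left(\mathrm{2HAM}(c^i)\right)_{i\ge0}$ is an infinite hierarchy, and the set of hierarchies of this form is infinite. -/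

import Mathlib

/-! ## Tiles and assemblies -/

namespace TwoHanded

/-- A glue: a label (a finite string over a binary alphabet) and a strength. -/
structure Glue where
  label : List Bool
  strength : ℕ

/-- A tile type: an unrotatable unit square with one glue on each side. -/
structure TileType where
  north : Glue
  east : Glue
  south : Glue
  west : Glue

/-- A position of the integer lattice. -/
abbrev Pos := ℤ × ℤ

/-- An assembly: a partial function from the lattice to tile types. -/
abbrev Assembly := Pos → Option TileType

namespace Assembly

/-- The set of positions that carry a tile. -/
def dom (α : Assembly) : Set Pos := {p | ∃ t, α p = some t}

/-- All tiles of `α` are of types in `T`. -/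
def Over (T : Finset TileType) (α : Assembly) : Prop := ∀ p t, α p = some t → t ∈ T

/-- The translation `α + u`. -/
def translate (u : Pos) (α : Assembly) : Assembly := fun p => α (p - u)

/-- `α ∪ β`; where both are defined, `α` takes precedence. -/
def union (α β : Assembly) : Assembly := fun p => (α p).orElse fun _ => β p

/-- The supertile of `α`: the set of all translations of `α`. -/
def supertile (α : Assembly) : Set Assembly := {β | ∃ u : Pos, translate u α = β}

open Classical in
/-- Weight of the edge between the positions `p` and `q` in the binding graph of `α`: the strength
of the common glue on their abutting sides, and `0` if they are not adjacent, if one of them is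
empty, or if the abutting glues differ. -/
noncomputable def bond (α : Assembly) (p q : Pos) : ℕ :=
  match α p, α q with
  | some s, some t =>
    if q = p + (0, 1) then (if s.north = t.south then s.north.strength else 0)
    else if q = p + (1, 0) then (if s.east = t.west then s.east.strength else 0)
    else if q = p + (0, -1) then (if s.south = t.north then s.south.strength else 0)
    else if q = p + (-1, 0) then (if s.west = t.east then s.west.strength else 0)
    else 0
  | _, _ => 0

/-- `τ`-stability: every cut `(A, B)` of the binding graph has weight at least `τ`. The assembly may
be infinite, so the weight of a cut may be infinite; it is at least `τ` if and only if finitely many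
edges across the cut have total weight at least `τ`. -/
def Stable (τ : ℕ) (α : Assembly) : Prop :=
  ∀ A B : Set Pos, A ∪ B = α.dom → Disjoint A B → A.Nonempty → B.Nonempty →
    ∃ E : Finset (Pos × Pos), (∀ e ∈ E, e.1 ∈ A ∧ e.2 ∈ B) ∧ τ ≤ ∑ e ∈ E, α.bond e.1 e.2

end Assembly

/-- `ta` is a supertile over the tile set `T`. -/
def IsSupertile (T : Finset TileType) (ta : Set Assembly) : Prop :=
  ∃ α : Assembly, α.Over T ∧ ta = α.supertile

/-- The combination set: all `τ`-stable supertiles obtained by attaching the supertiles `ta` and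
`tb` to each other without overlap. -/
def combine (τ : ℕ) (ta tb : Set Assembly) : Set (Set Assembly) :=
  {tg | ∃ α ∈ ta, ∃ β ∈ tb, Disjoint α.dom β.dom ∧ (α.union β).Stable τ ∧
    tg = (α.union β).supertile}

/-! ## Two-handed tile assembly systems -/

/-- A two-handed tile assembly system `(T, S, τ)`. The initial state `S` is a set of (nonempty,
`τ`-stable) supertiles over `T`, each of which is available in an infinite number of copies. -/
structure TAS where
  tiles : Finset TileType
  init : Set (Set Assembly)
  temp : ℕ
  init_spec : ∀ ta ∈ init, ∃ α : Assembly,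
    α.Over tiles ∧ α.dom.Nonempty ∧ α.Stable temp ∧ ta = α.supertile

namespace TAS

/-- The supertiles that occur in some state of an assembly sequence that starts in the initial
state. (All counts in the initial state are infinite, so any two such supertiles can be made
available side by side.) -/
inductive Reachable (𝒯 : TAS) : Set Assembly → Prop
  | init {ta : Set Assembly} : ta ∈ 𝒯.init → Reachable 𝒯 ta
  | attach {ta tb tg : Set Assembly} :
      Reachable 𝒯 ta → Reachable 𝒯 tb → tg ∈ combine 𝒯.temp ta tb → Reachable 𝒯 tg

/-- A supertile assembly sequence, followed in a fixed frame: in each step the current assembly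
stays as it is or a supertile from the pool `P` attaches to it. A finite sequence is one that is
eventually constant. -/
def IsGrowth (𝒯 : TAS) (P : Set Assembly → Prop) (a : ℕ → Assembly) : Prop :=
  ∀ i, a (i + 1) = a i ∨
    ∃ γ : Assembly, P γ.supertile ∧ Disjoint (a i).dom γ.dom ∧
      ((a i).union γ).Stable 𝒯.temp ∧ a (i + 1) = (a i).union γ

/-- `α` is the union of the assemblies `a i`: the result of the sequence. -/
def IsResult (a : ℕ → Assembly) (α : Assembly) : Prop :=
  ∀ p t, α p = some t ↔ ∃ i, a i p = some t

/-- `ta ∈ 𝒜[𝒯]`: `ta` is the result of a (finite or infinite) supertile assembly sequence that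
starts from the initial state. -/
def Producible (𝒯 : TAS) (ta : Set Assembly) : Prop :=
  ∃ (a : ℕ → Assembly) (α : Assembly), (a 0).supertile ∈ 𝒯.init ∧ 𝒯.IsGrowth 𝒯.Reachable a ∧
    IsResult a α ∧ ta = α.supertile

/-- `ta →¹ tb`: one attachment of a producible supertile turns `ta` into `tb`. -/
def Step (𝒯 : TAS) (ta tb : Set Assembly) : Prop :=
  ∃ tg, 𝒯.Producible tg ∧ tb ∈ combine 𝒯.temp ta tg

/-- `ta →^{≤1} tb`. -/
def StepLE (𝒯 : TAS) (ta tb : Set Assembly) : Prop := ta = tb ∨ 𝒯.Step ta tb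

/-- `ta → tb`: `tb` is the result of a (finite or infinite) sequence of attachments of producible
supertiles that starts from `ta`. -/
def Grows (𝒯 : TAS) (ta tb : Set Assembly) : Prop :=
  ∃ (a : ℕ → Assembly) (α : Assembly), (a 0).supertile = ta ∧ 𝒯.IsGrowth 𝒯.Producible a ∧
    IsResult a α ∧ tb = α.supertile

end TAS

/-! ## Simulation -/

/-- An `m`-block (macrotile): a partial function from `ℤ_m × ℤ_m` to tile types. -/
abbrev Block (m : ℕ) := Fin m × Fin m → Option TileType

/-- The `m`-block of `α` with coordinates `x`. -/
def blockAt (m : ℕ) (α : Assembly) (x : Pos) : Block m :=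
  fun ij => α ((m : ℤ) * x.1 + (ij.1 : ℕ), (m : ℤ) * x.2 + (ij.2 : ℕ))

/-- The block is not the empty block. -/
def Block.IsNonempty {m : ℕ} (b : Block m) : Prop := ∃ ij t, b ij = some t

/-- An `m`-block representation function `R : B_m^U ⇀ T`: a partial function that assigns tile
types of `T` to `m`-blocks over `U`. -/
structure Repr (U T : Finset TileType) (m : ℕ) where
  toFun : Block m → Option TileType
  source : ∀ b t, toFun b = some t → ∀ ij u, b ij = some u → u ∈ U
  target : ∀ b t, toFun b = some t → t ∈ T

namespace Repr

variable {U T : Finset TileType} {m : ℕ}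

/-- The assembly representation function `R*`. -/
def onAssembly (R : Repr U T m) (α : Assembly) : Assembly := fun x => R.toFun (blockAt m α x)

/-- The supertile representation function `R̃`. -/
def onSupertile (R : Repr U T m) (ta : Set Assembly) : Set Assembly := R.onAssembly '' ta

/-- `α` maps cleanly to `R*(α)`: every nonempty block of `α` represents a tile of `R*(α)` or lies
directly north, south, east or west of such a block, or `α` has at most one nonempty block. -/
def CleanAssembly (R : Repr U T m) (α : Assembly) : Prop :=
  (∀ x : Pos, (blockAt m α x).IsNonempty →
    ∃ u v : ℤ, u ^ 2 + v ^ 2 < 2 ∧ (x.1 + u, x.2 + v) ∈ (R.onAssembly α).dom) ∨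
  (∀ x y : Pos, (blockAt m α x).IsNonempty → (blockAt m α y).IsNonempty → x = y)

/-- `ta` maps cleanly to `R̃(ta)`. -/
def Clean (R : Repr U T m) (ta : Set Assembly) : Prop :=
  IsSupertile T (R.onSupertile ta) ∧ ∀ α ∈ ta, R.CleanAssembly α

end Repr

variable {m : ℕ}

/-- `𝒰` and `𝒯` have equivalent productions. -/
def EquivProductions (𝒰 𝒯 : TAS) (R : Repr 𝒰.tiles 𝒯.tiles m) : Prop :=
  {tb | ∃ ta, 𝒰.Producible ta ∧ R.onSupertile ta = tb} = {tb | 𝒯.Producible tb} ∧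
  ∀ ta, 𝒰.Producible ta → R.Clean ta

/-- `𝒯` follows `𝒰`. -/
def Follows (𝒰 𝒯 : TAS) (R : Repr 𝒰.tiles 𝒯.tiles m) : Prop :=
  ∀ ta tb, 𝒰.Producible ta → 𝒰.Producible tb → 𝒰.Step ta tb →
    𝒯.StepLE (R.onSupertile ta) (R.onSupertile tb)

/-- `𝒰` weakly models `𝒯`. -/
def WeaklyModels (𝒰 𝒯 : TAS) (R : Repr 𝒰.tiles 𝒯.tiles m) : Prop :=
  ∀ ta tb, 𝒯.Producible ta → 𝒯.Producible tb → 𝒯.Step ta tb →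
    ∀ ta', 𝒰.Producible ta' → R.onSupertile ta' = ta →
      ∃ ta'' tb', 𝒰.Producible ta'' ∧ R.onSupertile ta'' = ta ∧ 𝒰.Grows ta' ta'' ∧
        𝒰.Producible tb' ∧ R.onSupertile tb' = tb ∧ 𝒰.Step ta'' tb'

/-- `𝒰` simulates `𝒯`, at some scale factor and under some representation function. -/
def Simulates (𝒰 𝒯 : TAS) : Prop :=
  ∃ (m : ℕ) (_ : 0 < m) (R : Repr 𝒰.tiles 𝒯.tiles m),
    EquivProductions 𝒰 𝒯 R ∧ Follows 𝒰 𝒯 R ∧ WeaklyModels 𝒰 𝒯 R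

/-! ## Classes and hierarchies -/

/-- `2HAM(k)`: all two-handed tile assembly systems at temperature `k`. -/
def TwoHAM (k : ℕ) : Set TAS := {𝒯 | 𝒯.temp = k}

/-- The class `𝔄` can simulate the class `𝔅`: every system of `𝔅` is simulated by some system of
`𝔄`. -/
def ClassSimulates (𝔄 𝔅 : Set TAS) : Prop := ∀ 𝒯 ∈ 𝔅, ∃ 𝒰 ∈ 𝔄, Simulates 𝒰 𝒯

/-- An infinite hierarchy of 2HAM classes: the temperatures strictly increase, no level can be
simulated by a lower one, and every level can simulate all levels below it. -/
structure IsHierarchy (H : ℕ → Set TAS) : Prop where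
  temperature : ∃ k : ℕ → ℕ, StrictMono k ∧ (∀ i, 0 < k i) ∧ ∀ i, H i = TwoHAM (k i)
  power : ∀ i j, j < i → ¬ ClassSimulates (H j) (H i)
  downward : ∀ i j, j ≤ i → ClassSimulates (H i) (H j)

end TwoHanded

/-! Simulating a lower level is a matter of scaling. If `k` divides `l`, multiplying all glue
strengths and the temperature by `l / k` multiplies the weight of every cut by that factor, so
stability, productions and steps are unchanged up to relabeling. This is a simulation at scale
factor one (`simulates_scale`, `classSimulates_of_dvd`), and powers of `c` divide each other.

The substance is that for `τ ≥ 2` one system at temperature `τ` defeats every simulator at a lower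
temperature (`Ladder.not_simulates`). Its initial supertiles are pieces and seeds, for all `N` and
all `t : Fin τ → ℕ` with values below `N`. A piece is a bar with `τ` hanging teeth, whose columns
encode `t` and whose tips have strength one. A seed has `N` docks matching the piece with the same
`t`. A piece can bind only if all `τ` of its tips are matched (`tips_matched`).

Suppose that a simulator has scale `m` and temperature below `τ`. Fix `N` large in terms of `m`, `τ`
and the simulator's tiles, and let it fill the docks of the seed of `t` one after another. By
`Follows`, the supertile attached in each step represents either the piece or something that
contains both ends of the whole seed (`stepLE_chain`). In the second case its position is forced up
to a bounded error, so it places a new tile in a bounded region around the seed's corner. That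
region has fewer than `N` positions, so some step attaches a genuine piece simulator `γ` to a seed
simulator `A` (`exists_piece_step`), and their relative position is known up to a bounded error
(`exists_aligned_step`).

Cleanness confines every contact of `A` and `γ` to bounded windows around the tips (`contact`).
Fewer than `τ` positive bonds already reach the simulator's temperature, so the window of some tooth
`r` is not needed (`exists_unneeded_tooth`). Color `t` by `r`, the offset of `γ` and the contents of
all windows. The number of colors does not depend on `N`, so two families `t`, `t'` of the same
color differ exactly at `r` (`exists_eq_color_differ_once`). Then the `γ` of `t'` attaches to the
`A` of `t`: it looks like the `γ` of `t` in every window that matters, and it cannot collide at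
tooth `r`, because the two teeth there lie in different columns. In the simulated system, however,
the partially filled seed of `t` and the piece of `t'` have no common successor (`not_stepLE_both`),
which contradicts `Follows`. -/

namespace TwoHanded

namespace Assembly

/-! ### Domains, translations and unions -/

theorem mem_dom {α : Assembly} {p : Pos} : p ∈ α.dom ↔ ∃ t, α p = some t := Iff.rfl

theorem notMem_dom {α : Assembly} {p : Pos} : p ∉ α.dom ↔ α p = none := by
  rw [mem_dom]
  cases α p <;> simp

theorem translate_apply (u : Pos) (α : Assembly) (p : Pos) : translate u α p = α (p - u) := rfl

@[simp] theorem translate_zero (α : Assembly) : translate 0 α = α := by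
  funext p
  simp [translate]

@[simp] theorem translate_translate (u v : Pos) (α : Assembly) :
    translate u (translate v α) = translate (u + v) α := by
  funext p
  simp only [translate]
  congr 1
  abel

theorem mem_dom_translate {u p : Pos} {α : Assembly} :
    p ∈ (translate u α).dom ↔ p - u ∈ α.dom := Iff.rfl

theorem union_of_mem {α β : Assembly} {p : Pos} (h : p ∈ α.dom) : α.union β p = α p := by
  obtain ⟨t, ht⟩ := h
  simp [union, ht]

theorem union_of_notMem {α β : Assembly} {p : Pos} (h : p ∉ α.dom) : α.union β p = β p := by
  rw [notMem_dom] at h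
  simp [union, h]

theorem dom_union (α β : Assembly) : (α.union β).dom = α.dom ∪ β.dom := by
  ext p
  by_cases h : p ∈ α.dom
  · simp only [Set.mem_union, h, true_or, iff_true]
    rw [mem_dom, union_of_mem h]
    exact h
  · simp only [Set.mem_union, h, false_or]
    rw [mem_dom, union_of_notMem h]
    rfl

theorem union_of_mem_right {α β : Assembly} (hd : Disjoint α.dom β.dom) {p : Pos}
    (h : p ∈ β.dom) : α.union β p = β p :=
  union_of_notMem fun h' => Set.disjoint_left.1 hd h' h

theorem union_comm_of_disjoint {α β : Assembly} (hd : Disjoint α.dom β.dom) :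
    α.union β = β.union α := by
  funext p
  by_cases h : p ∈ α.dom
  · rw [union_of_mem h, union_of_mem_right hd.symm h]
  · rw [union_of_notMem h]
    by_cases h' : p ∈ β.dom
    · rw [union_of_mem h']
    · rw [union_of_notMem h', notMem_dom.1 h, notMem_dom.1 h']

theorem translate_union (u : Pos) (α β : Assembly) :
    translate u (α.union β) = (translate u α).union (translate u β) := rfl

theorem disjoint_translate {u : Pos} {α β : Assembly} :
    Disjoint (translate u α).dom (translate u β).dom ↔ Disjoint α.dom β.dom := by
  simp only [Set.disjoint_left]
  constructor
  · intro h p hp hq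
    exact h (a := p + u) (by simpa [mem_dom_translate] using hp)
      (by simpa [mem_dom_translate] using hq)
  · intro h p hp hq
    exact h hp hq

/-- `α` is a subassembly of `β`. -/
def Sub (α β : Assembly) : Prop := ∀ p t, α p = some t → β p = some t

theorem Sub.refl (α : Assembly) : α.Sub α := fun _ _ h => h

theorem Sub.trans {α β γ : Assembly} (h : α.Sub β) (h' : β.Sub γ) : α.Sub γ :=
  fun p t ht => h' p t (h p t ht)

theorem Sub.dom_subset {α β : Assembly} (h : α.Sub β) : α.dom ⊆ β.dom :=
  fun p ⟨t, ht⟩ => ⟨t, h p t ht⟩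

theorem Sub.apply_eq {α β : Assembly} (h : α.Sub β) {p : Pos} (hp : p ∈ α.dom) : β p = α p := by
  obtain ⟨t, ht⟩ := hp
  rw [ht, h p t ht]

theorem Sub.translate {α β : Assembly} (h : α.Sub β) (u : Pos) :
    (α.translate u).Sub (β.translate u) := fun p t ht => h (p - u) t ht

theorem sub_union_left (α β : Assembly) : α.Sub (α.union β) :=
  fun _ t h => (union_of_mem ⟨t, h⟩).trans h

theorem sub_union_right {α β : Assembly} (hd : Disjoint α.dom β.dom) : β.Sub (α.union β) :=
  fun _ t h => (union_of_mem_right hd ⟨t, h⟩).trans h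

theorem Over.translate {T : Finset TileType} {α : Assembly} (h : α.Over T) (u : Pos) :
    (α.translate u).Over T := fun p t ht => h (p - u) t ht

theorem Over.union {T : Finset TileType} {α β : Assembly} (h : α.Over T) (h' : β.Over T) :
    (α.union β).Over T := by
  intro p t ht
  by_cases hp : p ∈ α.dom
  · rw [union_of_mem hp] at ht
    exact h p t ht
  · rw [union_of_notMem hp] at ht
    exact h' p t ht

/-! ### Supertiles -/

theorem mem_supertile {α β : Assembly} : β ∈ α.supertile ↔ ∃ u, translate u α = β := Iff.rfl

theorem self_mem_supertile (α : Assembly) : α ∈ α.supertile := ⟨0, translate_zero α⟩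

@[simp] theorem supertile_translate (u : Pos) (α : Assembly) :
    (translate u α).supertile = α.supertile := by
  ext β
  simp only [mem_supertile, translate_translate]
  constructor
  · rintro ⟨v, rfl⟩
    exact ⟨v + u, rfl⟩
  · rintro ⟨v, rfl⟩
    exact ⟨v - u, by simp⟩

theorem supertile_eq_of_mem {α β : Assembly} (h : β ∈ α.supertile) : β.supertile = α.supertile := by
  obtain ⟨u, rfl⟩ := h
  exact supertile_translate u α

theorem exists_translate_of_supertile_eq {α β : Assembly} (h : α.supertile = β.supertile) :
    ∃ u, translate u α = β := by
  have := self_mem_supertile β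
  rwa [← h] at this

/-! ### The binding graph -/

theorem bond_translate (u : Pos) (α : Assembly) (p q : Pos) :
    bond (translate u α) p q = bond α (p - u) (q - u) := by
  have h (w : Pos) : q = p + w ↔ q - u = p - u + w := by
    rw [sub_add_eq_add_sub, sub_left_inj]
  simp only [bond, translate_apply, h]

theorem bond_congr {α β : Assembly} {p q : Pos} (hp : α p = β p) (hq : α q = β q) :
    bond α p q = bond β p q := by
  simp only [bond, hp, hq]

theorem mem_dom_of_bond_pos {α : Assembly} {p q : Pos} (h : 0 < bond α p q) :
    p ∈ α.dom ∧ q ∈ α.dom := by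
  simp only [mem_dom]
  unfold bond at h
  split at h
  · exact ⟨⟨_, by assumption⟩, ⟨_, by assumption⟩⟩
  · simp at h

/-- A positive bond comes from a common glue of positive strength on abutting sides. -/
theorem bond_pos_cases {α : Assembly} {p q : Pos} (h : 0 < bond α p q) :
    ∃ s t, α p = some s ∧ α q = some t ∧
      ((q = p + (0, 1) ∧ s.north = t.south ∧ bond α p q = s.north.strength) ∨
       (q = p + (1, 0) ∧ s.east = t.west ∧ bond α p q = s.east.strength) ∨
       (q = p + (0, -1) ∧ s.south = t.north ∧ bond α p q = s.south.strength) ∨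
       (q = p + (-1, 0) ∧ s.west = t.east ∧ bond α p q = s.west.strength)) := by
  obtain ⟨⟨s, hs⟩, ⟨t, ht⟩⟩ := mem_dom_of_bond_pos h
  refine ⟨s, t, hs, ht, ?_⟩
  simp only [bond, hs, ht] at h ⊢
  split_ifs at h ⊢ <;> simp_all

theorem bond_north {α : Assembly} {p : Pos} {s t : TileType} (hs : α p = some s)
    (ht : α (p + (0, 1)) = some t) (h : s.north = t.south) :
    bond α p (p + (0, 1)) = s.north.strength := by
  simp [bond, hs, ht, h]

theorem bond_east {α : Assembly} {p : Pos} {s t : TileType} (hs : α p = some s)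
    (ht : α (p + (1, 0)) = some t) (h : s.east = t.west) :
    bond α p (p + (1, 0)) = s.east.strength := by
  simp [bond, hs, ht, h]

theorem bond_comm (α : Assembly) (p q : Pos) : bond α p q = bond α q p := by
  have key : ∀ p q : Pos, 0 < bond α p q → bond α p q = bond α q p := by
    intro p q h
    obtain ⟨s, t, hs, ht, h⟩ := bond_pos_cases h
    rcases h with ⟨rfl, h, hb⟩ | ⟨rfl, h, hb⟩ | ⟨rfl, h, hb⟩ | ⟨rfl, h, hb⟩ <;>
      rw [hb] <;> simp [bond, hs, ht, h, Prod.ext_iff, add_assoc]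
  rcases Nat.eq_zero_or_pos (bond α p q) with h | h
  · rcases Nat.eq_zero_or_pos (bond α q p) with h' | h'
    · rw [h, h']
    · exact (key q p h').symm
  · exact key p q h

/-! ### Stability -/

theorem Stable.translate {τ : ℕ} {α : Assembly} (h : α.Stable τ) (u : Pos) :
    (α.translate u).Stable τ := by
  intro A B hAB hd hA hB
  obtain ⟨E, hE, hs⟩ := h ((fun p => p + u) ⁻¹' A) ((fun p => p + u) ⁻¹' B)
    (by
      ext p
      have := Set.ext_iff.1 hAB (p + u)
      simpa [mem_dom_translate] using this)
    (hd.preimage _)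
    (by
      obtain ⟨p, hp⟩ := hA
      exact ⟨p - u, by simpa using hp⟩)
    (by
      obtain ⟨p, hp⟩ := hB
      exact ⟨p - u, by simpa using hp⟩)
  refine ⟨E.map ((Equiv.addRight u).prodCongr (Equiv.addRight u)).toEmbedding, ?_, ?_⟩
  · intro e he
    obtain ⟨f, hf, rfl⟩ := Finset.mem_map.1 he
    exact hE f hf
  · rw [Finset.sum_map]
    refine hs.trans (le_of_eq (Finset.sum_congr rfl fun e _ => ?_))
    simp [bond_translate]

/-- A cut of an assembly that separates a stable subassembly has weight at least `τ`. -/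
theorem Stable.cut_of_sub {τ : ℕ} {α β : Assembly} (h : α.Stable τ) (hs : α.Sub β)
    {A B : Set Pos} (hAB : A ∪ B = β.dom) (hd : Disjoint A B) (hA : (A ∩ α.dom).Nonempty)
    (hB : (B ∩ α.dom).Nonempty) :
    ∃ E : Finset (Pos × Pos), (∀ e ∈ E, e.1 ∈ A ∧ e.2 ∈ B) ∧ τ ≤ ∑ e ∈ E, β.bond e.1 e.2 := by
  obtain ⟨E, hE, hw⟩ := h (A ∩ α.dom) (B ∩ α.dom)
    (by rw [← Set.union_inter_distrib_right, hAB]; exact Set.inter_eq_right.2 hs.dom_subset)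
    (hd.mono Set.inter_subset_left Set.inter_subset_left) hA hB
  refine ⟨E, fun e he => ⟨(hE e he).1.1, (hE e he).2.1⟩, hw.trans (Finset.sum_le_sum ?_)⟩
  intro e he
  rw [bond_congr (hs.apply_eq (hE e he).1.2) (hs.apply_eq (hE e he).2.2)]

/-- Two disjoint stable assemblies form a stable union if the bonds between them have total
strength at least `τ`. -/
theorem Stable.union {τ : ℕ} {α β : Assembly} (hα : α.Stable τ) (hβ : β.Stable τ)
    (hd : Disjoint α.dom β.dom) (E : Finset (Pos × Pos))
    (hE : ∀ e ∈ E, e.1 ∈ α.dom ∧ e.2 ∈ β.dom)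
    (hw : τ ≤ ∑ e ∈ E, (α.union β).bond e.1 e.2) : (α.union β).Stable τ := by
  intro A B hAB hAB' hA hB
  have hsub : ∀ p, p ∈ A ∨ p ∈ B ↔ p ∈ α.dom ∨ p ∈ β.dom := fun p => by
    rw [← Set.mem_union, hAB, dom_union, Set.mem_union]
  by_cases h1 : (A ∩ α.dom).Nonempty ∧ (B ∩ α.dom).Nonempty
  · exact hα.cut_of_sub (sub_union_left α β) hAB hAB' h1.1 h1.2
  by_cases h2 : (A ∩ β.dom).Nonempty ∧ (B ∩ β.dom).Nonempty
  · exact hβ.cut_of_sub (sub_union_right hd) hAB hAB' h2.1 h2.2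
  -- If the cut splits neither part, it is the cut between `α` and `β` themselves, in one of the two
  -- orders.
  have hdisj := Set.disjoint_left.1 hAB'
  have hdisj' := Set.disjoint_left.1 hd
  obtain ⟨a, ha⟩ := hA
  obtain ⟨b, hb⟩ := hB
  simp only [Set.Nonempty, Set.mem_inter_iff, not_and_or, not_exists] at h1 h2
  rcases (hsub a).1 (Or.inl ha) with ha' | ha'
  · have hB1 : ∀ x, x ∈ B → x ∉ α.dom := by
      intro x hx hxα
      rcases h1 with h1 | h1
      · exact (h1 a).elim (· ha) (· ha')
      · exact (h1 x).elim (· hx) (· hxα)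
    have hb' : b ∈ β.dom := ((hsub b).1 (Or.inr hb)).resolve_left (hB1 b hb)
    have hA1 : ∀ x, x ∈ A → x ∉ β.dom := by
      intro x hx hxβ
      rcases h2 with h2 | h2
      · exact (h2 x).elim (· hx) (· hxβ)
      · exact (h2 b).elim (· hb) (· hb')
    refine ⟨E, fun e he => ⟨?_, ?_⟩, hw⟩
    · exact ((hsub _).2 (Or.inl (hE e he).1)).resolve_right fun h => hB1 _ h (hE e he).1
    · exact ((hsub _).2 (Or.inr (hE e he).2)).resolve_left fun h => hA1 _ h (hE e he).2
  · have hB1 : ∀ x, x ∈ B → x ∉ β.dom := by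
      intro x hx hxβ
      rcases h2 with h2 | h2
      · exact (h2 a).elim (· ha) (· ha')
      · exact (h2 x).elim (· hx) (· hxβ)
    have hb' : b ∈ α.dom := ((hsub b).1 (Or.inr hb)).resolve_right (hB1 b hb)
    have hA1 : ∀ x, x ∈ A → x ∉ α.dom := by
      intro x hx hxα
      rcases h1 with h1 | h1
      · exact (h1 x).elim (· hx) (· hxα)
      · exact (h1 b).elim (· hb) (· hb')
    refine ⟨E.map (Equiv.prodComm Pos Pos).toEmbedding, fun e he => ?_, ?_⟩
    · obtain ⟨f, hf, rfl⟩ := Finset.mem_map.1 he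
      refine ⟨?_, ?_⟩
      · exact ((hsub _).2 (Or.inr (hE f hf).2)).resolve_right fun h => hB1 _ h (hE f hf).2
      · exact ((hsub _).2 (Or.inl (hE f hf).1)).resolve_left fun h => hA1 _ h (hE f hf).1
    · refine hw.trans (le_of_eq ?_)
      rw [Finset.sum_map]
      exact Finset.sum_congr rfl fun e _ => bond_comm _ _ _

/-- The bonds across the cut between the two parts of a stable union. -/
theorem Stable.exists_crossing {τ : ℕ} {α β : Assembly} (h : (α.union β).Stable τ)
    (hd : Disjoint α.dom β.dom) (hα : α.dom.Nonempty) (hβ : β.dom.Nonempty) :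
    ∃ E : Finset (Pos × Pos), (∀ e ∈ E, e.1 ∈ α.dom ∧ e.2 ∈ β.dom) ∧
      τ ≤ ∑ e ∈ E, (α.union β).bond e.1 e.2 :=
  h α.dom β.dom (dom_union α β).symm hd hα hβ

/-- An assembly in which every tile but one has a strongly bound predecessor is stable. -/
theorem Stable.of_parent {τ : ℕ} {α : Assembly} (root : Pos) (μ : Pos → ℕ)
    (h : ∀ p ∈ α.dom, p ≠ root → ∃ q ∈ α.dom, μ q < μ p ∧ τ ≤ α.bond p q) : α.Stable τ := by
  -- Predecessors followed from a tile on the side without the root must cross the cut, and that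
  -- single edge has weight at least `τ`.
  have main : ∀ (A B : Set Pos), A ∪ B = α.dom → Disjoint A B → root ∈ A → ∀ n, ∀ p ∈ B, μ p = n →
      ∃ a ∈ A, ∃ b ∈ B, τ ≤ α.bond a b := by
    intro A B hAB hd hr n
    induction n using Nat.strong_induction_on with
    | _ n ih =>
      intro p hp hn
      obtain ⟨q, hq, hlt, hb⟩ := h p (hAB ▸ Or.inr hp)
        (fun e => Set.disjoint_left.1 hd hr (e ▸ hp))
      rw [← hAB] at hq
      rcases hq with hq | hq
      · exact ⟨q, hq, p, hp, by rwa [bond_comm]⟩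
      · exact ih (μ q) (hn ▸ hlt) q hq rfl
  have hroot : ∀ n, ∀ p ∈ α.dom, μ p = n → root ∈ α.dom := by
    intro n
    induction n using Nat.strong_induction_on with
    | _ n ih =>
      intro p hp hn
      by_cases e : p = root
      · exact e ▸ hp
      · obtain ⟨q, hq, hlt, -⟩ := h p hp e
        exact ih (μ q) (hn ▸ hlt) q hq rfl
  intro A B hAB hd ⟨a, ha⟩ ⟨b, hb⟩
  have hr : root ∈ A ∪ B := by
    rw [hAB]
    exact hroot _ a (hAB ▸ Or.inl ha) rfl
  rcases hr with hr | hr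
  · obtain ⟨x, hx, y, hy, hxy⟩ := main A B hAB hd hr _ b hb rfl
    exact ⟨{(x, y)}, by simp [hx, hy], by simpa using hxy⟩
  · obtain ⟨x, hx, y, hy, hxy⟩ := main B A (by rwa [Set.union_comm]) hd.symm hr _ a ha rfl
    exact ⟨{(y, x)}, by simp [hx, hy], by simpa [bond_comm α y x] using hxy⟩

end Assembly

open Assembly hiding translate

/-! ### Combination of supertiles -/

theorem combine_comm (τ : ℕ) (ta tb : Set Assembly) : combine τ ta tb = combine τ tb ta := by
  have key : ∀ ta tb, combine τ ta tb ⊆ combine τ tb ta := by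
    rintro ta tb tg ⟨α, hα, β, hβ, hd, hs, rfl⟩
    rw [union_comm_of_disjoint hd] at hs ⊢
    exact ⟨β, hβ, α, hα, hd.symm, hs, rfl⟩
  exact Set.Subset.antisymm (key _ _) (key _ _)

theorem combine_mem {τ : ℕ} {α β : Assembly} (hd : Disjoint α.dom β.dom)
    (hs : (α.union β).Stable τ) :
    (α.union β).supertile ∈ combine τ α.supertile β.supertile :=
  ⟨α, self_mem_supertile α, β, self_mem_supertile β, hd, hs, rfl⟩

/-- A combination of two supertiles, seen in a frame fixed for the first one. -/
theorem combine_cases {τ : ℕ} {α : Assembly} {tb tg : Set Assembly} {β₀ : Assembly}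
    (hb : tb = β₀.supertile) (h : tg ∈ combine τ α.supertile tb) :
    ∃ β : Assembly, tb = β.supertile ∧ Disjoint α.dom β.dom ∧ (α.union β).Stable τ ∧
      tg = (α.union β).supertile := by
  obtain ⟨α', ⟨u, rfl⟩, β, hβ, hd, hs, rfl⟩ := h
  rw [hb] at hβ ⊢
  have e : (α.translate u).union β = Assembly.translate u (α.union (β.translate (-u))) := by
    rw [translate_union]
    simp
  rw [e] at hs ⊢
  have hd' : Disjoint α.dom (β.translate (-u)).dom := by
    rw [← disjoint_translate (u := u)]
    simpa using hd
  refine ⟨β.translate (-u), ?_, hd', ?_, ?_⟩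
  · rw [supertile_translate, supertile_eq_of_mem hβ]
  · simpa using hs.translate (-u)
  · rw [supertile_translate]

/-! ### Assembly sequences, their results and producible supertiles -/

namespace TAS

variable {𝒯 : TAS}

theorem Reachable.exists_assembly {ta : Set Assembly} (h : 𝒯.Reachable ta) :
    ∃ α : Assembly, ta = α.supertile ∧ α.Over 𝒯.tiles ∧ α.Stable 𝒯.temp ∧ α.dom.Nonempty := by
  induction h with
  | init h =>
    obtain ⟨α, h1, h2, h3, h4⟩ := 𝒯.init_spec _ h
    exact ⟨α, h4, h1, h3, h2⟩
  | attach _ _ h iha ihb =>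
    obtain ⟨α, rfl, ha, has, hne⟩ := iha
    obtain ⟨β, rfl, hb, hbs, -⟩ := ihb
    obtain ⟨α', ⟨u, rfl⟩, β', ⟨v, rfl⟩, hd, hs, rfl⟩ := h
    refine ⟨_, rfl, (ha.translate u).union (hb.translate v), hs, ?_⟩
    rw [dom_union]
    obtain ⟨p, hp⟩ := hne
    exact ⟨p + u, Or.inl (by simpa [mem_dom_translate] using hp)⟩

theorem IsGrowth.sub {P : Set Assembly → Prop} {a : ℕ → Assembly} (h : 𝒯.IsGrowth P a) {i j : ℕ}
    (hij : i ≤ j) : (a i).Sub (a j) := by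
  induction j, hij using Nat.le_induction with
  | base => exact Sub.refl _
  | succ j _ ih =>
    rcases h j with e | ⟨γ, -, -, -, e⟩
    · rwa [e]
    · rw [e]
      exact ih.trans (sub_union_left _ _)

theorem IsResult.sub {a : ℕ → Assembly} {α : Assembly} (h : IsResult a α) (i : ℕ) :
    (a i).Sub α := fun p t ht => (h p t).2 ⟨i, ht⟩

theorem IsResult.eq {a : ℕ → Assembly} {α β : Assembly} (h : IsResult a α) (h' : IsResult a β) :
    α = β := by
  funext p
  ext t
  exact (h p t).trans (h' p t).symm

theorem IsGrowth.isResult_of_const {P : Set Assembly → Prop} {a : ℕ → Assembly}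
    (h : 𝒯.IsGrowth P a) {k : ℕ} (hk : ∀ i, k ≤ i → a i = a k) : IsResult a (a k) := by
  intro p t
  refine ⟨fun ht => ⟨k, ht⟩, ?_⟩
  rintro ⟨i, hi⟩
  have := h.sub (le_max_left i k) p t hi
  rwa [hk _ (le_max_right i k)] at this

theorem IsGrowth.stable {P : Set Assembly → Prop} {a : ℕ → Assembly}
    (h : 𝒯.IsGrowth P a) (h0 : (a 0).Stable 𝒯.temp) (i : ℕ) : (a i).Stable 𝒯.temp := by
  induction i with
  | zero => exact h0
  | succ i ih =>
    rcases h i with e | ⟨γ, -, -, hs, e⟩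
    · rwa [e]
    · rwa [e]

/-- A cut of the limit separates two tiles that are both present at some finite stage. The stability
of that stage already supplies finitely many edges of sufficient weight. -/
theorem IsGrowth.stable_result {P : Set Assembly → Prop} {a : ℕ → Assembly} {α : Assembly}
    (h : 𝒯.IsGrowth P a) (h0 : (a 0).Stable 𝒯.temp) (hr : IsResult a α) : α.Stable 𝒯.temp := by
  intro A B hAB hd ⟨x, hx⟩ ⟨y, hy⟩
  obtain ⟨s, hs⟩ : x ∈ α.dom := hAB ▸ Or.inl hx
  obtain ⟨t, ht⟩ : y ∈ α.dom := hAB ▸ Or.inr hy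
  obtain ⟨i, hi⟩ := (hr x s).1 hs
  obtain ⟨j, hj⟩ := (hr y t).1 ht
  exact (h.stable h0 (max i j)).cut_of_sub (hr.sub _) hAB hd
    ⟨x, hx, s, h.sub (le_max_left i j) x s hi⟩ ⟨y, hy, t, h.sub (le_max_right i j) y t hj⟩

theorem IsGrowth.over {P : Set Assembly → Prop} {a : ℕ → Assembly} (h : 𝒯.IsGrowth P a)
    (hP : ∀ γ : Assembly, P γ.supertile → γ.Over 𝒯.tiles) (h0 : (a 0).Over 𝒯.tiles) (i : ℕ) :
    (a i).Over 𝒯.tiles := by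
  induction i with
  | zero => exact h0
  | succ i ih =>
    rcases h i with e | ⟨γ, hγ, -, -, e⟩
    · rwa [e]
    · rw [e]
      exact ih.union (hP γ hγ)

theorem Reachable.over {α : Assembly} (h : 𝒯.Reachable α.supertile) : α.Over 𝒯.tiles := by
  obtain ⟨β, e, hβ, -, -⟩ := h.exists_assembly
  obtain ⟨u, rfl⟩ := exists_translate_of_supertile_eq e.symm
  exact hβ.translate u

theorem Producible.exists_assembly {ta : Set Assembly} (h : 𝒯.Producible ta) :
    ∃ α : Assembly, ta = α.supertile ∧ α.Over 𝒯.tiles ∧ α.Stable 𝒯.temp ∧ α.dom.Nonempty := by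
  obtain ⟨a, α, h0, hg, hr, rfl⟩ := h
  have h0' : 𝒯.Reachable (a 0).supertile := .init h0
  obtain ⟨β, e, -, hs, hne⟩ := h0'.exists_assembly
  obtain ⟨u, hu⟩ := exists_translate_of_supertile_eq e.symm
  refine ⟨α, rfl, ?_, hg.stable_result (hu ▸ hs.translate u) hr, ?_⟩
  · intro p t ht
    obtain ⟨i, hi⟩ := (hr p t).1 ht
    exact hg.over (fun γ hγ => hγ.over) h0'.over i p t hi
  · obtain ⟨p, hp⟩ := hne
    refine ⟨p + u, (hr.sub 0).dom_subset ?_⟩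
    rw [← hu]
    simpa [mem_dom_translate] using hp

theorem Producible.over {α : Assembly} (h : 𝒯.Producible α.supertile) : α.Over 𝒯.tiles := by
  obtain ⟨β, e, hβ, -, -⟩ := h.exists_assembly
  obtain ⟨u, rfl⟩ := exists_translate_of_supertile_eq e.symm
  exact hβ.translate u

theorem Producible.stable {α : Assembly} (h : 𝒯.Producible α.supertile) :
    α.Stable 𝒯.temp := by
  obtain ⟨β, e, -, hβ, -⟩ := h.exists_assembly
  obtain ⟨u, rfl⟩ := exists_translate_of_supertile_eq e.symm
  exact hβ.translate u

theorem Producible.nonempty {α : Assembly} (h : 𝒯.Producible α.supertile) : α.dom.Nonempty := by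
  obtain ⟨β, e, -, -, p, hp⟩ := h.exists_assembly
  obtain ⟨u, rfl⟩ := exists_translate_of_supertile_eq e.symm
  exact ⟨p + u, by simpa [mem_dom_translate] using hp⟩

/-- A tree of attachments becomes a linear sequence by following its left branch; each right subtree
enters as one supertile of the pool. -/
theorem Reachable.exists_growth {ta : Set Assembly} (h : 𝒯.Reachable ta) :
    ∃ (a : ℕ → Assembly) (k : ℕ), (a 0).supertile ∈ 𝒯.init ∧ 𝒯.IsGrowth 𝒯.Reachable a ∧
      (∀ i, k ≤ i → a i = a k) ∧ ta = (a k).supertile := by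
  induction h with
  | @init ta h =>
    obtain ⟨α, -, -, -, rfl⟩ := 𝒯.init_spec _ h
    exact ⟨fun _ => α, 0, h, fun i => Or.inl rfl, fun _ _ => rfl, rfl⟩
  | @attach ta tb tg _ hb hg iha _ =>
    obtain ⟨a, k, h0, ha, hk, rfl⟩ := iha
    obtain ⟨β₀, hβ₀, -⟩ := hb.exists_assembly
    obtain ⟨β, rfl, hd, hs, rfl⟩ := combine_cases hβ₀ hg
    refine ⟨fun i => if i ≤ k then a i else (a k).union β, k + 1, by simpa using h0, ?_, ?_, ?_⟩
    · intro i
      rcases lt_trichotomy i k with hi | rfl | hi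
      · have h1 : i + 1 ≤ k := hi
        simpa [hi.le, h1] using ha i
      · right
        exact ⟨β, hb, by simpa using hd, by simpa using hs, by simp⟩
      · left
        have h1 : ¬ i ≤ k := by omega
        have h2 : ¬ i + 1 ≤ k := by omega
        simp [h1, h2]
    · intro i hi
      have h1 : ¬ i ≤ k := by omega
      simp [h1]
    · simp

theorem Reachable.producible {ta : Set Assembly} (h : 𝒯.Reachable ta) : 𝒯.Producible ta := by
  obtain ⟨a, k, h0, ha, hk, e⟩ := h.exists_growth
  exact ⟨a, a k, h0, ha, ha.isResult_of_const hk, e⟩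

theorem IsGrowth.reachable {a : ℕ → Assembly} (h : 𝒯.IsGrowth 𝒯.Reachable a)
    (h0 : (a 0).supertile ∈ 𝒯.init) (i : ℕ) : 𝒯.Reachable (a i).supertile := by
  induction i with
  | zero => exact .init h0
  | succ i ih =>
    rcases h i with e | ⟨γ, hγ, hd, hs, e⟩
    · rwa [e]
    · rw [e]
      exact .attach ih hγ (combine_mem hd hs)

/-- A finite producible supertile is assembled in finitely many attachments. -/
theorem Producible.reachable {α : Assembly} (h : 𝒯.Producible α.supertile) (hf : α.dom.Finite) :
    𝒯.Reachable α.supertile := by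
  obtain ⟨a, β, h0, ha, hr, e⟩ := h
  obtain ⟨u, rfl⟩ := exists_translate_of_supertile_eq e
  have hf' : (α.translate u).dom.Finite := by
    have : (α.translate u).dom = (fun p => p - u) ⁻¹' α.dom := rfl
    rw [this]
    exact hf.preimage (sub_left_injective.injOn)
  -- Each of the finitely many tiles appears at a finite stage, so one stage contains them all and
  -- equals the result.
  have : ∃ k, ∀ p ∈ (α.translate u).dom, p ∈ (a k).dom := by
    refine hf'.induction_on_subset (motive := fun s _ => ∃ k, ∀ p ∈ s, p ∈ (a k).dom) _ ⟨0, by simp⟩ ?_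
    rintro p s hp - - ⟨k, hk⟩
    obtain ⟨t, ht⟩ := hp
    obtain ⟨i, hi⟩ := (hr p t).1 ht
    refine ⟨max i k, fun q hq => ?_⟩
    rcases hq with rfl | hq
    · exact ⟨t, ha.sub (le_max_left i k) _ t hi⟩
    · exact (ha.sub (le_max_right i k)).dom_subset (hk q hq)
  obtain ⟨k, hk⟩ := this
  have e2 : a k = α.translate u := by
    funext p
    by_cases hp : p ∈ (α.translate u).dom
    · exact ((hr.sub k).apply_eq (hk p hp)).symm
    · rw [notMem_dom.1 hp, ← notMem_dom]
      exact fun h => hp ((hr.sub k).dom_subset h)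
  rw [← supertile_translate u, ← e2]
  exact ha.reachable h0 k

end TAS

/-! ## Scaling the strengths of all glues -/

/-- The glue `g` with its strength multiplied by `f`. -/
def Glue.scale (f : ℕ) (g : Glue) : Glue := ⟨g.label, f * g.strength⟩

/-- The tile type `t` with all strengths multiplied by `f`. -/
def TileType.scale (f : ℕ) (t : TileType) : TileType :=
  ⟨t.north.scale f, t.east.scale f, t.south.scale f, t.west.scale f⟩

theorem Glue.scale_injective {f : ℕ} (hf : 0 < f) : Function.Injective (Glue.scale f) := by
  rintro ⟨l, s⟩ ⟨l', s'⟩ h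
  simp only [Glue.scale, Glue.mk.injEq] at h ⊢
  exact ⟨h.1, Nat.eq_of_mul_eq_mul_left hf h.2⟩

theorem TileType.scale_injective {f : ℕ} (hf : 0 < f) : Function.Injective (TileType.scale f) := by
  rintro ⟨n, e, s, w⟩ ⟨n', e', s', w'⟩ h
  simp only [TileType.scale, TileType.mk.injEq] at h ⊢
  exact ⟨Glue.scale_injective hf h.1, Glue.scale_injective hf h.2.1,
    Glue.scale_injective hf h.2.2.1, Glue.scale_injective hf h.2.2.2⟩

namespace Assembly

/-- The assembly `α` with all strengths multiplied by `f`. -/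
def scale (f : ℕ) (α : Assembly) : Assembly := fun p => (α p).map (TileType.scale f)

variable {f : ℕ}

theorem scale_injective (hf : 0 < f) : Function.Injective (scale f) := by
  intro α β h
  funext p
  exact Option.map_injective (TileType.scale_injective hf) (congrFun h p)

theorem dom_scale (α : Assembly) : (α.scale f).dom = α.dom := by
  ext p
  simp [mem_dom, scale]

theorem scale_union (α β : Assembly) : (α.union β).scale f = (α.scale f).union (β.scale f) := by
  funext p
  simp only [scale, union]
  cases α p <;> simp

open Classical in
theorem bond_scale (hf : 0 < f) (α : Assembly) (p q : Pos) :
    (α.scale f).bond p q = f * α.bond p q := by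
  have h (g g' : Glue) : (if g.scale f = g'.scale f then (g.scale f).strength else 0) =
      f * if g = g' then g.strength else 0 := by
    simp only [(Glue.scale_injective hf).eq_iff, mul_ite, mul_zero]
    rfl
  unfold bond scale
  cases α p <;> cases α q <;>
    simp only [TileType.scale, h, Option.map_some, Option.map_none, mul_zero, mul_ite]

theorem stable_scale (hf : 0 < f) {τ : ℕ} {α : Assembly} :
    (α.scale f).Stable (f * τ) ↔ α.Stable τ := by
  simp only [Stable, dom_scale, bond_scale hf, ← Finset.mul_sum, Nat.mul_le_mul_left_iff hf]

theorem image_scale_supertile (α : Assembly) :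
    scale f '' α.supertile = (α.scale f).supertile := by
  ext β
  simp only [Set.mem_image, mem_supertile]
  constructor
  · rintro ⟨_, ⟨u, rfl⟩, rfl⟩
    exact ⟨u, rfl⟩
  · rintro ⟨u, rfl⟩
    exact ⟨_, ⟨u, rfl⟩, rfl⟩

theorem exists_scale_of_supertile_eq {α γ : Assembly}
    (h : γ.supertile = scale f '' α.supertile) :
    ∃ β : Assembly, γ = β.scale f ∧ β.supertile = α.supertile := by
  rw [image_scale_supertile] at h
  obtain ⟨u, rfl⟩ := exists_translate_of_supertile_eq h.symm
  exact ⟨α.translate u, rfl, supertile_translate u α⟩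

end Assembly

/-- Scaling is injective on glues, so abutting glues match after scaling exactly when they did
before, and all cut weights grow by the factor `f` together with the threshold. -/
theorem combine_scale {f : ℕ} (hf : 0 < f) (τ : ℕ) (ta tb : Set Assembly) :
    combine (f * τ) (scale f '' ta) (scale f '' tb) = Set.image (scale f) '' combine τ ta tb := by
  ext tg
  constructor
  · rintro ⟨_, ⟨α, hα, rfl⟩, _, ⟨β, hβ, rfl⟩, hd, hs, rfl⟩
    rw [← scale_union, stable_scale hf] at hs
    rw [dom_scale, dom_scale] at hd
    refine ⟨_, ⟨α, hα, β, hβ, hd, hs, rfl⟩, ?_⟩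
    rw [image_scale_supertile, scale_union]
  · rintro ⟨_, ⟨α, hα, β, hβ, hd, hs, rfl⟩, rfl⟩
    refine ⟨_, ⟨α, hα, rfl⟩, _, ⟨β, hβ, rfl⟩, ?_, ?_, ?_⟩
    · rwa [dom_scale, dom_scale]
    · rwa [← scale_union, stable_scale hf]
    · rw [image_scale_supertile, scale_union]

/-! ### The scaled system and its simulation of the original -/

namespace TAS

/-- The system `𝒯` with all strengths and the temperature multiplied by `f`. -/
def scale (f : ℕ) (hf : 0 < f) (𝒯 : TAS) : TAS where
  tiles := 𝒯.tiles.map ⟨TileType.scale f, TileType.scale_injective hf⟩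
  init := Set.image (Assembly.scale f) '' 𝒯.init
  temp := f * 𝒯.temp
  init_spec := by
    rintro _ ⟨ta, hta, rfl⟩
    obtain ⟨α, h1, h2, h3, rfl⟩ := 𝒯.init_spec ta hta
    refine ⟨α.scale f, ?_, ?_, (stable_scale hf).2 h3, image_scale_supertile α⟩
    · intro p t ht
      obtain ⟨s, hs, rfl⟩ := Option.map_eq_some_iff.1 ht
      exact Finset.mem_map_of_mem _ (h1 p s hs)
    · rwa [dom_scale]

variable {f : ℕ} {hf : 0 < f} {𝒯 : TAS}

theorem Reachable.scale {ta : Set Assembly} (h : 𝒯.Reachable ta) :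
    (𝒯.scale f hf).Reachable (Assembly.scale f '' ta) := by
  induction h with
  | init h => exact .init ⟨_, h, rfl⟩
  | attach _ _ hg iha ihb =>
    refine .attach iha ihb ?_
    change _ ∈ combine (f * 𝒯.temp) _ _
    rw [combine_scale hf]
    exact ⟨_, hg, rfl⟩

theorem Reachable.exists_of_scale {tb : Set Assembly} (h : (𝒯.scale f hf).Reachable tb) :
    ∃ ta, 𝒯.Reachable ta ∧ tb = Assembly.scale f '' ta := by
  induction h with
  | init h =>
    obtain ⟨ta, h, rfl⟩ := h
    exact ⟨ta, .init h, rfl⟩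
  | attach _ _ hg iha ihb =>
    obtain ⟨ta, ha, rfl⟩ := iha
    obtain ⟨tb, hb, rfl⟩ := ihb
    change _ ∈ combine (f * 𝒯.temp) _ _ at hg
    rw [combine_scale hf] at hg
    obtain ⟨tg, hg, rfl⟩ := hg
    exact ⟨tg, .attach ha hb hg, rfl⟩

theorem isGrowth_scale {P Q : Set Assembly → Prop} {a : ℕ → Assembly}
    (hPQ : ∀ ta, P ta → Q (Assembly.scale f '' ta)) (h : 𝒯.IsGrowth P a) :
    (𝒯.scale f hf).IsGrowth Q fun i => (a i).scale f := by
  intro i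
  rcases h i with e | ⟨γ, hγ, hd, hs, e⟩
  · left
    simp only [e]
  · right
    refine ⟨γ.scale f, ?_, ?_, ?_, ?_⟩
    · rw [← image_scale_supertile]
      exact hPQ _ hγ
    · rwa [dom_scale, dom_scale]
    · rw [← scale_union]
      exact (stable_scale hf).2 hs
    · simp only [e, scale_union]

theorem isResult_scale {a : ℕ → Assembly} {α : Assembly} (hf : 0 < f) :
    IsResult (fun i => (a i).scale f) (α.scale f) ↔ IsResult a α := by
  constructor
  · intro h p t
    have := h p (t.scale f)
    simpa [Assembly.scale, (TileType.scale_injective hf).eq_iff] using this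
  · intro h p t
    simp only [Assembly.scale, Option.map_eq_some_iff]
    constructor
    · rintro ⟨s, hs, rfl⟩
      obtain ⟨i, hi⟩ := (h p s).1 hs
      exact ⟨i, s, hi, rfl⟩
    · rintro ⟨i, s, hs, rfl⟩
      exact ⟨s, (h p s).2 ⟨i, hs⟩, rfl⟩

/-- Everything that enters the sequence is a scaled assembly, so every stage and the limit have
unscaled versions; injectivity of the scaling carries the equations back. -/
theorem exists_growth_of_scale {P Q : Set Assembly → Prop} {a : ℕ → Assembly} {α : Assembly}
    (hQ : ∀ tb, Q tb → ∃ β : Assembly, P β.supertile ∧ tb = Assembly.scale f '' β.supertile)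
    (h0 : ∃ b : Assembly, a 0 = b.scale f) (h : (𝒯.scale f hf).IsGrowth Q a) (hr : IsResult a α) :
    ∃ (b : ℕ → Assembly) (β : Assembly), a = (fun i => (b i).scale f) ∧ α = β.scale f ∧ 𝒯.IsGrowth P b ∧ IsResult b β := by
  have hQ' : ∀ γ : Assembly, Q γ.supertile → ∃ β : Assembly, γ = β.scale f ∧ P β.supertile := by
    intro γ hγ
    obtain ⟨β, hβ, e⟩ := hQ _ hγ
    obtain ⟨δ, hδ, e⟩ := exists_scale_of_supertile_eq e
    exact ⟨δ, hδ, e ▸ hβ⟩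
  have hb : ∀ i, ∃ b : Assembly, a i = b.scale f := by
    intro i
    induction i with
    | zero => exact h0
    | succ i ih =>
      rcases h i with e | ⟨γ, hγ, -, -, e⟩
      · rwa [e]
      · obtain ⟨b, hb⟩ := ih
        obtain ⟨β, rfl, -⟩ := hQ' γ hγ
        exact ⟨b.union β, by rw [e, hb, scale_union]⟩
  choose b hb using hb
  obtain rfl : a = fun i => (b i).scale f := funext hb
  have hβ : ∃ β : Assembly, α = β.scale f := by
    have : ∀ p, ∃ o : Option TileType, α p = o.map (TileType.scale f) := by
      intro p
      cases ht : α p with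
      | none => exact ⟨none, rfl⟩
      | some t =>
        obtain ⟨i, hi⟩ := (hr p t).1 ht
        exact ⟨b i p, hi.symm⟩
    choose β hβ using this
    exact ⟨β, funext hβ⟩
  obtain ⟨β, rfl⟩ := hβ
  refine ⟨b, β, rfl, rfl, ?_, (isResult_scale hf).1 hr⟩
  intro i
  rcases h i with e | ⟨γ, hγ, hd, hs, e⟩
  · exact Or.inl (scale_injective hf e)
  · obtain ⟨γ, rfl, hγ'⟩ := hQ' γ hγ
    rw [← scale_union] at e hs
    rw [dom_scale, dom_scale] at hd
    exact Or.inr ⟨γ, hγ', hd, (stable_scale hf).1 hs, scale_injective hf e⟩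

theorem Producible.scale {ta : Set Assembly} (h : 𝒯.Producible ta) :
    (𝒯.scale f hf).Producible (Assembly.scale f '' ta) := by
  obtain ⟨a, α, h0, hg, hr, rfl⟩ := h
  refine ⟨_, α.scale f, ?_, isGrowth_scale (fun _ h => h.scale) hg, (isResult_scale hf).2 hr,
    image_scale_supertile α⟩
  exact ⟨_, h0, image_scale_supertile _⟩

theorem Producible.exists_of_scale {tb : Set Assembly} (h : (𝒯.scale f hf).Producible tb) :
    ∃ ta, 𝒯.Producible ta ∧ tb = Assembly.scale f '' ta := by
  obtain ⟨a, α, ⟨ta, h0, e⟩, hg, hr, rfl⟩ := h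
  obtain ⟨β, -, -, -, rfl⟩ := 𝒯.init_spec _ h0
  obtain ⟨b₀, hb₀, e⟩ := exists_scale_of_supertile_eq e.symm
  obtain ⟨b, β, rfl, rfl, hb, hr⟩ := exists_growth_of_scale (P := 𝒯.Reachable) (fun tb htb => by
    obtain ⟨ta, hta, rfl⟩ := htb.exists_of_scale
    obtain ⟨β, rfl, -⟩ := hta.exists_assembly
    exact ⟨β, hta, rfl⟩) ⟨b₀, hb₀⟩ hg hr
  obtain rfl := scale_injective hf hb₀
  exact ⟨β.supertile, ⟨b, β, e ▸ h0, hb, hr, rfl⟩, (image_scale_supertile β).symm⟩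

theorem step_scale {ta tb : Set Assembly} :
    (𝒯.scale f hf).Step (Assembly.scale f '' ta) (Assembly.scale f '' tb) ↔ 𝒯.Step ta tb := by
  have hinj : Function.Injective (Set.image (Assembly.scale f)) :=
    (scale_injective hf).image_injective
  constructor
  · rintro ⟨tg, hg, h⟩
    obtain ⟨tg, hg', rfl⟩ := hg.exists_of_scale
    change _ ∈ combine (f * 𝒯.temp) _ _ at h
    rw [combine_scale hf] at h
    obtain ⟨tb', h, e⟩ := h
    exact ⟨tg, hg', hinj e ▸ h⟩
  · rintro ⟨tg, hg, h⟩
    refine ⟨_, hg.scale, ?_⟩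
    change _ ∈ combine (f * 𝒯.temp) _ _
    rw [combine_scale hf]
    exact ⟨tb, h, rfl⟩

theorem Grows.refl {ta : Set Assembly} {α : Assembly} (h : ta = α.supertile) : 𝒯.Grows ta ta :=
  ⟨fun _ => α, α, h.symm, fun _ => Or.inl rfl, fun _ _ => ⟨fun h => ⟨0, h⟩, fun ⟨_, h⟩ => h⟩, h⟩

open Classical in
/-- The representation function, at scale factor one, that undoes the scaling of strengths. -/
noncomputable def scaleRepr (f : ℕ) (hf : 0 < f) (𝒯 : TAS) :
    Repr (𝒯.scale f hf).tiles 𝒯.tiles 1 where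
  toFun b := if h : ∃ t ∈ 𝒯.tiles, b 0 = some (t.scale f) then some h.choose else none
  source := by
    intro b t h ij u hu
    obtain rfl : ij = 0 := Subsingleton.elim _ _
    split_ifs at h with h'
    obtain ⟨s, hs, e⟩ := h'
    rw [e, Option.some.injEq] at hu
    rw [← hu]
    exact Finset.mem_map_of_mem _ hs
  target := by
    intro b t h
    split_ifs at h with h'
    rw [Option.some.injEq] at h
    rw [← h]
    exact h'.choose_spec.1

theorem blockAt_one (α : Assembly) (x : Pos) : blockAt 1 α x = fun _ => α x := by
  funext ij
  simp [blockAt]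

theorem scaleRepr_onAssembly {α : Assembly} (h : α.Over 𝒯.tiles) :
    (scaleRepr f hf 𝒯).onAssembly (α.scale f) = α := by
  funext x
  simp only [Repr.onAssembly, scaleRepr, blockAt_one]
  split_ifs with h'
  · obtain ⟨-, h2⟩ := h'.choose_spec
    obtain ⟨s, hs, e⟩ := Option.map_eq_some_iff.1 h2
    rw [hs, TileType.scale_injective hf e]
  · rw [eq_comm, ← notMem_dom]
    rintro ⟨t, ht⟩
    exact h' ⟨t, h x t ht, by simp [Assembly.scale, ht]⟩

theorem scaleRepr_onSupertile {ta : Set Assembly} (h : 𝒯.Producible ta) :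
    (scaleRepr f hf 𝒯).onSupertile (Assembly.scale f '' ta) = ta := by
  obtain ⟨α, rfl, hα, -⟩ := h.exists_assembly
  rw [Repr.onSupertile, Set.image_image]
  conv_rhs => rw [← Set.image_id α.supertile]
  refine Set.image_congr ?_
  rintro _ ⟨u, rfl⟩
  exact scaleRepr_onAssembly (hα.translate u)

/-- Multiplying all strengths and the temperature by the same factor gives a simulation. -/
theorem simulates_scale (f : ℕ) (hf : 0 < f) (𝒯 : TAS) : Simulates (𝒯.scale f hf) 𝒯 := by
  refine ⟨1, one_pos, scaleRepr f hf 𝒯, ⟨?_, ?_⟩, ?_, ?_⟩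
  · ext tb
    constructor
    · rintro ⟨ta, hta, rfl⟩
      obtain ⟨ta, h, rfl⟩ := hta.exists_of_scale
      rw [scaleRepr_onSupertile h]
      exact h
    · intro h
      exact ⟨_, h.scale, scaleRepr_onSupertile h⟩
  · intro ta hta
    obtain ⟨ta, h, rfl⟩ := hta.exists_of_scale
    obtain ⟨α, rfl, hα, -⟩ := h.exists_assembly
    refine ⟨?_, ?_⟩
    · rw [scaleRepr_onSupertile h]
      exact ⟨α, hα, rfl⟩
    · rintro _ ⟨_, ⟨u, rfl⟩, rfl⟩
      left
      intro x ⟨ij, t, ht⟩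
      refine ⟨0, 0, by norm_num, ?_⟩
      rw [scaleRepr_onAssembly (hα.translate u)]
      rw [blockAt_one] at ht
      obtain ⟨s, hs, -⟩ := Option.map_eq_some_iff.1 ht
      exact ⟨s, by simpa using hs⟩
  · intro ta tb hta htb h
    obtain ⟨ta, ha, rfl⟩ := hta.exists_of_scale
    obtain ⟨tb, hb, rfl⟩ := htb.exists_of_scale
    rw [scaleRepr_onSupertile ha, scaleRepr_onSupertile hb]
    exact Or.inr (step_scale.1 h)
  -- A producible supertile has only one representative, so no preparatory growth is needed.
  · intro ta tb hta htb h ta' hta' e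
    obtain ⟨ta', h', rfl⟩ := hta'.exists_of_scale
    rw [scaleRepr_onSupertile h'] at e
    subst e
    obtain ⟨α, e, -⟩ := (hta.scale (f := f) (hf := hf)).exists_assembly
    exact ⟨_, _, hta.scale, scaleRepr_onSupertile hta, Grows.refl e, htb.scale,
      scaleRepr_onSupertile htb, step_scale.2 h⟩

end TAS

theorem classSimulates_of_dvd {k l : ℕ} (hl : 0 < l) (h : k ∣ l) :
    ClassSimulates (TwoHAM l) (TwoHAM k) := by
  obtain ⟨f, rfl⟩ := h
  intro 𝒯 h𝒯
  have hf : 0 < f := Nat.pos_of_mul_pos_left hl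
  refine ⟨𝒯.scale f hf, ?_, TAS.simulates_scale f hf 𝒯⟩
  change f * 𝒯.temp = k * f
  rw [show 𝒯.temp = k from h𝒯, mul_comm]

namespace Ladder

/-! ## A family of half-ladders

For each temperature `τ` we build a system whose initial supertiles are *pieces*, horizontal bars
with `τ` teeth that hang down and carry a glue of strength one at their tips, and *seeds*, horizontal
bars with several docks, each of which consists of `τ` upward teeth. A piece attaches to a dock if
all teeth match. -/

/-- The glue that holds pieces and seeds together. -/
def strong (τ : ℕ) : Glue := ⟨[false], τ⟩

/-- The glue at the tip of the tooth number `s`. -/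
def tip (s : ℕ) : Glue := ⟨List.replicate s true, 1⟩

/-- A glue without strength. -/
def mark (l : List Bool) : Glue := ⟨l, 0⟩

theorem tip_injective {s s' : ℕ} (h : tip s = tip s') : s = s' := by
  have := congrArg (fun g => g.label.length) h
  simpa [tip] using this

theorem mark_injective {l l' : List Bool} (h : mark l = mark l') : l = l' :=
  congrArg Glue.label h

theorem mark_ne_tip (l : List Bool) (s : ℕ) : mark l ≠ tip s :=
  fun h => by simpa [mark, tip] using congrArg Glue.strength h

theorem strong_ne_tip {τ : ℕ} (hτ : 2 ≤ τ) (s : ℕ) : strong τ ≠ tip s := by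
  intro h
  have : τ = 1 := congrArg Glue.strength h
  omega

theorem mark_ne_strong {τ : ℕ} (hτ : 2 ≤ τ) (l : List Bool) : mark l ≠ strong τ := by
  intro h
  have : 0 = τ := congrArg Glue.strength h
  omega

/-! ### Coordinates -/

variable {τ : ℕ}

/-- The column of the tooth number `s`. -/
def tooth (t : Fin τ → ℕ) (s : Fin τ) : ℤ := 10 * ((s : ℕ) + (τ : ℤ) * t s)

/-- The length of a piece. -/
def width (τ N : ℕ) : ℤ := 10 * ((τ : ℤ) * N)

/-- The distance between neighboring docks. -/
def pitch (τ N : ℕ) : ℤ := width τ N + 40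

/-- The first column of the dock number `k`. -/
def dock (τ N k : ℕ) : ℤ := 20 + k * pitch τ N

theorem width_nonneg (τ N : ℕ) : 0 ≤ width τ N := by
  unfold width
  positivity

theorem width_pos {N : ℕ} (hτ : 0 < τ) (hN : 0 < N) : 0 < width τ N := by
  unfold width
  positivity

theorem tooth_nonneg (t : Fin τ → ℕ) (s : Fin τ) : 0 ≤ tooth t s := by
  unfold tooth
  positivity

theorem tooth_le {N : ℕ} {t : Fin τ → ℕ} {s : Fin τ} (h : t s < N) :
    tooth t s + 10 ≤ width τ N := by
  have h1 : (s : ℤ) + 1 ≤ τ := by exact_mod_cast s.2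
  have h2 : (t s : ℤ) + 1 ≤ N := by exact_mod_cast h
  have h3 : (τ : ℤ) * (t s + 1) ≤ τ * N := mul_le_mul_of_nonneg_left h2 (by positivity)
  unfold tooth width
  linarith

/-- A tenth of the column is `s + τ * t s`, which determines `s` as its remainder modulo `τ` and
then `t s`. The factor ten leaves room for positions known only up to a few blocks. -/
theorem tooth_close {t t' : Fin τ → ℕ} {s s' : Fin τ} (h : tooth t s - tooth t' s' < 10)
    (h' : tooth t' s' - tooth t s < 10) : s = s' ∧ t s = t' s' := by
  have e : (s : ℕ) + τ * t s = s' + τ * t' s' := by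
    unfold tooth at h h'
    zify
    omega
  have e1 : s = s' := by
    have := congrArg (· % τ) e
    simpa [Nat.mod_eq_of_lt, Fin.ext_iff] using this
  subst e1
  have hτ : 0 < τ := s.pos
  exact ⟨rfl, Nat.eq_of_mul_eq_mul_left hτ (Nat.add_left_cancel e)⟩

theorem tooth_injective {t : Fin τ → ℕ} {s s' : Fin τ} (h : tooth t s = tooth t s') : s = s' :=
  (tooth_close (t := t) (t' := t) (by omega) (by omega)).1

theorem dock_add_pitch_le {N k l : ℕ} (h : k < l) : dock τ N k + pitch τ N ≤ dock τ N l := by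
  have h1 : (k : ℤ) + 1 ≤ l := by exact_mod_cast h
  have h2 : 0 ≤ pitch τ N := add_nonneg (width_nonneg τ N) (by norm_num)
  have := mul_le_mul_of_nonneg_right h1 h2
  unfold dock
  linarith

theorem dock_ge (τ N k : ℕ) : 20 ≤ dock τ N k := by
  have h2 : 0 ≤ pitch τ N := add_nonneg (width_nonneg τ N) (by norm_num)
  unfold dock
  have : 0 ≤ (k : ℤ) * pitch τ N := by positivity
  linarith

theorem dock_eq_of_close {N k l : ℕ} (h : dock τ N k - dock τ N l < pitch τ N)
    (h' : dock τ N l - dock τ N k < pitch τ N) : k = l := by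
  rcases lt_trichotomy k l with hkl | rfl | hkl
  · have := dock_add_pitch_le (τ := τ) (N := N) hkl
    omega
  · rfl
  · have := dock_add_pitch_le (τ := τ) (N := N) hkl
    omega

theorem width_injective (hτ : 0 < τ) {N N' : ℕ} (h : width τ N = width τ N') : N = N' := by
  unfold width at h
  have : τ * N = τ * N' := by
    zify
    omega
  exact Nat.eq_of_mul_eq_mul_left hτ this

/-! ### Pieces -/

/-- The tile of the bar of a piece in column `x`. -/
noncomputable def pieceBar (N : ℕ) (t : Fin τ → ℕ) (x : ℤ) : TileType :=
  open Classical in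
  { north := if x = 0 then mark [true] else if x = width τ N then mark [false] else mark []
    east := if x = width τ N then mark [] else strong τ
    south := if ∃ s, x = tooth t s then strong τ else mark []
    west := if x = 0 then mark [] else strong τ }

/-- The tile in row `y` of the tooth number `s` of a piece. -/
def pieceTooth (s : Fin τ) (y : ℤ) : TileType :=
  { north := strong τ
    east := mark []
    south := if y = 11 then tip s else strong τ
    west := mark [] }

open Classical in
/-- The piece of length `width τ N` with teeth in the columns `tooth t s`. -/
noncomputable def piece (N : ℕ) (t : Fin τ → ℕ) : Assembly := fun p =>
  if p.2 = 21 ∧ 0 ≤ p.1 ∧ p.1 ≤ width τ N then some (pieceBar N t p.1)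
  else if h : (11 ≤ p.2 ∧ p.2 ≤ 20) ∧ ∃ s, p.1 = tooth t s then some (pieceTooth h.2.choose p.2)
  else none

theorem piece_bar {N : ℕ} {t : Fin τ → ℕ} {x : ℤ} (h : 0 ≤ x) (h' : x ≤ width τ N) :
    piece N t (x, 21) = some (pieceBar N t x) := by
  simp [piece, h, h']

theorem piece_tooth {N : ℕ} {t : Fin τ → ℕ} {y : ℤ} (s : Fin τ) (h : 11 ≤ y) (h' : y ≤ 20) :
    piece N t (tooth t s, y) = some (pieceTooth s y) := by
  have hs : ∃ s', tooth t s = tooth t s' := ⟨s, rfl⟩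
  have h1 : y ≠ 21 := by omega
  have h2 : hs.choose = s := (tooth_injective hs.choose_spec).symm
  simp only [piece, h1, h, h', hs, false_and, if_false, and_self, dif_pos, h2]

theorem piece_cases {N : ℕ} {t : Fin τ → ℕ} {p : Pos} {a : TileType} (h : piece N t p = some a) :
    (∃ x, p = (x, 21) ∧ 0 ≤ x ∧ x ≤ width τ N ∧ a = pieceBar N t x) ∨
    ∃ s y, p = (tooth t s, y) ∧ 11 ≤ y ∧ y ≤ 20 ∧ a = pieceTooth s y := by
  obtain ⟨x, y⟩ := p
  simp only [piece] at h
  split_ifs at h with h1 h2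
  · obtain ⟨rfl, h1, h2⟩ := h1
    exact Or.inl ⟨x, rfl, h1, h2, (Option.some.inj h).symm⟩
  · refine Or.inr ⟨h2.2.choose, y, ?_, h2.1.1, h2.1.2, (Option.some.inj h).symm⟩
    rw [← h2.2.choose_spec]

theorem mem_piece_cases {N : ℕ} {t : Fin τ → ℕ} {p : Pos} (h : p ∈ (piece N t).dom) :
    (p.2 = 21 ∧ 0 ≤ p.1 ∧ p.1 ≤ width τ N) ∨ ∃ s, p.1 = tooth t s ∧ 11 ≤ p.2 ∧ p.2 ≤ 20 := by
  obtain ⟨a, ha⟩ := h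
  rcases piece_cases ha with ⟨x, rfl, h⟩ | ⟨s, y, rfl, h⟩
  · exact Or.inl ⟨rfl, h.1, h.2.1⟩
  · exact Or.inr ⟨s, rfl, h.1, h.2.1⟩

theorem mem_piece_box {N : ℕ} {t : Fin τ → ℕ} (ht : ∀ s, t s < N) {p : Pos}
    (h : p ∈ (piece N t).dom) : 0 ≤ p.1 ∧ p.1 ≤ width τ N ∧ 11 ≤ p.2 ∧ p.2 ≤ 21 := by
  rcases mem_piece_cases h with h | ⟨s, h⟩
  · omega
  · have := tooth_nonneg t s
    have := tooth_le (ht s)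
    omega

/-! ### Seeds -/

/-- The tile of the bar of a seed in column `x`. -/
noncomputable def seedBar (N : ℕ) (t : Fin τ → ℕ) (x : ℤ) : TileType :=
  open Classical in
  { north := if x = dock τ N N ∨ ∃ s, ∃ k < N, x = dock τ N k + tooth t s then strong τ else mark []
    east := if x = dock τ N N then mark [] else strong τ
    south := if x = 0 then mark [true] else mark []
    west := if x = 0 then mark [] else strong τ }

/-- The tile in row `y` of the tower of a seed. -/
def seedTower (τ : ℕ) (y : ℤ) : TileType :=
  { north := if y = 21 then mark [true, true] else strong τ
    east := mark []
    south := strong τ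
    west := mark [] }

/-- The tile in row `y` of a tooth number `s` of a seed. -/
def seedTooth (s : Fin τ) (y : ℤ) : TileType :=
  { north := if y = 10 then tip s else strong τ
    east := mark []
    south := strong τ
    west := mark [] }

open Classical in
/-- The seed with `N` docks for the piece with parameters `N` and `t`. -/
noncomputable def seed (N : ℕ) (t : Fin τ → ℕ) : Assembly := fun p =>
  if p.2 = 0 ∧ 0 ≤ p.1 ∧ p.1 ≤ dock τ N N then some (seedBar N t p.1)
  else if p.1 = dock τ N N ∧ 1 ≤ p.2 ∧ p.2 ≤ 21 then some (seedTower τ p.2)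
  else if h : (1 ≤ p.2 ∧ p.2 ≤ 10) ∧ ∃ s, ∃ k < N, p.1 = dock τ N k + tooth t s then
    some (seedTooth h.2.choose p.2)
  else none

theorem seed_bar {N : ℕ} {t : Fin τ → ℕ} {x : ℤ} (h : 0 ≤ x) (h' : x ≤ dock τ N N) :
    seed N t (x, 0) = some (seedBar N t x) := by
  simp [seed, h, h']

theorem seed_tower {N : ℕ} {t : Fin τ → ℕ} {y : ℤ} (h : 1 ≤ y) (h' : y ≤ 21) :
    seed N t (dock τ N N, y) = some (seedTower τ y) := by
  have h1 : y ≠ 0 := by omega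
  simp [seed, h, h', h1]

/-- All teeth of a dock lie within one width, which is smaller than the pitch, so the column
determines first the dock and then the tooth. -/
theorem dock_add_tooth_eq {N k k' : ℕ} {t : Fin τ → ℕ} (ht : ∀ s, t s < N) {s s' : Fin τ}
    (h : dock τ N k + tooth t s = dock τ N k' + tooth t s') : k = k' ∧ s = s' := by
  have h1 := tooth_nonneg t s
  have h2 := tooth_nonneg t s'
  have h3 := tooth_le (ht s)
  have h4 := tooth_le (ht s')
  have e : k = k' := dock_eq_of_close (τ := τ) (N := N) (by unfold pitch; omega)
    (by unfold pitch; omega)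
  subst e
  exact ⟨rfl, tooth_injective (t := t) (by omega)⟩

theorem dock_add_tooth_lt {N k : ℕ} {t : Fin τ → ℕ} (ht : ∀ s, t s < N) (hk : k < N) (s : Fin τ) :
    dock τ N k + tooth t s + 40 ≤ dock τ N N := by
  have h3 := tooth_le (ht s)
  have := dock_add_pitch_le (τ := τ) (N := N) hk
  unfold pitch at this
  omega

theorem seed_tooth {N : ℕ} {t : Fin τ → ℕ} (ht : ∀ s, t s < N) {y : ℤ} {k : ℕ} (hk : k < N)
    (s : Fin τ) (h : 1 ≤ y) (h' : y ≤ 10) :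
    seed N t (dock τ N k + tooth t s, y) = some (seedTooth s y) := by
  have hs : ∃ s', ∃ k' < N, dock τ N k + tooth t s = dock τ N k' + tooth t s' := ⟨s, k, hk, rfl⟩
  have h1 : y ≠ 0 := by omega
  have h2 : hs.choose = s := by
    obtain ⟨k', -, e⟩ := hs.choose_spec
    exact (dock_add_tooth_eq ht e).2.symm
  have h3 : dock τ N k + tooth t s ≠ dock τ N N := by
    have := dock_add_tooth_lt ht hk s
    omega
  simp only [seed, h1, h, h', h3, hs, false_and, if_false, and_self, dif_pos, h2]

theorem seed_cases {N : ℕ} {t : Fin τ → ℕ} {p : Pos} {a : TileType} (h : seed N t p = some a) :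
    (∃ x, p = (x, 0) ∧ 0 ≤ x ∧ x ≤ dock τ N N ∧ a = seedBar N t x) ∨
    (∃ y, p = (dock τ N N, y) ∧ 1 ≤ y ∧ y ≤ 21 ∧ a = seedTower τ y) ∨
    ∃ s k y, k < N ∧ p = (dock τ N k + tooth t s, y) ∧ 1 ≤ y ∧ y ≤ 10 ∧ a = seedTooth s y := by
  obtain ⟨x, y⟩ := p
  simp only [seed] at h
  split_ifs at h with h1 h2 h3
  · obtain ⟨rfl, h1, h2⟩ := h1
    exact Or.inl ⟨x, rfl, h1, h2, (Option.some.inj h).symm⟩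
  · obtain ⟨rfl, h1, h2⟩ := h2
    exact Or.inr (Or.inl ⟨y, rfl, h1, h2, (Option.some.inj h).symm⟩)
  · obtain ⟨k, hk, e⟩ := h3.2.choose_spec
    refine Or.inr (Or.inr ⟨h3.2.choose, k, y, hk, ?_, h3.1.1, h3.1.2, (Option.some.inj h).symm⟩)
    rw [← e]

theorem mem_seed_cases {N : ℕ} {t : Fin τ → ℕ} {p : Pos} (h : p ∈ (seed N t).dom) :
    (p.2 = 0 ∧ 0 ≤ p.1 ∧ p.1 ≤ dock τ N N) ∨ (p.1 = dock τ N N ∧ 1 ≤ p.2 ∧ p.2 ≤ 21) ∨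
    ∃ s, ∃ k < N, p.1 = dock τ N k + tooth t s ∧ 1 ≤ p.2 ∧ p.2 ≤ 10 := by
  obtain ⟨a, ha⟩ := h
  rcases seed_cases ha with ⟨x, rfl, h⟩ | ⟨y, rfl, h⟩ | ⟨s, k, y, hk, rfl, h⟩
  · exact Or.inl ⟨rfl, h.1, h.2.1⟩
  · exact Or.inr (Or.inl ⟨rfl, h.1, h.2.1⟩)
  · exact Or.inr (Or.inr ⟨s, k, hk, rfl, h.1, h.2.1⟩)

/-! ### Stability -/

theorem piece_stable {N : ℕ} {t : Fin τ → ℕ} (ht : ∀ s, t s < N) : (piece N t).Stable τ := by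
  -- Predecessors lie to the left along the bar and upward along a tooth, so the distance to the
  -- upper left corner decreases.
  refine Stable.of_parent (0, 21) (fun p => p.1.toNat + (21 - p.2).toNat) ?_
  rintro p ⟨a, ha⟩ hne
  rcases piece_cases ha with ⟨x, rfl, h0, h1, rfl⟩ | ⟨s, y, rfl, h0, h1, rfl⟩
  · have hx : x ≠ 0 := fun e => hne (by rw [e])
    have hb : piece N t (x - 1, 21) = some (pieceBar N t (x - 1)) :=
      piece_bar (by omega) (by omega)
    refine ⟨(x - 1, 21), ⟨_, hb⟩, by simp only; omega, ?_⟩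
    have e : ((x, 21) : Pos) = (x - 1, 21) + (1, 0) := by simp
    rw [bond_comm, e, bond_east hb (by rw [← e]; exact ha)]
    · have : x - 1 ≠ width τ N := by omega
      simp [pieceBar, this, strong]
    · have : x - 1 ≠ width τ N := by omega
      simp [pieceBar, this, hx]
  · have e : ((tooth t s, y + 1) : Pos) = (tooth t s, y) + (0, 1) := by simp
    have hb : ∃ b, piece N t (tooth t s, y + 1) = some b ∧ b.south = strong τ := by
      by_cases hy : y = 20
      · subst hy
        have := tooth_le (ht s)
        exact ⟨_, piece_bar (tooth_nonneg t s) (by omega), if_pos ⟨s, rfl⟩⟩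
      · exact ⟨_, piece_tooth s (by omega) (by omega), if_neg (by omega)⟩
    obtain ⟨b, hb, hbs⟩ := hb
    refine ⟨(tooth t s, y + 1), ⟨b, hb⟩, by simp only; omega, ?_⟩
    rw [e, bond_north ha (by rw [← e]; exact hb)]
    · exact le_refl _
    · rw [hbs]
      rfl

theorem seed_stable {N : ℕ} {t : Fin τ → ℕ} (ht : ∀ s, t s < N) : (seed N t).Stable τ := by
  have hpos := dock_ge τ N N
  -- Here predecessors lie to the left along the bar and downward along teeth and tower.
  refine Stable.of_parent (0, 0) (fun p => p.1.toNat + p.2.toNat) ?_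
  have up : ∀ x y a b, seed N t (x, y) = some a → 1 ≤ y → a.south = strong τ →
      seed N t (x, y - 1) = some b → b.north = strong τ →
      ∃ q ∈ (seed N t).dom, q.1.toNat + q.2.toNat < x.toNat + y.toNat ∧
        τ ≤ (seed N t).bond (x, y) q := by
    intro x y a b ha hy has hb hbn
    have e : ((x, y) : Pos) = (x, y - 1) + (0, 1) := by simp
    refine ⟨(x, y - 1), ⟨b, hb⟩, by simp only; omega, ?_⟩
    rw [bond_comm, e, bond_north hb (by rw [← e]; exact ha), hbn]
    · exact le_refl _
    · rw [hbn, has]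
  rintro p ⟨a, ha⟩ hne
  rcases seed_cases ha with ⟨x, rfl, h0, h1, rfl⟩ | ⟨y, rfl, h0, h1, rfl⟩ |
    ⟨s, k, y, hk, rfl, h0, h1, rfl⟩
  · have hx : x ≠ 0 := fun e => hne (by rw [e])
    have hb : seed N t (x - 1, 0) = some (seedBar N t (x - 1)) :=
      seed_bar (by omega) (by omega)
    refine ⟨(x - 1, 0), ⟨_, hb⟩, by simp only; omega, ?_⟩
    have e : ((x, 0) : Pos) = (x - 1, 0) + (1, 0) := by simp
    rw [bond_comm, e, bond_east hb (by rw [← e]; exact ha)]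
    · have : x - 1 ≠ dock τ N N := by omega
      simp [seedBar, this, strong]
    · have : x - 1 ≠ dock τ N N := by omega
      simp [seedBar, this, hx]
  · by_cases hy : y = 1
    · subst hy
      exact up _ _ _ _ ha h0 rfl (seed_bar (by omega) le_rfl) (if_pos (Or.inl rfl))
    · exact up _ _ _ _ ha h0 rfl (seed_tower (by omega) (by omega)) (if_neg (by omega))
  · by_cases hy : y = 1
    · subst hy
      have h1 := dock_add_tooth_lt ht hk s
      have h2 := tooth_nonneg t s
      have h3 := dock_ge τ N k
      exact up _ _ _ _ ha h0 rfl (seed_bar (by omega) (by omega)) (if_pos (Or.inr ⟨s, k, hk, rfl⟩))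
    · exact up _ _ _ _ ha h0 rfl (seed_tooth ht hk s (by omega) (by omega)) (if_neg (by omega))

/-! ### Tips and marks -/

theorem piece_south_tip (hτ : 2 ≤ τ) {N : ℕ} {t : Fin τ → ℕ} {p : Pos} {a : TileType} {s : Fin τ}
    (h : piece N t p = some a) (hs : a.south = tip s) : p = (tooth t s, 11) := by
  rcases piece_cases h with ⟨x, rfl, -, -, rfl⟩ | ⟨s', y, rfl, -, -, rfl⟩
  · simp only [pieceBar] at hs
    split_ifs at hs
    · exact absurd hs (strong_ne_tip hτ s)
    · exact absurd hs (mark_ne_tip _ s)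
  · simp only [pieceTooth] at hs
    split_ifs at hs with hy
    · rw [hy, Fin.ext (tip_injective hs)]
    · exact absurd hs (strong_ne_tip hτ s)

theorem piece_north_ne_tip (hτ : 2 ≤ τ) {N : ℕ} {t : Fin τ → ℕ} {p : Pos} {a : TileType} {s : ℕ}
    (h : piece N t p = some a) : a.north ≠ tip s := by
  rcases piece_cases h with ⟨x, rfl, -, -, rfl⟩ | ⟨s', y, rfl, -, -, rfl⟩
  · simp only [pieceBar]
    split_ifs <;> exact mark_ne_tip _ s
  · exact strong_ne_tip hτ s

theorem piece_north_mark (hτ : 2 ≤ τ) {N : ℕ} {t : Fin τ → ℕ} {p : Pos} {a : TileType}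
    {l : List Bool} (h : piece N t p = some a) (hl : a.north = mark l) :
    p.2 = 21 ∧ 0 ≤ p.1 ∧ p.1 ≤ width τ N ∧
      l = if p.1 = 0 then [true] else if p.1 = width τ N then [false] else [] := by
  rcases piece_cases h with ⟨x, rfl, h0, h1, rfl⟩ | ⟨s', y, rfl, -, -, rfl⟩
  · refine ⟨rfl, h0, h1, mark_injective ?_⟩
    rw [← hl]
    simp only [pieceBar]
    split_ifs <;> rfl
  · exact absurd hl.symm (mark_ne_strong hτ l)

theorem seed_south_ne_tip (hτ : 2 ≤ τ) {N : ℕ} {t : Fin τ → ℕ} {p : Pos} {a : TileType} {s : ℕ}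
    (h : seed N t p = some a) : a.south ≠ tip s := by
  rcases seed_cases h with ⟨x, rfl, -, -, rfl⟩ | ⟨y, rfl, -, -, rfl⟩ | ⟨s', k, y, -, rfl, -, -, rfl⟩
  · simp only [seedBar]
    split_ifs <;> exact mark_ne_tip _ s
  · exact strong_ne_tip hτ s
  · exact strong_ne_tip hτ s

theorem seed_north_tip (hτ : 2 ≤ τ) {N : ℕ} {t : Fin τ → ℕ} {p : Pos} {a : TileType} {s : Fin τ}
    (h : seed N t p = some a) (hs : a.north = tip s) :
    ∃ k < N, p = (dock τ N k + tooth t s, 10) := by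
  rcases seed_cases h with ⟨x, rfl, -, -, rfl⟩ | ⟨y, rfl, -, -, rfl⟩ | ⟨s', k, y, hk, rfl, -, -, rfl⟩
  · simp only [seedBar] at hs
    split_ifs at hs
    · exact absurd hs (strong_ne_tip hτ s)
    · exact absurd hs (mark_ne_tip _ s)
  · simp only [seedTower] at hs
    split_ifs at hs
    · exact absurd hs (mark_ne_tip _ s)
    · exact absurd hs (strong_ne_tip hτ s)
  · simp only [seedTooth] at hs
    split_ifs at hs with hy
    · exact ⟨k, hk, by rw [hy, Fin.ext (tip_injective hs)]⟩
    · exact absurd hs (strong_ne_tip hτ s)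

/-! ### Glues and neighbors -/

/-- The sides of the tile `a` at `p` carry admissible glues, and a strong side has a neighbor
in `D`. -/
structure Fits (τ : ℕ) (D : Set Pos) (p : Pos) (a : TileType) : Prop where
  north : a.north.strength = 0 ∨ (a.north = strong τ ∧ p + (0, 1) ∈ D) ∨ ∃ s : Fin τ, a.north = tip s
  east : a.east.strength = 0 ∨ (a.east = strong τ ∧ p + (1, 0) ∈ D)
  south : a.south.strength = 0 ∨ (a.south = strong τ ∧ p + (0, -1) ∈ D) ∨
    ∃ s : Fin τ, a.south = tip s
  west : a.west.strength = 0 ∨ (a.west = strong τ ∧ p + (-1, 0) ∈ D)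

/-- Every tile of `x` fits. -/
def Sound (τ : ℕ) (x : Assembly) : Prop := ∀ p a, x p = some a → Fits τ x.dom p a

theorem Fits.mono {D D' : Set Pos} {p : Pos} {a : TileType} (h : Fits τ D p a) (hD : D ⊆ D') :
    Fits τ D' p a where
  north := h.north.imp_right (Or.imp_left (And.imp_right (@hD _)))
  east := h.east.imp_right (And.imp_right (@hD _))
  south := h.south.imp_right (Or.imp_left (And.imp_right (@hD _)))
  west := h.west.imp_right (And.imp_right (@hD _))

theorem Sound.translate {x : Assembly} (h : Sound τ x) (u : Pos) : Sound τ (x.translate u) := by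
  intro p a ha
  have := h (p - u) a ha
  simpa only [sub_add_eq_add_sub] using
    (show Fits τ (x.translate u).dom p a from
      { north := by simpa only [mem_dom_translate, ← sub_add_eq_add_sub] using this.north
        east := by simpa only [mem_dom_translate, ← sub_add_eq_add_sub] using this.east
        south := by simpa only [mem_dom_translate, ← sub_add_eq_add_sub] using this.south
        west := by simpa only [mem_dom_translate, ← sub_add_eq_add_sub] using this.west })

theorem Sound.union {x y : Assembly} (hx : Sound τ x) (hy : Sound τ y) : Sound τ (x.union y) := by
  intro p a ha
  rw [dom_union]
  by_cases hp : p ∈ x.dom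
  · rw [union_of_mem hp] at ha
    exact (hx p a ha).mono Set.subset_union_left
  · rw [union_of_notMem hp] at ha
    exact (hy p a ha).mono Set.subset_union_right

theorem Sound.result {a : ℕ → Assembly} {x : Assembly} (h : ∀ i, Sound τ (a i))
    (hr : TAS.IsResult a x) : Sound τ x := by
  intro p b hb
  obtain ⟨i, hi⟩ := (hr p b).1 hb
  exact (h i p b hi).mono (hr.sub i).dom_subset

theorem piece_sound {N : ℕ} {t : Fin τ → ℕ} (ht : ∀ s, t s < N) : Sound τ (piece N t) := by
  intro p a ha
  rcases piece_cases ha with ⟨x, rfl, h0, h1, rfl⟩ | ⟨s, y, rfl, h0, h1, rfl⟩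
  · constructor
    · left
      simp only [pieceBar]
      split_ifs <;> rfl
    · simp only [pieceBar]
      split_ifs with h
      · exact Or.inl rfl
      · refine Or.inr ⟨rfl, pieceBar N t (x + 1), ?_⟩
        simpa using piece_bar (t := t) (show 0 ≤ x + 1 by omega) (by omega)
    · simp only [pieceBar]
      split_ifs with h
      · obtain ⟨s, rfl⟩ := h
        refine Or.inr (Or.inl ⟨rfl, pieceTooth s 20, ?_⟩)
        simpa using piece_tooth (N := N) s (by norm_num) (le_refl 20)
      · exact Or.inl rfl
    · simp only [pieceBar]
      split_ifs with h
      · exact Or.inl rfl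
      · refine Or.inr ⟨rfl, pieceBar N t (x + -1), ?_⟩
        simpa using piece_bar (t := t) (show 0 ≤ x + -1 by omega) (by omega)
  · constructor
    · right; left
      refine ⟨rfl, ?_⟩
      simp only [Prod.mk_add_mk, add_zero]
      by_cases hy : y = 20
      · subst hy
        have := tooth_le (ht s)
        exact ⟨_, piece_bar (tooth_nonneg t s) (by omega)⟩
      · exact ⟨_, piece_tooth s (by omega) (by omega)⟩
    · exact Or.inl rfl
    · simp only [pieceTooth]
      split_ifs with h
      · exact Or.inr (Or.inr ⟨s, rfl⟩)
      · refine Or.inr (Or.inl ⟨rfl, ?_⟩)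
        simp only [Prod.mk_add_mk, add_zero]
        exact ⟨_, piece_tooth s (by omega) (by omega)⟩
    · exact Or.inl rfl

theorem seed_sound {N : ℕ} {t : Fin τ → ℕ} (ht : ∀ s, t s < N) : Sound τ (seed N t) := by
  have hpos := dock_ge τ N N
  intro p a ha
  rcases seed_cases ha with ⟨x, rfl, h0, h1, rfl⟩ | ⟨y, rfl, h0, h1, rfl⟩ |
    ⟨s, k, y, hk, rfl, h0, h1, rfl⟩
  · constructor
    · simp only [seedBar]
      split_ifs with h
      · refine Or.inr (Or.inl ⟨rfl, ?_⟩)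
        simp only [Prod.mk_add_mk, add_zero, zero_add]
        rcases h with rfl | ⟨s, k, hk, rfl⟩
        · exact ⟨_, seed_tower le_rfl (by norm_num)⟩
        · exact ⟨_, seed_tooth ht hk s le_rfl (by norm_num)⟩
      · exact Or.inl rfl
    · simp only [seedBar]
      split_ifs with h
      · exact Or.inl rfl
      · refine Or.inr ⟨rfl, seedBar N t (x + 1), ?_⟩
        simpa using seed_bar (t := t) (show 0 ≤ x + 1 by omega) (by omega)
    · left
      simp only [seedBar]
      split_ifs <;> rfl
    · simp only [seedBar]
      split_ifs with h
      · exact Or.inl rfl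
      · refine Or.inr ⟨rfl, seedBar N t (x + -1), ?_⟩
        simpa using seed_bar (t := t) (show 0 ≤ x + -1 by omega) (by omega)
  · constructor
    · simp only [seedTower]
      split_ifs with h
      · exact Or.inl rfl
      · refine Or.inr (Or.inl ⟨rfl, ?_⟩)
        simp only [Prod.mk_add_mk, add_zero]
        exact ⟨_, seed_tower (by omega) (by omega)⟩
    · exact Or.inl rfl
    · refine Or.inr (Or.inl ⟨rfl, ?_⟩)
      simp only [Prod.mk_add_mk, add_zero]
      by_cases hy : y = 1
      · subst hy
        exact ⟨_, seed_bar (by omega) le_rfl⟩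
      · exact ⟨_, seed_tower (by omega) (by omega)⟩
    · exact Or.inl rfl
  · constructor
    · simp only [seedTooth]
      split_ifs with h
      · exact Or.inr (Or.inr ⟨s, rfl⟩)
      · refine Or.inr (Or.inl ⟨rfl, ?_⟩)
        simp only [Prod.mk_add_mk, add_zero]
        exact ⟨_, seed_tooth ht hk s (by omega) (by omega)⟩
    · exact Or.inl rfl
    · refine Or.inr (Or.inl ⟨rfl, ?_⟩)
      simp only [Prod.mk_add_mk, add_zero]
      by_cases hy : y = 1
      · subst hy
        have h1 := dock_add_tooth_lt ht hk s
        have h2 := tooth_nonneg t s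
        have h3 := dock_ge τ N k
        exact ⟨_, seed_bar (by omega) (by omega)⟩
      · exact ⟨_, seed_tooth ht hk s (by omega) (by omega)⟩
    · exact Or.inl rfl

/-- A bond between two disjoint sound assemblies joins two tips. -/
theorem Sound.crossing {x y : Assembly} (hx : Sound τ x)
    (hd : Disjoint x.dom y.dom) {p q : Pos} (hp : p ∈ x.dom) (hq : q ∈ y.dom)
    (hb : 0 < (x.union y).bond p q) :
    ∃ (s : Fin τ) (a b : TileType), x p = some a ∧ y q = some b ∧ (x.union y).bond p q = 1 ∧
      ((q = p + (0, 1) ∧ a.north = tip s ∧ b.south = tip s) ∨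
       (q = p + (0, -1) ∧ a.south = tip s ∧ b.north = tip s)) := by
  obtain ⟨a, b, ha, hb', h⟩ := bond_pos_cases hb
  rw [union_of_mem hp] at ha
  rw [union_of_mem_right hd hq] at hb'
  -- A strong side already faces a tile of `x`, so it cannot face a tile of `y`; only tips remain.
  have hno : ∀ w : Pos, q = p + w → p + w ∉ x.dom := by
    rintro w rfl h
    exact Set.disjoint_left.1 hd h hq
  have hf := hx p a ha
  rcases h with ⟨e, hg, hw⟩ | ⟨e, hg, hw⟩ | ⟨e, hg, hw⟩ | ⟨e, hg, hw⟩ <;> rw [hw] at hb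
  · rcases hf.north with h | h | ⟨s, hs⟩
    · omega
    · exact absurd h.2 (hno _ e)
    · exact ⟨s, a, b, ha, hb', by rw [hw, hs]; rfl, Or.inl ⟨e, hs, hg ▸ hs⟩⟩
  · rcases hf.east with h | h
    · omega
    · exact absurd h.2 (hno _ e)
  · rcases hf.south with h | h | ⟨s, hs⟩
    · omega
    · exact absurd h.2 (hno _ e)
    · exact ⟨s, a, b, ha, hb', by rw [hw, hs]; rfl, Or.inr ⟨e, hs, hg ▸ hs⟩⟩
  · rcases hf.west with h | h
    · omega
    · exact absurd h.2 (hno _ e)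

/-! ### The two kinds of assemblies -/

/-- An assembly that contains a seed, in which every downward tip is bound to an upward tip. -/
structure SeedLike (τ : ℕ) (x : Assembly) : Prop where
  sound : Sound τ x
  tips : ∀ p a (s : Fin τ), x p = some a → a.south = tip s →
    ∃ b, x (p + (0, -1)) = some b ∧ b.north = tip s
  seed : ∃ (N : ℕ) (t : Fin τ → ℕ) (u : Pos), (∀ s, t s < N) ∧ ((seed N t).translate u).Sub x

/-- A translation of a piece. -/
def PieceLike (τ : ℕ) (x : Assembly) : Prop :=
  ∃ (N : ℕ) (t : Fin τ → ℕ) (u : Pos), (∀ s, t s < N) ∧ x = (piece N t).translate u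

theorem seed_seedLike (hτ : 2 ≤ τ) {N : ℕ} {t : Fin τ → ℕ} (ht : ∀ s, t s < N) :
    SeedLike τ (seed N t) where
  sound := seed_sound ht
  tips := fun _ _ _ h hs => absurd hs (seed_south_ne_tip hτ h)
  seed := ⟨N, t, 0, ht, by rw [translate_zero]; exact Sub.refl _⟩

theorem SeedLike.translate {x : Assembly} (h : SeedLike τ x) (u : Pos) :
    SeedLike τ (x.translate u) where
  sound := h.sound.translate u
  tips := by
    intro p a s ha hs
    obtain ⟨b, hb, hbs⟩ := h.tips (p - u) a s ha hs
    refine ⟨b, ?_, hbs⟩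
    rwa [translate_apply, ← sub_add_eq_add_sub]
  seed := by
    obtain ⟨N, t, v, ht, hs⟩ := h.seed
    exact ⟨N, t, u + v, ht, by simpa using hs.translate u⟩

theorem PieceLike.translate {x : Assembly} (h : PieceLike τ x) (u : Pos) :
    PieceLike τ (x.translate u) := by
  obtain ⟨N, t, v, ht, rfl⟩ := h
  exact ⟨N, t, u + v, ht, Assembly.translate_translate _ _ _⟩

theorem PieceLike.sound {x : Assembly} (h : PieceLike τ x) : Sound τ x := by
  obtain ⟨N, t, v, ht, rfl⟩ := h
  exact (piece_sound ht).translate v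

theorem PieceLike.north_ne_tip (hτ : 2 ≤ τ) {x : Assembly} (h : PieceLike τ x) {p : Pos}
    {a : TileType} (ha : x p = some a) (s : ℕ) : a.north ≠ tip s := by
  obtain ⟨N, t, v, ht, rfl⟩ := h
  exact piece_north_ne_tip hτ ha

theorem PieceLike.nonempty {x : Assembly} (h : PieceLike τ x) : x.dom.Nonempty := by
  obtain ⟨N, t, v, ht, rfl⟩ := h
  refine ⟨(0, 21) + v, pieceBar N t 0, ?_⟩
  rw [translate_apply, add_sub_cancel_right]
  exact piece_bar le_rfl (width_nonneg τ N)

theorem SeedLike.nonempty {x : Assembly} (h : SeedLike τ x) : x.dom.Nonempty := by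
  obtain ⟨N, t, v, ht, hs⟩ := h.seed
  refine ⟨(0, 0) + v, seedBar N t 0, hs _ _ ?_⟩
  have := dock_ge τ N N
  rw [translate_apply, add_sub_cancel_right]
  exact seed_bar le_rfl (by omega)

/-- The seed has at least one dock and hence an upward tip, while the tips of a piece all point
down. -/
theorem SeedLike.not_pieceLike (hτ : 2 ≤ τ) {x : Assembly} (h : SeedLike τ x) :
    ¬ PieceLike τ x := by
  intro hp
  obtain ⟨N, t, v, ht, hs⟩ := h.seed
  have s : Fin τ := ⟨0, by omega⟩
  have hN : 0 < N := (Nat.zero_le _).trans_lt (ht s)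
  have : x ((dock τ N 0 + tooth t s, 10) + v) = some (seedTooth s 10) := by
    refine hs _ _ ?_
    rw [translate_apply, add_sub_cancel_right]
    exact seed_tooth ht hN s (by norm_num) le_rfl
  exact hp.north_ne_tip hτ this s (by simp [seedTooth])

/-- A bond would need an upward tip, and pieces have none. -/
theorem PieceLike.not_stable_union (hτ : 2 ≤ τ) {x y : Assembly} (hx : PieceLike τ x)
    (hy : PieceLike τ y) (hd : Disjoint x.dom y.dom) : ¬ (x.union y).Stable τ := by
  intro h
  obtain ⟨E, hE, hw⟩ := h.exists_crossing hd hx.nonempty hy.nonempty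
  rw [Finset.sum_eq_zero] at hw
  · omega
  intro e he
  by_contra hne
  obtain ⟨s, a, b, ha, hb, -, ⟨-, h1, -⟩ | ⟨-, -, h1⟩⟩ := hx.sound.crossing hd (hE e he).1
    (hE e he).2 (Nat.pos_of_ne_zero hne)
  · exact hx.north_ne_tip hτ ha s h1
  · exact hy.north_ne_tip hτ hb s h1

/-- A bond would join a downward tip of one assembly to an upward tip of the other. But the cell
below that downward tip is already occupied by its own assembly. -/
theorem SeedLike.not_stable_union (hτ : 2 ≤ τ) {x y : Assembly} (hx : SeedLike τ x)
    (hy : SeedLike τ y) (hd : Disjoint x.dom y.dom) : ¬ (x.union y).Stable τ := by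
  intro h
  obtain ⟨E, hE, hw⟩ := h.exists_crossing hd hx.nonempty hy.nonempty
  rw [Finset.sum_eq_zero] at hw
  · omega
  intro e he
  by_contra hne
  have hE1 := (hE e he).1
  have hE2 := (hE e he).2
  obtain ⟨s, a, b, ha, hb, -, ⟨e1, -, h1⟩ | ⟨e1, h1, -⟩⟩ := hx.sound.crossing hd hE1
    hE2 (Nat.pos_of_ne_zero hne)
  · obtain ⟨c, hc, -⟩ := hy.tips _ _ _ hb h1
    rw [e1, add_assoc, Prod.mk_add_mk] at hc
    norm_num at hc
    exact Set.disjoint_left.1 hd hE1 ⟨c, hc⟩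
  · obtain ⟨c, hc, -⟩ := hx.tips _ _ _ ha h1
    rw [← e1] at hc
    exact Set.disjoint_left.1 hd ⟨c, hc⟩ hE2

/-- If a piece attaches to an assembly, then all of its teeth are matched. -/
theorem tips_matched (hτ : 2 ≤ τ) {x : Assembly} (hx : SeedLike τ x) {N : ℕ} {t : Fin τ → ℕ}
    (ht : ∀ s, t s < N) {u : Pos} (hd : Disjoint x.dom ((piece N t).translate u).dom)
    (h : (x.union ((piece N t).translate u)).Stable τ) (s : Fin τ) :
    ∃ b, x ((tooth t s, 10) + u) = some b ∧ b.north = tip s := by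
  have hy : PieceLike τ ((piece N t).translate u) := ⟨N, t, u, ht, rfl⟩
  obtain ⟨E, hE, hw⟩ := h.exists_crossing hd hx.nonempty hy.nonempty
  by_contra hno
  classical
  set f : Fin τ → Pos × Pos := fun s => ((tooth t s, 10) + u, (tooth t s, 11) + u)
  -- There is only one possible bond per tooth, of strength one. With tooth `s` unmatched the total
  -- is at most `τ - 1`.
  have key : ∀ e ∈ E, 0 < (x.union ((piece N t).translate u)).bond e.1 e.2 →
      e ∈ (Finset.univ.erase s).image f ∧
        (x.union ((piece N t).translate u)).bond e.1 e.2 = 1 := by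
    intro e he hpos
    obtain ⟨s', a, b, ha, hb, h1, ⟨e1, h2, h3⟩ | ⟨-, -, h2⟩⟩ := hx.sound.crossing hd
      (hE e he).1 (hE e he).2 hpos
    · refine ⟨?_, h1⟩
      have e2 : e.2 = (tooth t s', 11) + u := by
        rw [← piece_south_tip hτ hb h3, sub_add_cancel]
      have e3 : e.1 = (tooth t s', 10) + u := by
        rw [e2] at e1
        have : ((tooth t s', 11) : Pos) = (tooth t s', 10) + (0, 1) := by simp
        rw [this, add_right_comm, add_left_inj] at e1
        exact e1.symm
      refine Finset.mem_image.2 ⟨s', Finset.mem_erase.2 ⟨?_, Finset.mem_univ _⟩,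
        Prod.ext e3.symm e2.symm⟩
      rintro rfl
      exact hno ⟨a, e3 ▸ ha, h2⟩
    · exact absurd h2 (hy.north_ne_tip hτ hb s')
  have h1 : ∑ e ∈ E, (x.union ((piece N t).translate u)).bond e.1 e.2 ≤
      ∑ e ∈ (Finset.univ.erase s).image f, 1 := by
    rw [← Finset.sum_filter_add_sum_filter_not E
      (fun e => 0 < (x.union ((piece N t).translate u)).bond e.1 e.2)]
    rw [Finset.sum_eq_zero (s := E.filter fun e => ¬ _) (by simp)]
    rw [add_zero]
    refine (Finset.sum_le_sum (g := fun _ => 1) fun e he => ?_).trans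
      (Finset.sum_le_sum_of_subset fun e he => ?_)
    · exact (key e (Finset.mem_filter.1 he).1 (Finset.mem_filter.1 he).2).2.le
    · exact (key e (Finset.mem_filter.1 he).1 (Finset.mem_filter.1 he).2).1
  have h2 : ((Finset.univ.erase s).image f).card ≤ τ - 1 :=
    Finset.card_image_le.trans (by simp)
  rw [Finset.sum_const, smul_eq_mul, mul_one] at h1
  omega

/-- What can attach to an assembly that contains a seed. -/
theorem SeedLike.attach (hτ : 2 ≤ τ) {x y : Assembly} (hx : SeedLike τ x)
    (hy : SeedLike τ y ∨ PieceLike τ y) (hd : Disjoint x.dom y.dom) (h : (x.union y).Stable τ) :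
    SeedLike τ (x.union y) ∧ ∃ (N : ℕ) (t : Fin τ → ℕ) (u : Pos), (∀ s, t s < N) ∧
      y = (piece N t).translate u ∧ ∀ s, ∃ b, x ((tooth t s, 10) + u) = some b ∧ b.north = tip s := by
  rcases hy with hy | hy
  · exact absurd h (hx.not_stable_union hτ hy hd)
  have hys := hy.sound
  obtain ⟨N, t, u, ht, rfl⟩ := hy
  have hm := tips_matched hτ hx ht hd h
  refine ⟨⟨hx.sound.union hys, ?_, ?_⟩, N, t, u, ht, rfl, hm⟩
  · intro p a s ha hs
    by_cases hp : p ∈ x.dom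
    · rw [union_of_mem hp] at ha
      obtain ⟨b, hb, h'⟩ := hx.tips p a s ha hs
      exact ⟨b, sub_union_left _ _ _ _ hb, h'⟩
    · rw [union_of_notMem hp] at ha
      obtain ⟨b, hb, h'⟩ := hm s
      refine ⟨b, sub_union_left _ _ _ _ ?_, h'⟩
      have e : p - u = (tooth t s, 11) := piece_south_tip hτ ha hs
      have e' : p + (0, -1) = (tooth t s, 10) + u := by
        rw [← sub_add_cancel p u, e, add_right_comm]
        simp
      rwa [e']
  · obtain ⟨N', t', v, ht', hs⟩ := hx.seed
    exact ⟨N', t', v, ht', hs.trans (sub_union_left _ _)⟩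

theorem seedLike_union (hτ : 2 ≤ τ) {x y : Assembly} (hx : SeedLike τ x ∨ PieceLike τ x)
    (hy : SeedLike τ y ∨ PieceLike τ y) (hd : Disjoint x.dom y.dom) (h : (x.union y).Stable τ) :
    SeedLike τ (x.union y) := by
  rcases hx with hx | hx
  · exact (hx.attach hτ hy hd h).1
  · rcases hy with hy | hy
    · rw [union_comm_of_disjoint hd] at h ⊢
      exact (hy.attach hτ (Or.inr hx) hd.symm h).1
    · exact absurd h (hx.not_stable_union hτ hy hd)

/-! ### The system -/

open Classical in
/-- All glues that occur on pieces and seeds. -/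
noncomputable def glues (τ : ℕ) : Finset Glue :=
  {strong τ, mark [], mark [true], mark [false], mark [true, true]} ∪
    Finset.univ.image fun s : Fin τ => tip s

open Classical in
/-- The tile types whose glues belong to `glues τ`. -/
noncomputable def tiles (τ : ℕ) : Finset TileType :=
  (glues τ ×ˢ glues τ ×ˢ glues τ ×ˢ glues τ).image fun g => ⟨g.1, g.2.1, g.2.2.1, g.2.2.2⟩

open Classical in
theorem mem_tiles {a : TileType} (h1 : a.north ∈ glues τ) (h2 : a.east ∈ glues τ)
    (h3 : a.south ∈ glues τ) (h4 : a.west ∈ glues τ) : a ∈ tiles τ :=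
  Finset.mem_image.2 ⟨(a.north, a.east, a.south, a.west), by simp [h1, h2, h3, h4], rfl⟩

theorem strong_mem : strong τ ∈ glues τ := by simp [glues]
theorem mark_mem : mark [] ∈ glues τ := by simp [glues]
theorem mark_true_mem : mark [true] ∈ glues τ := by simp [glues]
theorem mark_false_mem : mark [false] ∈ glues τ := by simp [glues]
theorem mark_true_true_mem : mark [true, true] ∈ glues τ := by simp [glues]
theorem tip_mem (s : Fin τ) : tip s ∈ glues τ := by simp [glues]

theorem piece_over (N : ℕ) (t : Fin τ → ℕ) : (piece N t).Over (tiles τ) := by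
  intro p a ha
  rcases piece_cases ha with ⟨x, rfl, -, -, rfl⟩ | ⟨s, y, rfl, -, -, rfl⟩ <;>
    apply mem_tiles <;> simp only [pieceBar, pieceTooth] <;> (try split_ifs) <;>
    first
      | exact strong_mem
      | exact mark_mem
      | exact mark_true_mem
      | exact mark_false_mem
      | exact tip_mem _

theorem seed_over (N : ℕ) (t : Fin τ → ℕ) : (seed N t).Over (tiles τ) := by
  intro p a ha
  rcases seed_cases ha with ⟨x, rfl, -, -, rfl⟩ | ⟨y, rfl, -, -, rfl⟩ |
      ⟨s, k, y, -, rfl, -, -, rfl⟩ <;>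
    apply mem_tiles <;> simp only [seedBar, seedTower, seedTooth] <;> (try split_ifs) <;>
    first
      | exact strong_mem
      | exact mark_mem
      | exact mark_true_mem
      | exact mark_true_true_mem
      | exact tip_mem _

theorem seed_nonempty (N : ℕ) (t : Fin τ → ℕ) : (seed N t).dom.Nonempty :=
  ⟨(0, 0), _, seed_bar le_rfl ((by norm_num : (0 : ℤ) ≤ 20).trans (dock_ge τ N N))⟩

theorem piece_nonempty (N : ℕ) (t : Fin τ → ℕ) : (piece N t).dom.Nonempty :=
  ⟨(0, 21), _, piece_bar le_rfl (width_nonneg τ N)⟩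

/-- The system at temperature `τ` whose initial supertiles are the seeds and the pieces. -/
noncomputable def system (τ : ℕ) : TAS where
  tiles := tiles τ
  init := {ta | ∃ (N : ℕ) (t : Fin τ → ℕ), (∀ s, t s < N) ∧
    (ta = (seed N t).supertile ∨ ta = (piece N t).supertile)}
  temp := τ
  init_spec := by
    rintro ta ⟨N, t, ht, rfl | rfl⟩
    · exact ⟨_, seed_over N t, seed_nonempty N t, seed_stable ht, rfl⟩
    · exact ⟨_, piece_over N t, piece_nonempty N t, piece_stable ht, rfl⟩

theorem kind_translate {x : Assembly} (h : SeedLike τ x ∨ PieceLike τ x) (u : Pos) :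
    SeedLike τ (x.translate u) ∨ PieceLike τ (x.translate u) :=
  h.imp (·.translate u) (·.translate u)

theorem kind_of_mem_supertile {x y : Assembly} (h : SeedLike τ x ∨ PieceLike τ x)
    (hy : y ∈ x.supertile) : SeedLike τ y ∨ PieceLike τ y := by
  obtain ⟨u, rfl⟩ := hy
  exact kind_translate h u

theorem kind_of_reachable (hτ : 2 ≤ τ) {ta : Set Assembly} (h : (system τ).Reachable ta) :
    ∀ x ∈ ta, SeedLike τ x ∨ PieceLike τ x := by
  induction h with
  | init h =>
    obtain ⟨N, t, ht, rfl | rfl⟩ := h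
    · exact fun x hx => kind_of_mem_supertile (Or.inl (seed_seedLike hτ ht)) hx
    · refine fun x hx => kind_of_mem_supertile (Or.inr ⟨N, t, 0, ht, ?_⟩) hx
      rw [translate_zero]
  | attach _ _ hg iha ihb =>
    obtain ⟨α, hα, β, hβ, hd, hs, rfl⟩ := hg
    exact fun x hx => kind_of_mem_supertile
      (Or.inl (seedLike_union hτ (iha α hα) (ihb β hβ) hd hs)) hx

/-- Every producible supertile is a piece or contains a seed. -/
theorem kind_of_producible (hτ : 2 ≤ τ) {ta : Set Assembly} (h : (system τ).Producible ta) :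
    ∀ x ∈ ta, SeedLike τ x ∨ PieceLike τ x := by
  obtain ⟨a, α, h0, hg, hr, rfl⟩ := h
  have h0' := kind_of_reachable hτ (.init h0) (a 0) (self_mem_supertile _)
  have step : ∀ i, a (i + 1) = a i ∨
      ((SeedLike τ (a i) ∨ PieceLike τ (a i)) → SeedLike τ (a (i + 1))) := by
    intro i
    rcases hg i with e | ⟨γ, hγ, hd, hs, e⟩
    · exact Or.inl e
    · right
      intro hi
      rw [e]
      exact seedLike_union hτ hi (kind_of_reachable hτ hγ γ (self_mem_supertile _)) hd hs
  have hk : ∀ i, SeedLike τ (a i) ∨ PieceLike τ (a i) := by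
    intro i
    induction i with
    | zero => exact h0'
    | succ i ih =>
      rcases step i with e | e
      · rwa [e]
      · exact Or.inl (e ih)
  suffices hα : SeedLike τ α ∨ PieceLike τ α from fun x hx => kind_of_mem_supertile hα hx
  -- A seed, once present, stays, and the tip condition passes to the limit. Without a seed no
  -- attachment ever happens and the result is the initial piece.
  by_cases hex : ∃ i, SeedLike τ (a i)
  · left
    obtain ⟨i, hi⟩ := hex
    have hge : ∀ j, i ≤ j → SeedLike τ (a j) := by
      intro j hj
      induction j, hj using Nat.le_induction with
      | base => exact hi
      | succ j _ ih =>
        rcases step j with e | e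
        · rwa [e]
        · exact e (Or.inl ih)
    refine ⟨Sound.result (fun j => (hk j).elim (·.sound) (·.sound)) hr, ?_, ?_⟩
    · intro p b s hb hs
      obtain ⟨j, hj⟩ := (hr p b).1 hb
      obtain ⟨c, hc, hcs⟩ := (hge _ (le_max_left i j)).tips p b s
        (hg.sub (le_max_right i j) p b hj) hs
      exact ⟨c, hr.sub _ _ _ hc, hcs⟩
    · obtain ⟨N, t, u, ht, hs⟩ := hi.seed
      exact ⟨N, t, u, ht, hs.trans (hr.sub i)⟩
  · right
    have hc : ∀ i, a i = a 0 := by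
      intro i
      induction i with
      | zero => rfl
      | succ i ih =>
        rcases step i with e | e
        · rw [e, ih]
        · exact absurd ⟨_, e (hk i)⟩ hex
    rw [hr.eq (hg.isResult_of_const (k := 0) fun i _ => hc i)]
    exact h0'.resolve_left fun h => hex ⟨0, h⟩

/-! ### Seeds with some docks filled -/

/-- The seed with pieces in the first `k` docks. -/
noncomputable def chain (N : ℕ) (t : Fin τ → ℕ) : ℕ → Assembly
  | 0 => seed N t
  | k + 1 => (chain N t k).union ((piece N t).translate (dock τ N k, 0))

variable {N : ℕ} {t : Fin τ → ℕ}

theorem chain_cases {k : ℕ} {p : Pos} {a : TileType} (h : chain N t k p = some a) :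
    seed N t p = some a ∨ ∃ k' < k, piece N t (p - (dock τ N k', 0)) = some a := by
  induction k with
  | zero => exact Or.inl h
  | succ k ih =>
    rw [chain] at h
    by_cases hp : p ∈ (chain N t k).dom
    · rw [union_of_mem hp] at h
      exact (ih h).imp_right fun ⟨k', hk', h⟩ => ⟨k', hk'.trans (Nat.lt_succ_self k), h⟩
    · rw [union_of_notMem hp] at h
      exact Or.inr ⟨k, Nat.lt_succ_self k, h⟩

theorem mem_chain_cases {k : ℕ} {p : Pos} (h : p ∈ (chain N t k).dom) :
    p ∈ (seed N t).dom ∨ ∃ k' < k, p - (dock τ N k', 0) ∈ (piece N t).dom := by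
  obtain ⟨a, ha⟩ := h
  exact (chain_cases ha).imp (fun h => ⟨a, h⟩) fun ⟨k', hk', h⟩ => ⟨k', hk', a, h⟩

theorem seed_sub_chain (N : ℕ) (t : Fin τ → ℕ) (k : ℕ) : (seed N t).Sub (chain N t k) := by
  induction k with
  | zero => exact Sub.refl _
  | succ k ih => exact ih.trans (sub_union_left _ _)

theorem chain_disjoint (ht : ∀ s, t s < N) {k : ℕ} (hk : k < N) :
    Disjoint (chain N t k).dom ((piece N t).translate (dock τ N k, 0)).dom := by
  rw [Set.disjoint_left]
  intro p hp hq
  rw [mem_dom_translate] at hq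
  have h1 := mem_piece_box ht hq
  have h2 := dock_add_pitch_le (τ := τ) (N := N) hk
  simp only [Prod.fst_sub, Prod.snd_sub, pitch] at h1 h2
  rcases mem_chain_cases hp with h | ⟨k', hk', h⟩
  · rcases mem_seed_cases h with h | h | ⟨s, k', -, h⟩ <;> omega
  · have h3 := mem_piece_box ht h
    have h4 := dock_add_pitch_le (τ := τ) (N := N) hk'
    simp only [Prod.fst_sub, Prod.snd_sub, pitch] at h3 h4
    omega

theorem piece_sub_chain (ht : ∀ s, t s < N) {k k' : ℕ} (hk : k ≤ N) (hk' : k' < k) :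
    ((piece N t).translate (dock τ N k', 0)).Sub (chain N t k) := by
  induction k with
  | zero => omega
  | succ k ih =>
    rcases Nat.lt_succ_iff_lt_or_eq.1 hk' with h | rfl
    · exact (ih (by omega) h).trans (sub_union_left _ _)
    · exact sub_union_right (chain_disjoint ht (by omega))

/-- The `τ` tips of the dock meet those of the piece, each with a bond of strength one, so the total
is exactly `τ`. -/
theorem chain_succ_stable (ht : ∀ s, t s < N) {k : ℕ} (hk : k < N)
    (h : (chain N t k).Stable τ) : (chain N t (k + 1)).Stable τ := by
  have hd := chain_disjoint ht hk
  classical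
  have h1 (s : Fin τ) : chain N t k (dock τ N k + tooth t s, 10) = some (seedTooth s 10) :=
    seed_sub_chain N t k _ _ (seed_tooth ht hk s (by norm_num) le_rfl)
  have h2 (s : Fin τ) : (piece N t).translate (dock τ N k, 0) (dock τ N k + tooth t s, 11) =
      some (pieceTooth s 11) := by
    have : ((dock τ N k + tooth t s, 11) - (dock τ N k, 0) : Pos) = (tooth t s, 11) := by simp
    rw [translate_apply, this]
    exact piece_tooth s le_rfl (by norm_num)
  refine h.union ((piece_stable ht).translate _) hd (Finset.univ.image fun s : Fin τ =>
    ((dock τ N k + tooth t s, 10), (dock τ N k + tooth t s, 11))) ?_ ?_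
  · intro e he
    obtain ⟨s, -, rfl⟩ := Finset.mem_image.1 he
    exact ⟨⟨_, h1 s⟩, ⟨_, h2 s⟩⟩
  · rw [Finset.sum_image]
    · rw [Finset.sum_congr rfl (g := fun _ => 1)]
      · simp
      · intro s _
        have e : ((dock τ N k + tooth t s, 11) : Pos) = (dock τ N k + tooth t s, 10) + (0, 1) := by
          simp
        have h1' := h1 s
        have h2' := h2 s
        rw [← union_of_mem (β := (piece N t).translate (dock τ N k, 0)) ⟨_, h1 s⟩] at h1'
        rw [← union_of_mem_right hd ⟨_, h2 s⟩] at h2'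
        simp only
        rw [e] at h2' ⊢
        rw [bond_north h1' h2']
        · simp [seedTooth, tip]
        · simp [seedTooth, pieceTooth]
    · intro s _ s' _ e
      simp only [Prod.mk.injEq, add_right_inj] at e
      exact tooth_injective e.1.1

theorem chain_stable (ht : ∀ s, t s < N) {k : ℕ} (hk : k ≤ N) : (chain N t k).Stable τ := by
  induction k with
  | zero => exact seed_stable ht
  | succ k ih => exact chain_succ_stable ht hk (ih (by omega))

theorem chain_seedLike (hτ : 2 ≤ τ) (ht : ∀ s, t s < N) {k : ℕ} (hk : k ≤ N) :
    SeedLike τ (chain N t k) := by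
  induction k with
  | zero => exact seed_seedLike hτ ht
  | succ k ih =>
    exact ((ih (by omega)).attach hτ (Or.inr ⟨N, t, _, ht, rfl⟩) (chain_disjoint ht hk)
      (chain_stable ht hk)).1

theorem piece_reachable (ht : ∀ s, t s < N) : (system τ).Reachable (piece N t).supertile :=
  .init ⟨N, t, ht, Or.inr rfl⟩

theorem chain_mem_combine (ht : ∀ s, t s < N) {k : ℕ} (hk : k < N) :
    (chain N t (k + 1)).supertile ∈ combine (system τ).temp (chain N t k).supertile
      (piece N t).supertile := by
  rw [← supertile_translate (dock τ N k, 0) (piece N t)]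
  exact combine_mem (chain_disjoint ht hk) (chain_stable (k := k + 1) ht hk)

theorem chain_reachable (ht : ∀ s, t s < N) {k : ℕ} (hk : k ≤ N) :
    (system τ).Reachable (chain N t k).supertile := by
  induction k with
  | zero => exact .init ⟨N, t, ht, Or.inl rfl⟩
  | succ k ih => exact .attach (ih (by omega)) (piece_reachable ht) (chain_mem_combine ht hk)

theorem chain_step (ht : ∀ s, t s < N) {k : ℕ} (hk : k < N) :
    (system τ).Step (chain N t k).supertile (chain N t (k + 1)).supertile :=
  ⟨_, (piece_reachable ht).producible, chain_mem_combine ht hk⟩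

theorem chain_north_tip (hτ : 2 ≤ τ) {k : ℕ} {p : Pos} {a : TileType} {s : Fin τ}
    (h : chain N t k p = some a) (hs : a.north = tip s) :
    ∃ k < N, p = (dock τ N k + tooth t s, 10) := by
  rcases chain_cases h with h | ⟨k', -, h⟩
  · exact seed_north_tip hτ h hs
  · exact absurd hs (piece_north_ne_tip hτ h)

theorem chain_south_tip (hτ : 2 ≤ τ) {k : ℕ} {p : Pos} {a : TileType} {s : Fin τ}
    (h : chain N t k p = some a) (hs : a.south = tip s) :
    ∃ k' < k, p = (dock τ N k' + tooth t s, 11) := by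
  rcases chain_cases h with h | ⟨k', hk', h⟩
  · exact absurd hs (seed_south_ne_tip hτ h)
  · refine ⟨k', hk', ?_⟩
    rw [← sub_add_cancel p (dock τ N k', 0), piece_south_tip hτ h hs]
    simp [add_comm]

/-- The marks have no strength and serve only to locate a subassembly: this one pins the lower left
corner of any seed contained in the chain. -/
theorem chain_south_mark (hτ : 2 ≤ τ) {k : ℕ} {p : Pos} {a : TileType}
    (h : chain N t k p = some a) (hs : a.south = mark [true]) : p = (0, 0) := by
  rcases chain_cases h with h | ⟨k', hk', h⟩
  · rcases seed_cases h with ⟨x, rfl, -, -, rfl⟩ | ⟨y, rfl, -, -, rfl⟩ |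
      ⟨s', k, y, -, rfl, -, -, rfl⟩
    · simp only [seedBar] at hs
      split_ifs at hs with h0
      · rw [h0]
      · exact absurd (mark_injective hs) (by simp)
    · exact absurd hs.symm (mark_ne_strong hτ _)
    · exact absurd hs.symm (mark_ne_strong hτ _)
  · rcases piece_cases h with ⟨x, -, -, -, rfl⟩ | ⟨s', y, -, -, -, rfl⟩
    · simp only [pieceBar] at hs
      split_ifs at hs with h0
      · exact absurd hs.symm (mark_ne_strong hτ _)
      · exact absurd (mark_injective hs) (by simp)
    · simp only [pieceTooth] at hs
      split_ifs at hs with h0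
      · exact absurd hs.symm (mark_ne_tip _ _)
      · exact absurd hs.symm (mark_ne_strong hτ _)

/-- These marks pin the top of the tower and the two ends of every docked piece. -/
theorem chain_north_mark (hτ : 2 ≤ τ) {k : ℕ} {p : Pos} {a : TileType} {l : List Bool}
    (h : chain N t k p = some a) (hl : a.north = mark l) :
    l = [] ∨ (l = [true, true] ∧ p = (dock τ N N, 21)) ∨ ∃ k' < k,
      (l = [true] ∧ p = (dock τ N k', 21)) ∨ (l = [false] ∧ p = (dock τ N k' + width τ N, 21)) := by
  rcases chain_cases h with h | ⟨k', hk', h⟩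
  · rcases seed_cases h with ⟨x, rfl, -, -, rfl⟩ | ⟨y, rfl, -, -, rfl⟩ |
      ⟨s', k, y, -, rfl, -, -, rfl⟩
    · simp only [seedBar] at hl
      split_ifs at hl with h0
      · exact absurd hl.symm (mark_ne_strong hτ _)
      · exact Or.inl (mark_injective hl).symm
    · simp only [seedTower] at hl
      split_ifs at hl with h0
      · exact Or.inr (Or.inl ⟨(mark_injective hl).symm, by rw [h0]⟩)
      · exact absurd hl.symm (mark_ne_strong hτ _)
    · simp only [seedTooth] at hl
      split_ifs at hl with h0
      · exact absurd hl.symm (mark_ne_tip _ _)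
      · exact absurd hl.symm (mark_ne_strong hτ _)
  · obtain ⟨h1, -, -, h2⟩ := piece_north_mark hτ h hl
    simp only [Prod.snd_sub, Prod.fst_sub, sub_zero] at h1 h2
    split_ifs at h2 with h3 h4
    · exact Or.inr (Or.inr ⟨k', hk', Or.inl ⟨h2, Prod.ext (by simp only; omega) h1⟩⟩)
    · exact Or.inr (Or.inr ⟨k', hk', Or.inr ⟨h2, Prod.ext (by simp only; omega) h1⟩⟩)
    · exact Or.inl h2

/-- The only piece inside a partially filled seed is the one that belongs to it. -/
theorem piece_sub_chain_unique (hτ : 2 ≤ τ) (ht : ∀ s, t s < N) {k : ℕ} (hk : k ≤ N) {N' : ℕ}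
    {t' : Fin τ → ℕ} (ht' : ∀ s, t' s < N') {v : Pos}
    (h : ((piece N' t').translate v).Sub (chain N t k)) : N' = N ∧ t' = t := by
  have hN' : 0 < N' := (Nat.zero_le _).trans_lt (ht' ⟨0, by omega⟩)
  have hN : 0 < N := (Nat.zero_le _).trans_lt (ht ⟨0, by omega⟩)
  have hw := width_pos (τ := τ) (by omega) hN
  have hw' := width_pos (τ := τ) (by omega) hN'
  have hsub : ∀ p a, piece N' t' p = some a → chain N t k (p + v) = some a := by
    intro p a ha
    refine h _ _ ?_
    rwa [translate_apply, add_sub_cancel_right]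
  obtain ⟨k1, hk1, e1⟩ : ∃ k1 < k, (0, 21) + v = (dock τ N k1, 21) := by
    have hl : (pieceBar N' t' 0).north = mark [true] := by simp [pieceBar]
    simpa using chain_north_mark hτ (hsub _ _ (piece_bar le_rfl hw'.le)) hl
  obtain ⟨k2, hk2, e2⟩ : ∃ k2 < k, (width τ N', 21) + v = (dock τ N k2 + width τ N, 21) := by
    have hl : (pieceBar N' t' (width τ N')).north = mark [false] := by
      simp [pieceBar, hw'.ne']
    simpa using chain_north_mark hτ (hsub _ _ (piece_bar hw'.le le_rfl)) hl
  have hv1 : v.1 = dock τ N k1 := by simpa using congrArg Prod.fst e1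
  have hv2 : v.2 = 0 := by simpa using congrArg Prod.snd e1
  have hv3 : width τ N' + v.1 = dock τ N k2 + width τ N := congrArg Prod.fst e2
  -- If the right end lay in a later dock, the longer bar would be unmarked where the piece in dock
  -- `k1` carries its right-end mark. In an earlier dock it would lie to the left of the left end.
  have e : k1 = k2 := by
    rcases lt_trichotomy k1 k2 with hlt | rfl | hlt
    · exfalso
      have h1 := dock_add_pitch_le (τ := τ) (N := N) hlt
      unfold pitch at h1
      have h2 := hsub _ _ (piece_bar (t := t') hw.le (by omega : width τ N ≤ width τ N'))
      have h3 := piece_sub_chain ht hk hk1 ((width τ N, 21) + v) (pieceBar N t (width τ N)) (by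
        have : v = (dock τ N k1, 0) := Prod.ext hv1 hv2
        rw [translate_apply, ← this, add_sub_cancel_right]
        exact piece_bar hw.le le_rfl)
      rw [h2, Option.some.injEq] at h3
      have h4 := congrArg TileType.north h3
      have h5 : width τ N ≠ width τ N' := by omega
      simp only [pieceBar, hw.ne', h5, if_false, if_true] at h4
      exact absurd (mark_injective h4) (by simp)
    · rfl
    · exfalso
      have h1 := dock_add_pitch_le (τ := τ) (N := N) hlt
      unfold pitch at h1
      omega
  subst e
  have hNN : N' = N := width_injective (τ := τ) (by omega) (by omega)
  subst hNN
  refine ⟨rfl, funext fun s => ?_⟩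
  -- With the frame and the length fixed, each downward tip reveals the column of its tooth.
  obtain ⟨k3, -, e3⟩ := chain_south_tip hτ (hsub _ _ (piece_tooth s le_rfl (by norm_num)))
    (show (pieceTooth s 11).south = tip s by simp [pieceTooth])
  have hv4 : tooth t' s + v.1 = dock τ N' k3 + tooth t s := congrArg Prod.fst e3
  rw [hv1, add_comm] at hv4
  have h1 := tooth_nonneg t s
  have h2 := tooth_nonneg t' s
  have h3 := tooth_le (ht s)
  have h4 := tooth_le (ht' s)
  have e : k1 = k3 := dock_eq_of_close (τ := τ) (N := N') (by unfold pitch; omega)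
    (by unfold pitch; omega)
  subst e
  exact (tooth_close (s := s) (s' := s) (t := t') (t' := t) (by omega) (by omega)).2

/-- From what a partially filled seed can be produced in at most one step. -/
theorem stepLE_chain (hτ : 2 ≤ τ) (ht : ∀ s, t s < N) {k : ℕ} (hk : k ≤ N) {ta : Set Assembly}
    (hta : (system τ).Producible ta) (h : (system τ).StepLE ta (chain N t k).supertile) :
    ta = (piece N t).supertile ∨
      ∃ x : Assembly, ta = x.supertile ∧ (0, 0) ∈ x.dom ∧ (dock τ N N, 21) ∈ x.dom := by
  have hpos := dock_ge τ N N
  rcases h with rfl | ⟨tg, -, α, hα, β, -, hd, -, e⟩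
  · right
    refine ⟨_, rfl, ?_, ?_⟩
    · exact ⟨_, seed_sub_chain N t k _ _ (seed_bar le_rfl (by omega))⟩
    · exact ⟨_, seed_sub_chain N t k _ _ (seed_tower (by norm_num) le_rfl)⟩
  · obtain ⟨u, hu⟩ := exists_translate_of_supertile_eq e.symm
    have hs : (α.translate u).Sub (chain N t k) := by
      rw [← hu]
      exact (sub_union_left α β).translate u
    have hta' : ta = (α.translate u).supertile := by
      obtain ⟨γ, rfl, -⟩ := hta.exists_assembly
      rw [supertile_translate, supertile_eq_of_mem hα]
    generalize α.translate u = x at hs hta'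
    subst hta'
    -- The marks at the corner and at the top of the tower occur once in the chain, so a seed inside
    -- `x` reaches from one to the other, whatever its parameters.
    rcases kind_of_producible hτ hta x (self_mem_supertile x) with hx | ⟨N', t', v, ht', rfl⟩
    · right
      refine ⟨x, rfl, ?_⟩
      obtain ⟨N', t', v, ht', hx⟩ := hx.seed
      have hpos' := dock_ge τ N' N'
      have hsub : ∀ p a, seed N' t' p = some a → x (p + v) = some a := by
        intro p a ha
        refine hx _ _ ?_
        rwa [translate_apply, add_sub_cancel_right]
      have h1 := hsub _ _ (seed_bar (le_refl 0) (by omega))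
      have h2 := hsub _ _ (seed_tower (by norm_num) (le_refl 21))
      have e1 := chain_south_mark hτ (hs _ _ h1) (by simp [seedBar])
      have e2 := chain_north_mark hτ (hs _ _ h2)
        (show (seedTower τ 21).north = mark [true, true] by simp [seedTower])
      simp at e2
      rw [e1] at h1
      rw [show ((dock τ N' N' : ℤ), (21 : ℤ)) + v = (dock τ N N, 21) from e2] at h2
      exact ⟨⟨_, h1⟩, ⟨_, h2⟩⟩
    · left
      obtain ⟨rfl, rfl⟩ := piece_sub_chain_unique hτ ht hk ht' hs
      exact supertile_translate _ _

/-- A partially filled seed and a piece that fits in all but one of the positions have no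
common successor. -/
theorem not_stepLE_both (hτ : 2 ≤ τ) (ht : ∀ s, t s < N) {k : ℕ} (hk : k ≤ N) {t' : Fin τ → ℕ}
    (ht' : ∀ s, t' s < N) (r : Fin τ) (hr : t r ≠ t' r) (hne : ∀ s, s ≠ r → t s = t' s)
    {tz : Set Assembly} (h : (system τ).StepLE (chain N t k).supertile tz)
    (h' : (system τ).StepLE (piece N t').supertile tz) : False := by
  have hc := chain_seedLike hτ ht hk
  -- At most a piece is added, and pieces bring no upward tips. So all upward tips of the successor
  -- lie in the docks for `t`.
  obtain ⟨z, rfl, hz, hzt⟩ : ∃ z : Assembly, tz = z.supertile ∧ SeedLike τ z ∧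
      ∀ p a (s : Fin τ), z p = some a → a.north = tip s →
        ∃ k < N, p = (dock τ N k + tooth t s, 10) := by
    rcases h with rfl | ⟨tg, hg, h⟩
    · exact ⟨_, rfl, hc, fun p a s ha hs => chain_north_tip hτ ha hs⟩
    · obtain ⟨β₀, hβ₀, -⟩ := hg.exists_assembly
      obtain ⟨β, rfl, hd, hs, rfl⟩ := combine_cases hβ₀ h
      obtain ⟨hz, N', t', u, ht', rfl, -⟩ := hc.attach hτ
        (kind_of_producible hτ hg β (self_mem_supertile β)) hd hs
      refine ⟨_, rfl, hz, fun p a s ha hs => ?_⟩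
      by_cases hp : p ∈ (chain N t k).dom
      · rw [union_of_mem hp] at ha
        exact chain_north_tip hτ ha hs
      · rw [union_of_notMem hp] at ha
        exact absurd hs (piece_north_ne_tip hτ ha)
  rcases h' with e | ⟨tg, hg, h'⟩
  · obtain ⟨u, rfl⟩ := exists_translate_of_supertile_eq e
    exact hz.not_pieceLike hτ ⟨N, t', u, ht', rfl⟩
  · obtain ⟨β₀, hβ₀, -⟩ := hg.exists_assembly
    obtain ⟨β, rfl, hd, hs, e⟩ := combine_cases hβ₀ h'
    obtain ⟨u, hu⟩ := exists_translate_of_supertile_eq e.symm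
    -- Each tip of the embedded piece for `t'` stands on an upward tip of the same number, in a dock
    -- that may so far depend on `s`.
    have key : ∀ s, ∃ k < N, tooth t' s + u.1 = dock τ N k + tooth t s := by
      intro s
      have h1 : z ((tooth t' s, 11) + u) = some (pieceTooth s 11) := by
        rw [← hu, translate_apply, add_sub_cancel_right]
        exact sub_union_left _ _ _ _ (piece_tooth s le_rfl (by norm_num))
      obtain ⟨b, hb, hbs⟩ := hz.tips _ _ s h1 (by simp [pieceTooth])
      obtain ⟨k, hk, e⟩ := hzt _ _ s hb hbs
      refine ⟨k, hk, ?_⟩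
      simpa using congrArg Prod.fst e
    -- A tooth on which `t` and `t'` agree shifts the piece exactly to the start of a dock. Tooth
    -- `r` must then use the same dock, which forces `t r = t' r`.
    obtain ⟨s₀, hs₀⟩ : ∃ s₀ : Fin τ, s₀ ≠ r := by
      have : Nontrivial (Fin τ) := Fin.nontrivial_iff_two_le.2 hτ
      exact exists_ne r
    obtain ⟨k0, -, e0⟩ := key s₀
    obtain ⟨k1, -, e1⟩ := key r
    have e2 : tooth t s₀ = tooth t' s₀ := by
      unfold tooth
      rw [hne s₀ hs₀]
    have h1 := tooth_nonneg t r
    have h2 := tooth_nonneg t' r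
    have h3 := tooth_le (ht r)
    have h4 := tooth_le (ht' r)
    have e : k0 = k1 := dock_eq_of_close (τ := τ) (N := N) (by unfold pitch; omega)
      (by unfold pitch; omega)
    subst e
    exact hr (tooth_close (s := r) (s' := r) (t := t) (t' := t') (by omega) (by omega)).2

end Ladder

/-! ## Blocks -/

/-- The coordinates of the nonempty `m`-blocks of `α`. -/
def occupied (m : ℕ) (α : Assembly) : Set Pos := {x | (blockAt m α x).IsNonempty}

section Blocks

variable {m : ℕ}

theorem mem_occupied (hm : 0 < m) {α : Assembly} {x : Pos} :
    x ∈ occupied m α ↔ ∃ p ∈ α.dom, p.1 / m = x.1 ∧ p.2 / m = x.2 := by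
  have hm' : (0 : ℤ) < m := by exact_mod_cast hm
  constructor
  · rintro ⟨⟨i, j⟩, t, ht⟩
    have hi : ((i : ℕ) : ℤ) < m := by exact_mod_cast i.2
    have hj : ((j : ℕ) : ℤ) < m := by exact_mod_cast j.2
    refine ⟨_, ⟨t, ht⟩, ?_, ?_⟩
    · simp only
      rw [add_comm, Int.add_mul_ediv_left _ _ hm'.ne', Int.ediv_eq_zero_of_lt (by positivity) hi,
        zero_add]
    · simp only
      rw [add_comm, Int.add_mul_ediv_left _ _ hm'.ne', Int.ediv_eq_zero_of_lt (by positivity) hj,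
        zero_add]
  · rintro ⟨p, ⟨t, ht⟩, h1, h2⟩
    have key : ∀ a : ℤ, ∃ i : Fin m, (m : ℤ) * (a / m) + (i : ℕ) = a := by
      intro a
      have h0 := Int.emod_nonneg a hm'.ne'
      have h1 := Int.emod_lt_of_pos a hm'
      refine ⟨⟨(a % m).toNat, by omega⟩, ?_⟩
      simp only [Int.toNat_of_nonneg h0]
      exact Int.mul_ediv_add_emod a m
    obtain ⟨i, hi⟩ := key p.1
    obtain ⟨j, hj⟩ := key p.2
    refine ⟨(i, j), t, ?_⟩
    simp only [blockAt, ← h1, ← h2, hi, hj]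
    exact ht

theorem occupied_mono (hm : 0 < m) {α β : Assembly} (h : α.dom ⊆ β.dom) :
    occupied m α ⊆ occupied m β := by
  intro x hx
  rw [mem_occupied hm] at hx ⊢
  obtain ⟨p, hp, h'⟩ := hx
  exact ⟨p, h hp, h'⟩

theorem occupied_union (hm : 0 < m) (α β : Assembly) :
    occupied m (α.union β) = occupied m α ∪ occupied m β := by
  ext x
  simp only [Set.mem_union, mem_occupied hm, dom_union, or_and_right, exists_or]

theorem finite_block_preimage (hm : 0 < m) {S : Set Pos} (hS : S.Finite) :
    {p : Pos | (p.1 / (m : ℤ), p.2 / (m : ℤ)) ∈ S}.Finite := by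
  have hm' : (0 : ℤ) < m := by exact_mod_cast hm
  refine ((hS.prod (Set.finite_Icc ((0 : ℤ), (0 : ℤ)) (m, m))).image
    fun z => ((m : ℤ) * z.1.1 + z.2.1, (m : ℤ) * z.1.2 + z.2.2)).subset ?_
  intro p hp
  refine ⟨((p.1 / m, p.2 / m), (p.1 % m, p.2 % m)), ⟨hp, ?_⟩, ?_⟩
  · simp only [Set.mem_Icc, Prod.mk_le_mk]
    exact ⟨⟨Int.emod_nonneg _ hm'.ne', Int.emod_nonneg _ hm'.ne'⟩,
      ⟨(Int.emod_lt_of_pos _ hm').le, (Int.emod_lt_of_pos _ hm').le⟩⟩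
  · simp only [Int.mul_ediv_add_emod]

theorem ediv_le_add_one (hm : 0 < m) {a b : ℤ} (h : a ≤ b + 1) : a / m ≤ b / m + 1 := by
  have hm' : (0 : ℤ) < m := by exact_mod_cast hm
  rw [← Int.add_mul_ediv_right b 1 hm'.ne']
  exact Int.ediv_le_ediv hm' (by omega)

theorem blockAt_translate (α : Assembly) (u x : Pos) :
    blockAt m (α.translate (m * u.1, m * u.2)) x = blockAt m α (x - u) := by
  funext ij
  simp only [blockAt, translate_apply, Prod.mk_sub_mk, Prod.fst_sub, Prod.snd_sub]
  congr 2 <;> ring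

variable {U T : Finset TileType} {R : Repr U T m}

/-- Only translations by multiples of `m` respect the division into blocks; frames are therefore
changed only by such translations when representations must be followed. -/
theorem onAssembly_translate (α : Assembly) (u : Pos) :
    R.onAssembly (α.translate (m * u.1, m * u.2)) = (R.onAssembly α).translate u := by
  funext x
  simp only [Repr.onAssembly, blockAt_translate, translate_apply]

/-- Translates of `α` that are not aligned with the blocks might represent something else. Cleanness
makes the whole image a single supertile, and it contains `R.onAssembly α`. -/
theorem onSupertile_supertile {α : Assembly} (h : R.Clean α.supertile) :
    R.onSupertile α.supertile = (R.onAssembly α).supertile := by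
  obtain ⟨β, -, e⟩ := h.1
  rw [e]
  refine (supertile_eq_of_mem ?_).symm
  rw [← e]
  exact ⟨α, self_mem_supertile α, rfl⟩

/-- The empty block represents no tile if some clean supertile represents a finite one. -/
theorem empty_block_eq_none {α : Assembly} (h : R.CleanAssembly α)
    (hf : (R.onAssembly α).dom.Finite) : R.toFun (fun _ => none) = none := by
  by_contra hne
  obtain ⟨t, ht⟩ := Option.ne_none_iff_exists'.1 hne
  have hocc : ∀ x, x ∉ (R.onAssembly α).dom → (blockAt m α x).IsNonempty := by
    intro x hx
    by_contra hb
    refine hx ⟨t, ?_⟩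
    have : blockAt m α x = fun _ => none := by
      funext ij
      by_contra h
      obtain ⟨s, hs⟩ := Option.ne_none_iff_exists'.1 h
      exact hb ⟨ij, s, hs⟩
    rw [Repr.onAssembly, this, ht]
  -- All unrepresented blocks would be nonempty. The block in column `B + 2` has no represented tile
  -- next to it, and with the one in column `B + 3` there is more than one nonempty block, so both
  -- clauses of cleanness fail.
  obtain ⟨B, hB⟩ := (hf.image Prod.fst).bddAbove
  have hB' : ∀ x ∈ (R.onAssembly α).dom, x.1 ≤ B := fun x hx => hB ⟨x, hx, rfl⟩
  have h1 : ((B + 2, 0) : Pos) ∉ (R.onAssembly α).dom := fun h => by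
    have := hB' _ h
    simp only at this
    omega
  have h2 : ((B + 3, 0) : Pos) ∉ (R.onAssembly α).dom := fun h => by
    have := hB' _ h
    simp only at this
    omega
  rcases h with h | h
  · obtain ⟨u, v, huv, hd⟩ := h _ (hocc _ h1)
    have := hB' _ hd
    simp only at this
    nlinarith [sq_nonneg v]
  · have := h _ _ (hocc _ h1) (hocc _ h2)
    simp at this

theorem dom_onAssembly_subset (he : R.toFun (fun _ => none) = none) (α : Assembly) :
    (R.onAssembly α).dom ⊆ occupied m α := by
  rintro x ⟨t, ht⟩
  by_contra hb
  have : blockAt m α x = fun _ => none := by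
    funext ij
    by_contra h
    obtain ⟨s, hs⟩ := Option.ne_none_iff_exists'.1 h
    exact hb ⟨ij, s, hs⟩
  rw [Repr.onAssembly, this, he] at ht
  cases ht

/-- In a clean assembly with at least two represented tiles, every nonempty block is near a
represented tile. -/
theorem near_of_occupied (he : R.toFun (fun _ => none) = none) {α : Assembly}
    (h : R.CleanAssembly α) (hn : (R.onAssembly α).dom.Nontrivial) {x : Pos}
    (hx : x ∈ occupied m α) :
    ∃ y ∈ (R.onAssembly α).dom, |x.1 - y.1| ≤ 1 ∧ |x.2 - y.2| ≤ 1 := by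
  rcases h with h | h
  · obtain ⟨u, v, huv, hy⟩ := h x hx
    refine ⟨_, hy, ?_, ?_⟩ <;> simp only [sub_add_cancel_left, abs_neg, abs_le] <;>
      constructor <;> nlinarith [sq_nonneg u, sq_nonneg v]
  · obtain ⟨a, ha, b, hb, hne⟩ := hn
    exact absurd (h a b (dom_onAssembly_subset he α ha) (dom_onAssembly_subset he α hb)) hne

/-- Every nonempty block lies within distance one of finitely many represented positions, and a
block has finitely many cells. -/
theorem finite_of_clean (hm : 0 < m) (he : R.toFun (fun _ => none) = none) {α : Assembly}
    (h : R.CleanAssembly α) (hn : (R.onAssembly α).dom.Nontrivial)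
    (hf : (R.onAssembly α).dom.Finite) : α.dom.Finite := by
  have h1 : (occupied m α).Finite := by
    refine ((hf.prod (Set.finite_Icc ((-1 : ℤ), (-1 : ℤ)) (1, 1))).image
      fun z => z.1 + z.2).subset ?_
    intro x hx
    obtain ⟨y, hy, h1, h2⟩ := near_of_occupied he h hn hx
    rw [abs_le] at h1 h2
    refine ⟨(y, x - y), ⟨hy, ?_⟩, by simp⟩
    simp only [Set.mem_Icc, Prod.le_def, Prod.fst_sub, Prod.snd_sub]
    exact ⟨⟨h1.1, h2.1⟩, ⟨h1.2, h2.2⟩⟩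
  refine (finite_block_preimage hm h1).subset fun p hp => ?_
  change _ ∈ occupied m α
  rw [mem_occupied hm]
  exact ⟨p, hp, rfl, rfl⟩

end Blocks

/-! ### Two counting lemmas -/

/-- A family of natural numbers with sum at least `n` has at most `n` positive members with sum
at least `n`. -/
theorem exists_subset_card_le_sum {ι : Type*} (E : Finset ι) (f : ι → ℕ) {n : ℕ}
    (h : n ≤ ∑ e ∈ E, f e) :
    ∃ E' ⊆ E, E'.card ≤ n ∧ (∀ e ∈ E', 0 < f e) ∧ n ≤ ∑ e ∈ E', f e := by
  classical
  have hP : ∑ e ∈ E.filter (fun e => 0 < f e), f e = ∑ e ∈ E, f e := by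
    refine Finset.sum_filter_of_ne fun e _ h => Nat.pos_of_ne_zero h
  by_cases hc : (E.filter fun e => 0 < f e).card ≤ n
  · exact ⟨_, Finset.filter_subset _ _, hc, fun e he => (Finset.mem_filter.1 he).2, hP ▸ h⟩
  -- Any `n` positive members already have sum at least `n`.
  · obtain ⟨E', hE', hc'⟩ := Finset.exists_subset_card_eq (not_le.1 hc).le
    have hpos : ∀ e ∈ E', 0 < f e := fun e he => (Finset.mem_filter.1 (hE' he)).2
    refine ⟨E', hE'.trans (Finset.filter_subset _ _), hc'.le, hpos, ?_⟩
    calc n = ∑ e ∈ E', 1 := by simp [hc']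
      _ ≤ ∑ e ∈ E', f e := Finset.sum_le_sum fun e he => hpos e he

/-- Among sufficiently many functions two of the same color differ at exactly one position, which
may be prescribed by the color. -/
theorem exists_eq_color_differ_once {n N : ℕ} {κ : Type*} [Fintype κ] (f : (Fin n → Fin N) → κ)
    (ρ : κ → Fin n) (h : Fintype.card κ < N) :
    ∃ t t' : Fin n → Fin N, f t = f t' ∧ t (ρ (f t)) ≠ t' (ρ (f t)) ∧
      ∀ s, s ≠ ρ (f t) → t s = t' s := by
  obtain ⟨t₀⟩ : Nonempty (Fin n → Fin N) := ⟨fun _ => ⟨0, by omega⟩⟩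
  obtain ⟨n, rfl⟩ : ∃ l, n = l + 1 := ⟨n - 1, by have := (ρ (f t₀)).pos; omega⟩
  -- The color, together with all values except the one at the position named by the color, takes at
  -- most `card κ * N ^ n` values, fewer than the `N ^ (n + 1)` functions.
  have hc : Fintype.card (κ × (Fin n → Fin N)) < Fintype.card (Fin (n + 1) → Fin N) := by
    simp only [Fintype.card_prod, Fintype.card_fun, Fintype.card_fin, pow_succ]
    rw [mul_comm]
    exact Nat.mul_lt_mul_of_pos_left h (Nat.pow_pos (by omega))
  obtain ⟨t, t', hne, e⟩ := Fintype.exists_ne_map_eq_of_card_lt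
    (fun t : Fin (n + 1) → Fin N => (f t, fun i => t ((ρ (f t)).succAbove i))) hc
  simp only [Prod.mk.injEq] at e
  obtain ⟨e1, e2⟩ := e
  have hs : ∀ s, s ≠ ρ (f t) → t s = t' s := by
    intro s hs
    obtain ⟨i, rfl⟩ := Fin.exists_succAbove_eq hs
    have := congrFun e2 i
    rwa [← e1] at this
  refine ⟨t, t', e1, fun hr => hne (funext fun s => ?_), hs⟩
  by_cases h : s = ρ (f t)
  · rwa [h]
  · exact hs s h

namespace Ladder

variable {τ N : ℕ} {t : Fin τ → ℕ}

/-! ## Simulations of the system -/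

theorem mem_chain_box (ht : ∀ s, t s < N) {k : ℕ} (hk : k ≤ N) {p : Pos}
    (h : p ∈ (chain N t k).dom) : 0 ≤ p.1 ∧ p.1 ≤ dock τ N N ∧ 0 ≤ p.2 ∧ p.2 ≤ 21 := by
  have h0 := dock_ge τ N N
  rcases mem_chain_cases h with h | ⟨k', hk', h⟩
  · rcases mem_seed_cases h with h | h | ⟨s, k', hk', h⟩
    · omega
    · omega
    · have h1 := dock_add_tooth_lt ht hk' s
      have h2 := tooth_nonneg t s
      have h3 := dock_ge τ N k'
      omega
  · have h1 := mem_piece_box ht h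
    have h2 := dock_add_pitch_le (τ := τ) (N := N) (hk'.trans_le hk)
    have h3 := dock_ge τ N k'
    simp only [Prod.fst_sub, Prod.snd_sub, pitch] at h1 h2
    omega

/-- Near the empty dock number `k` there is nothing but the bar and the teeth of the dock. -/
theorem mem_chain_near_dock (ht : ∀ s, t s < N) {k : ℕ} (hk : k < N) {p : Pos}
    (h : p ∈ (chain N t k).dom) (h1 : dock τ N k ≤ p.1 + 5)
    (h2 : p.1 ≤ dock τ N k + width τ N + 5) :
    p.2 = 0 ∨ ∃ s, p.1 = dock τ N k + tooth t s ∧ 1 ≤ p.2 ∧ p.2 ≤ 10 := by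
  have h3 := dock_add_pitch_le (τ := τ) (N := N) hk
  unfold pitch at h3
  rcases mem_chain_cases h with h | ⟨k', hk', h⟩
  · rcases mem_seed_cases h with h | h | ⟨s, k', hk', h6⟩
    · exact Or.inl h.1
    · omega
    · right
      have h4 := tooth_le (ht s)
      have h5 := tooth_nonneg t s
      obtain rfl : k' = k := dock_eq_of_close (τ := τ) (N := N) (by unfold pitch; omega)
        (by unfold pitch; omega)
      exact ⟨s, h6⟩
  · have h4 := mem_piece_box ht h
    have h5 := dock_add_pitch_le (τ := τ) (N := N) hk'
    simp only [Prod.fst_sub, Prod.snd_sub, pitch] at h4 h5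
    omega

theorem chain_corner (N : ℕ) (t : Fin τ → ℕ) (k : ℕ) : (0, 0) ∈ (chain N t k).dom := by
  have h0 := dock_ge τ N N
  exact ⟨_, seed_sub_chain N t k _ _ (seed_bar le_rfl (by omega))⟩

theorem chain_top (N : ℕ) (t : Fin τ → ℕ) (k : ℕ) : (dock τ N N, 21) ∈ (chain N t k).dom :=
  ⟨_, seed_sub_chain N t k _ _ (seed_tower (by norm_num) le_rfl)⟩

theorem piece_left (N : ℕ) (t : Fin τ → ℕ) : (0, 21) ∈ (piece N t).dom :=
  ⟨_, piece_bar le_rfl (width_nonneg τ N)⟩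

theorem piece_right (N : ℕ) (t : Fin τ → ℕ) : (width τ N, 21) ∈ (piece N t).dom :=
  ⟨_, piece_bar (width_nonneg τ N) le_rfl⟩

theorem chain_nontrivial (N : ℕ) (t : Fin τ → ℕ) (k : ℕ) : (chain N t k).dom.Nontrivial :=
  ⟨_, chain_corner N t k, _, chain_top N t k, by simp⟩

theorem piece_nontrivial (hτ : 2 ≤ τ) (ht : ∀ s, t s < N) : (piece N t).dom.Nontrivial := by
  have := width_pos (τ := τ) (by omega) ((Nat.zero_le _).trans_lt (ht ⟨0, by omega⟩))
  refine ⟨_, piece_left N t, _, piece_right N t, fun h => ?_⟩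
  simp only [Prod.mk.injEq, and_true] at h
  omega

theorem chain_finite (ht : ∀ s, t s < N) {k : ℕ} (hk : k ≤ N) : (chain N t k).dom.Finite := by
  refine (Set.finite_Icc ((0 : ℤ), (0 : ℤ)) (dock τ N N, 21)).subset fun p hp => ?_
  have := mem_chain_box ht hk hp
  exact ⟨⟨this.1, this.2.2.1⟩, ⟨this.2.1, this.2.2.2⟩⟩

theorem piece_finite (ht : ∀ s, t s < N) : (piece N t).dom.Finite := by
  refine (Set.finite_Icc ((0 : ℤ), (0 : ℤ)) (width τ N, 21)).subset fun p hp => ?_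
  have := mem_piece_box ht hp
  exact ⟨⟨this.1, by simp only; omega⟩, ⟨this.2.1, this.2.2.2⟩⟩

end Ladder

theorem Assembly.finite_dom_translate {α : Assembly} (h : α.dom.Finite) (u : Pos) :
    (α.translate u).dom.Finite :=
  h.preimage (f := fun p => p - u) (sub_left_injective.injOn)

theorem Assembly.nontrivial_dom_translate {α : Assembly} (h : α.dom.Nontrivial) (u : Pos) :
    (α.translate u).dom.Nontrivial := by
  obtain ⟨a, ha, b, hb, hne⟩ := h
  refine ⟨a + u, ?_, b + u, ?_, fun h => hne (add_right_cancel h)⟩ <;>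
    simpa [mem_dom_translate]

/-! ### Geometry and steps of a simulator in terms of what it represents -/

section Represents

variable {𝒰 𝒯 : TAS} {m : ℕ} {R : Repr 𝒰.tiles 𝒯.tiles m}

theorem EquivProductions.onSupertile_eq (hE : EquivProductions 𝒰 𝒯 R) {A : Assembly}
    (hA : 𝒰.Producible A.supertile) :
    R.onSupertile A.supertile = (R.onAssembly A).supertile :=
  onSupertile_supertile (hE.2 _ hA)

theorem EquivProductions.exists_producible (hE : EquivProductions 𝒰 𝒯 R) {x : Assembly}
    (hx : 𝒯.Producible x.supertile) :
    ∃ A : Assembly, 𝒰.Producible A.supertile ∧ R.onSupertile A.supertile = x.supertile := by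
  have : x.supertile ∈ {tb | ∃ ta, 𝒰.Producible ta ∧ R.onSupertile ta = tb} := by
    rw [hE.1]
    exact hx
  obtain ⟨ta, hta, e⟩ := this
  obtain ⟨A, rfl, -⟩ := hta.exists_assembly
  exact ⟨A, hta, e⟩

theorem EquivProductions.exists_translate (hE : EquivProductions 𝒰 𝒯 R) {A x : Assembly}
    (hA : 𝒰.Producible A.supertile) (h : R.onSupertile A.supertile = x.supertile) :
    ∃ w, R.onAssembly A = x.translate w := by
  rw [hE.onSupertile_eq hA] at h
  obtain ⟨w, hw⟩ := exists_translate_of_supertile_eq h.symm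
  exact ⟨w, hw.symm⟩

/-- With two represented tiles the one-block clause of cleanness is excluded, so the nonempty blocks
exceed the represented shape by at most one in each direction. Absolute values are unfolded for
linear arithmetic. -/
theorem near_represented (hE : EquivProductions 𝒰 𝒯 R)
    (he : R.toFun (fun _ => none) = none) {A x : Assembly} (hx : x.dom.Nontrivial)
    (hA : 𝒰.Producible A.supertile) {w : Pos} (h : R.onAssembly A = x.translate w) {b : Pos}
    (hb : b ∈ occupied m A) :
    ∃ c ∈ x.dom, b.1 ≤ c.1 + w.1 + 1 ∧ c.1 + w.1 ≤ b.1 + 1 ∧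
      b.2 ≤ c.2 + w.2 + 1 ∧ c.2 + w.2 ≤ b.2 + 1 := by
  obtain ⟨y, hy, h1, h2⟩ := near_of_occupied he ((hE.2 _ hA).2 A (self_mem_supertile A))
    (h ▸ nontrivial_dom_translate hx w) hb
  rw [h, mem_dom_translate] at hy
  rw [abs_le] at h1 h2
  refine ⟨_, hy, ?_⟩
  simp only [Prod.fst_sub, Prod.snd_sub]
  omega

theorem occupied_of_represented (he : R.toFun (fun _ => none) = none) {A x : Assembly} {w : Pos}
    (h : R.onAssembly A = x.translate w)
    {c : Pos} (hc : c ∈ x.dom) : c + w ∈ occupied m A := by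
  refine dom_onAssembly_subset he A ?_
  rw [h, mem_dom_translate, add_sub_cancel_right]
  exact hc

theorem finite_of_represents (hE : EquivProductions 𝒰 𝒯 R)
    (he : R.toFun (fun _ => none) = none) (hm : 0 < m) {A x : Assembly} (hx : x.dom.Nontrivial)
    (hf : x.dom.Finite) (hA : 𝒰.Producible A.supertile)
    (h : R.onSupertile A.supertile = x.supertile) : A.dom.Finite := by
  obtain ⟨w, hw⟩ := hE.exists_translate hA h
  exact finite_of_clean hm he ((hE.2 _ hA).2 A (self_mem_supertile A))
    (hw ▸ nontrivial_dom_translate hx w) (hw ▸ finite_dom_translate hf w)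

/-- A step of the simulated system, lifted to the simulator in a fixed frame. -/
theorem lift_step (hF : Follows 𝒰 𝒯 R) (hW : WeaklyModels 𝒰 𝒯 R)
    {x y : Assembly} (hx : 𝒯.Producible x.supertile) (hy : 𝒯.Producible y.supertile)
    (hxy : 𝒯.Step x.supertile y.supertile) {A : Assembly} (hA : 𝒰.Producible A.supertile)
    (hAx : R.onSupertile A.supertile = x.supertile) :
    ∃ A' γ : Assembly, A.Sub A' ∧ 𝒰.Producible A'.supertile ∧
      R.onSupertile A'.supertile = x.supertile ∧ 𝒰.Producible γ.supertile ∧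
      Disjoint A'.dom γ.dom ∧ (A'.union γ).Stable 𝒰.temp ∧
      𝒰.Producible (A'.union γ).supertile ∧
      R.onSupertile (A'.union γ).supertile = y.supertile ∧
      𝒯.StepLE (R.onSupertile γ.supertile) y.supertile := by
  obtain ⟨ta, tb, hta, h1, ⟨a, α, h0, hg, hr, rfl⟩, htb, h2, tg, htg, hstep⟩ :=
    hW _ _ hx hy hxy _ hA hAx
  obtain ⟨u, hu⟩ := exists_translate_of_supertile_eq h0
  have hsub : A.Sub (α.translate u) := hu ▸ (hr.sub 0).translate u
  rw [← supertile_translate u α] at hta h1 hstep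
  generalize α.translate u = A' at *
  obtain ⟨γ₀, hγ₀, -⟩ := htg.exists_assembly
  obtain ⟨γ, rfl, hd, hs, rfl⟩ := combine_cases hγ₀ hstep
  refine ⟨A', γ, hsub, hta, h1, htg, hd, hs, htb, h2, ?_⟩
  -- Attachment is symmetric, so the same event is a step that starts from `γ`, and `Follows`
  -- restricts what `γ` may represent.
  rw [← h2]
  exact hF _ _ htg htb ⟨_, hta, combine_comm _ _ _ ▸ hstep⟩

end Represents

/-! ### No simulation at a lower temperature -/

namespace Ladder

variable {τ N : ℕ} {t : Fin τ → ℕ} {𝒰 : TAS} {m : ℕ} {R : Repr 𝒰.tiles (system τ).tiles m}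

theorem empty_block (hE : EquivProductions 𝒰 (system τ) R) :
    R.toFun (fun _ => none) = none := by
  have ht : ∀ s : Fin τ, (fun _ => 0 : Fin τ → ℕ) s < 1 := fun _ => Nat.one_pos
  obtain ⟨A, hA, h⟩ := hE.exists_producible (piece_reachable ht).producible
  obtain ⟨w, hw⟩ := hE.exists_translate hA h
  exact empty_block_eq_none ((hE.2 _ hA).2 A (self_mem_supertile A))
    (hw ▸ finite_dom_translate (piece_finite ht) w)

/-- The positions in the blocks around the origin. -/
def center (m : ℕ) : Set Pos :=
  {p | (p.1 / (m : ℤ), p.2 / (m : ℤ)) ∈ Set.Icc ((-2 : ℤ), (-2 : ℤ)) (2, 2)}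

theorem center_finite (hm : 0 < m) : (center m).Finite :=
  finite_block_preimage hm (Set.finite_Icc _ _)

/-- A simulation of the filling of the docks either attaches a piece at some point or puts, in
each step, at least one tile near the origin. -/
theorem exists_piece_step (hτ : 2 ≤ τ) (hm : 0 < m) (hE : EquivProductions 𝒰 (system τ) R)
    (hF : Follows 𝒰 (system τ) R) (hW : WeaklyModels 𝒰 (system τ) R) (ht : ∀ s, t s < N)
    (hN : (center m).ncard < N) :
    ∃ k < N, ∃ A γ : Assembly, 𝒰.Producible A.supertile ∧ 𝒰.Producible γ.supertile ∧
      R.onSupertile A.supertile = (chain N t k).supertile ∧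
      R.onSupertile γ.supertile = (piece N t).supertile ∧ Disjoint A.dom γ.dom ∧
      (A.union γ).Stable 𝒰.temp ∧ 𝒰.Producible (A.union γ).supertile ∧
      R.onSupertile (A.union γ).supertile = (chain N t (k + 1)).supertile := by
  have he := empty_block hE
  by_contra hno
  -- The simulator is followed in one frame, where the blocks of the seed's two extreme corners stay
  -- occupied. If no piece ever attaches, every step adds a tile to `center m`.
  have key : ∀ k ≤ N, ∃ A : Assembly, 𝒰.Producible A.supertile ∧
      R.onSupertile A.supertile = (chain N t k).supertile ∧ (0, 0) ∈ occupied m A ∧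
      (dock τ N N, 21) ∈ occupied m A ∧ k ≤ (A.dom ∩ center m).ncard := by
    intro k hk
    induction k with
    | zero =>
      obtain ⟨A, hA, h⟩ := hE.exists_producible (chain_reachable ht hk).producible
      obtain ⟨w, hw⟩ := hE.exists_translate hA h
      have e : R.onAssembly (A.translate (m * (-w).1, m * (-w).2)) =
          (chain N t 0).translate 0 := by
        rw [onAssembly_translate, hw]
        simp
      refine ⟨A.translate (m * (-w).1, m * (-w).2), by rwa [supertile_translate],
        by rwa [supertile_translate], ?_, ?_, Nat.zero_le _⟩
      · simpa using occupied_of_represented he e (chain_corner N t 0)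
      · simpa using occupied_of_represented he e (chain_top N t 0)
    | succ k ih =>
      obtain ⟨A, hA, hAR, h0, h1, hcard⟩ := ih (by omega)
      obtain ⟨A', γ, hsub, hA', hAR', hγ, hd, hs, hU, hUR, hle⟩ := lift_step hF hW
        (chain_reachable ht (by omega)).producible (chain_reachable ht hk).producible
        (chain_step ht hk) hA hAR
      have hsub' : A.dom ⊆ (A'.union γ).dom := (hsub.trans (sub_union_left A' γ)).dom_subset
      have h0' := occupied_mono hm hsub' h0
      have h1' := occupied_mono hm hsub' h1
      refine ⟨A'.union γ, hU, hUR, h0', h1', ?_⟩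
      have hγT : (system τ).Producible (R.onSupertile γ.supertile) := by
        have : R.onSupertile γ.supertile ∈ {tb | ∃ ta, 𝒰.Producible ta ∧ R.onSupertile ta = tb} :=
          ⟨_, hγ, rfl⟩
        rwa [hE.1] at this
      rcases stepLE_chain hτ ht hk hγT hle with h | ⟨x, hx, hx0, hx1⟩
      · exact absurd ⟨k, hk, A', γ, hA', hγ, hAR', h, hd, hs, hU, hUR⟩ hno
      · obtain ⟨w, hw⟩ := hE.exists_translate hU hUR
        obtain ⟨v, hv⟩ := hE.exists_translate hγ hx
        have hγsub : γ.dom ⊆ (A'.union γ).dom := (sub_union_right hd).dom_subset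
        have g0 := occupied_of_represented he hv hx0
        have g1 := occupied_mono hm hγsub (occupied_of_represented he hv hx1)
        have near : ∀ b ∈ occupied m (A'.union γ), w.1 ≤ b.1 + 1 ∧ b.1 ≤ dock τ N N + w.1 + 1 ∧
            w.2 ≤ b.2 + 1 ∧ b.2 ≤ 21 + w.2 + 1 := by
          intro b hb
          obtain ⟨c, hc, h⟩ := near_represented hE he (chain_nontrivial N t (k + 1)) hU hw hb
          have := mem_chain_box ht hk hc
          omega
        -- The two occupied corners put the offset `w` of the union within distance one of zero. The
        -- corners of what `γ` represents put `v` within distance one of `w`, hence within two of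
        -- the origin.
        have n1 := near _ h0'
        have n2 := near _ h1'
        have n3 := near _ (occupied_mono hm hγsub g0)
        have n4 := near _ g1
        simp only [Prod.fst_add, Prod.snd_add] at n1 n2 n3 n4
        obtain ⟨p, hp, hp1, hp2⟩ := (mem_occupied hm).1 g0
        simp only [Prod.fst_add, Prod.snd_add] at hp1 hp2
        have hpc : p ∈ center m := by
          simp only [center, Set.mem_ofPred_eq, Set.mem_Icc, Prod.mk_le_mk]
          omega
        have hfin : ((A'.union γ).dom ∩ center m).Finite :=
          (center_finite hm).subset Set.inter_subset_right
        -- The tile at `p` comes from `γ`, which is disjoint from `A`, so it is new.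
        have hlt : (A.dom ∩ center m).ncard < ((A'.union γ).dom ∩ center m).ncard := by
          refine Set.ncard_lt_ncard ?_ hfin
          refine ⟨Set.inter_subset_inter_left _ hsub', fun h => ?_⟩
          exact Set.disjoint_left.1 hd (hsub.dom_subset (h ⟨hγsub hp, hpc⟩).1) hp
        omega
  obtain ⟨A, -, -, -, -, h⟩ := key N le_rfl
  have := Set.ncard_le_ncard (Set.inter_subset_right (s := A.dom) (t := center m))
    (center_finite hm)
  omega

/-- A step that attaches a piece, in the frame of the dock. -/
theorem exists_aligned_step (hτ : 2 ≤ τ) (hm : 0 < m) (hE : EquivProductions 𝒰 (system τ) R)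
    (hF : Follows 𝒰 (system τ) R) (hW : WeaklyModels 𝒰 (system τ) R) (ht : ∀ s, t s < N)
    (hN : (center m).ncard < N) :
    ∃ k < N, ∃ (A γ : Assembly) (v : Pos), 𝒰.Producible A.supertile ∧ 𝒰.Producible γ.supertile ∧
      R.onAssembly A = (chain N t k).translate (-dock τ N k, 0) ∧
      R.onAssembly γ = (piece N t).translate v ∧
      v ∈ Finset.Icc ((-2 : ℤ), (-2 : ℤ)) (2, 2) ∧ Disjoint A.dom γ.dom ∧
      (A.union γ).Stable 𝒰.temp := by
  have he := empty_block hE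
  obtain ⟨k, hk, A, γ, hA, hγ, hAR, hγR, hd, hs, hU, hUR⟩ :=
    exists_piece_step hτ hm hE hF hW ht hN
  obtain ⟨w₀, hw₀⟩ := hE.exists_translate hA hAR
  -- A shift by whole blocks that moves the start of the dock to the origin of the represented
  -- plane.
  set z : Pos := (-dock τ N k, 0) - w₀ with hz
  set u : Pos := (m * z.1, m * z.2) with hu
  rw [← supertile_translate u] at hA hγ hAR hγR hU hUR
  rw [← disjoint_translate (u := u)] at hd
  replace hs := hs.translate u
  rw [translate_union] at hs hU hUR
  have hw : R.onAssembly (A.translate u) = (chain N t k).translate (-dock τ N k, 0) := by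
    rw [hu, onAssembly_translate, hw₀, translate_translate, hz, sub_add_cancel]
  clear_value u
  clear hw₀ hu
  generalize A.translate u = A at *
  generalize γ.translate u = γ at *
  obtain ⟨v, hv⟩ := hE.exists_translate hγ hγR
  obtain ⟨w, hw'⟩ := hE.exists_translate hU hUR
  refine ⟨k, hk, A, γ, v, hA, hγ, hw, hv, ?_, hd, hs⟩
  have near : ∀ b ∈ occupied m (A.union γ), w.1 ≤ b.1 + 1 ∧ b.1 ≤ dock τ N N + w.1 + 1 ∧
      w.2 ≤ b.2 + 1 ∧ b.2 ≤ 21 + w.2 + 1 := by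
    intro b hb
    obtain ⟨c, hc, h⟩ := near_represented hE he (chain_nontrivial N t (k + 1)) hU hw' hb
    have := mem_chain_box ht hk hc
    omega
  have nearγ : ∀ b ∈ occupied m γ, v.1 ≤ b.1 + 1 ∧ b.1 ≤ width τ N + v.1 + 1 ∧
      b.2 ≤ 21 + v.2 + 1 := by
    intro b hb
    obtain ⟨c, hc, h⟩ := near_represented hE he (piece_nontrivial hτ ht) hγ hv hb
    have := mem_piece_box ht hc
    omega
  have hAsub := occupied_mono (m := m) hm (sub_union_left A γ).dom_subset
  have hγsub := occupied_mono (m := m) hm (sub_union_right hd).dom_subset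
  have n1 := near _ (hAsub (occupied_of_represented he hw (chain_corner N t k)))
  have n2 := near _ (hAsub (occupied_of_represented he hw (chain_top N t k)))
  have n3 := near _ (hγsub (occupied_of_represented he hv (piece_left N t)))
  simp only [Prod.fst_add, Prod.snd_add] at n1 n2 n3
  -- The union represents the bar of the newly docked piece. Around the empty dock `A` reaches
  -- barely above row 10, so these blocks must be occupied by `γ`; the two ends of the bar then
  -- locate `v`.
  have bar : ∀ x, (x, 21) ∈ (piece N t).dom → 0 ≤ x → x ≤ width τ N →
      (dock τ N k + x, 21) + w ∈ occupied m γ := by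
    intro x hx hx0 hx1
    have h1 : (dock τ N k + x, 21) ∈ (chain N t (k + 1)).dom := by
      refine (piece_sub_chain ht hk (Nat.lt_succ_self k)).dom_subset ?_
      rw [mem_dom_translate]
      simpa using hx
    have h2 := occupied_of_represented he hw' h1
    rw [occupied_union hm] at h2
    refine h2.resolve_left fun h3 => ?_
    obtain ⟨c, hc, h4⟩ := near_represented hE he (chain_nontrivial N t k) hA hw h3
    simp only [Prod.fst_add, Prod.snd_add] at h4
    rcases mem_chain_near_dock ht hk hc (by omega) (by omega) with h5 | ⟨s, h5⟩ <;> omega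
  have n4 := nearγ _ (bar 0 (piece_left N t) le_rfl (width_nonneg τ N))
  have n5 := nearγ _ (bar _ (piece_right N t) (width_nonneg τ N) le_rfl)
  simp only [Prod.fst_add, Prod.snd_add] at n4 n5
  rw [Finset.mem_Icc, Prod.le_def, Prod.le_def]
  simp only
  omega

/-- The position `q` lies in a block close to the tip of the tooth in column `x`. -/
def InWindow (m : ℕ) (x : ℤ) (q : Pos) : Prop :=
  x - 3 ≤ q.1 / (m : ℤ) ∧ q.1 / (m : ℤ) ≤ x + 3 ∧ 7 ≤ q.2 / (m : ℤ) ∧ q.2 / (m : ℤ) ≤ 13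

open Classical in
/-- The part of `γ` over `U` in the blocks close to the tip of the tooth in column `x`. -/
noncomputable def window (U : Finset TileType) (m : ℕ) (x : ℤ) (γ : Assembly) :
    Fin (7 * m) × Fin (7 * m) → Option U := fun ij =>
  (γ (m * (x - 3) + (ij.1 : ℕ), m * 7 + (ij.2 : ℕ))).bind fun a =>
    if h : a ∈ U then some ⟨a, h⟩ else none

theorem apply_eq_of_window_eq {U : Finset TileType} (hm : 0 < m) {x : ℤ} {γ γ' : Assembly}
    (hγ : γ.Over U) (hγ' : γ'.Over U) (h : window U m x γ = window U m x γ') {q : Pos}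
    (hq : InWindow m x q) : γ q = γ' q := by
  have hm' : (0 : ℤ) < m := by exact_mod_cast hm
  -- In each direction the window consists of seven blocks, starting three before the central one.
  have key : ∀ a b : ℤ, b - 3 ≤ a / m → a / m ≤ b + 3 →
      ∃ i : Fin (7 * m), (m : ℤ) * (b - 3) + (i : ℕ) = a := by
    intro a b h1 h2
    have h3 : (b - 3) * m ≤ a := (Int.le_ediv_iff_mul_le hm').1 h1
    have h4 : a < (b + 4) * m := (Int.ediv_lt_iff_lt_mul hm').1 (by omega)
    have h5 : a - (b - 3) * m < 7 * m := by linarith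
    refine ⟨⟨(a - (b - 3) * m).toNat, by omega⟩, ?_⟩
    simp only
    rw [Int.toNat_of_nonneg (by omega)]
    ring
  obtain ⟨i, hi⟩ := key q.1 x hq.1 hq.2.1
  obtain ⟨j, hj⟩ := key q.2 10 (by have := hq.2.2.1; omega) (by have := hq.2.2.2; omega)
  norm_num at hj
  have hval : ∀ δ : Assembly, δ.Over U →
      (window U m x δ (i, j)).map Subtype.val = δ q := by
    intro δ hδ
    simp only [window, hi, hj]
    cases hq : δ q with
    | none => rfl
    | some a => simp [hδ q a hq]
  rw [← hval γ hγ, ← hval γ' hγ', h]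

/-- A partially filled seed and a piece next to it, in a simulation, touch only near the tips of
common teeth. -/
theorem contact (hτ : 2 ≤ τ) (hm : 0 < m) (hE : EquivProductions 𝒰 (system τ) R)
    {t' : Fin τ → ℕ} (ht : ∀ s, t s < N) (ht' : ∀ s, t' s < N) {k : ℕ} (hk : k < N)
    {A γ : Assembly} {v : Pos} (hA : 𝒰.Producible A.supertile) (hγ : 𝒰.Producible γ.supertile)
    (hw : R.onAssembly A = (chain N t k).translate (-dock τ N k, 0))
    (hv : R.onAssembly γ = (piece N t').translate v)
    (hv' : v ∈ Finset.Icc ((-2 : ℤ), (-2 : ℤ)) (2, 2)) {p q : Pos} (hp : p ∈ A.dom)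
    (hq : q ∈ γ.dom) (h1 : q.1 ≤ p.1 + 1) (h2 : p.1 ≤ q.1 + 1) (h3 : q.2 ≤ p.2 + 1)
    (h4 : p.2 ≤ q.2 + 1) : ∃ s, t s = t' s ∧ InWindow m (tooth t s) q := by
  have he := empty_block hE
  rw [Finset.mem_Icc, Prod.le_def, Prod.le_def] at hv'
  simp only at hv'
  have g1 := ediv_le_add_one hm h1
  have g2 := ediv_le_add_one hm h2
  have g3 := ediv_le_add_one hm h3
  have g4 := ediv_le_add_one hm h4
  obtain ⟨c, hc, c1⟩ := near_represented hE he (chain_nontrivial N t k) hA hw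
    ((mem_occupied hm (x := (p.1 / (m : ℤ), p.2 / (m : ℤ)))).2 ⟨p, hp, rfl, rfl⟩)
  obtain ⟨d, hd, d1⟩ := near_represented hE he (piece_nontrivial hτ ht') hγ hv
    ((mem_occupied hm (x := (q.1 / (m : ℤ), q.2 / (m : ℤ)))).2 ⟨q, hq, rfl, rfl⟩)
  have d2 := mem_piece_box ht' hd
  simp only at c1 d1
  -- One block for the adjacency, one for each of the two representations and two for `v`: the
  -- represented tiles `c` and `d` are at most five apart in the frame of the dock. This excludes
  -- both bars and, as teeth are ten apart, leaves a single common tooth.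
  rcases mem_chain_near_dock ht hk hc (by omega) (by omega) with c2 | ⟨s, c2⟩
  · omega
  rcases mem_piece_cases hd with d3 | ⟨s', d3⟩
  · omega
  obtain ⟨rfl, e⟩ := tooth_close (t := t) (t' := t') (s := s) (s' := s') (by omega) (by omega)
  have e' : tooth t s = tooth t' s := by
    unfold tooth
    rw [e]
  exact ⟨s, e, by unfold InWindow; omega⟩

theorem bond_pos_near {α : Assembly} {p q : Pos} (h : 0 < α.bond p q) :
    q.1 ≤ p.1 + 1 ∧ p.1 ≤ q.1 + 1 ∧ q.2 ≤ p.2 + 1 ∧ p.2 ≤ q.2 + 1 := by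
  obtain ⟨s, t, -, -, h'⟩ := bond_pos_cases h
  rcases h' with ⟨rfl, -⟩ | ⟨rfl, -⟩ | ⟨rfl, -⟩ | ⟨rfl, -⟩ <;>
    simp only [Prod.fst_add, Prod.snd_add] <;> omega

/-- At a temperature below `τ`, a simulated piece is bound even without one of its teeth. -/
theorem exists_unneeded_tooth (hτ : 2 ≤ τ) (hm : 0 < m) (hE : EquivProductions 𝒰 (system τ) R)
    (hU : 𝒰.temp < τ) (ht : ∀ s, t s < N) {k : ℕ} (hk : k < N)
    {A γ : Assembly} {v : Pos} (hA : 𝒰.Producible A.supertile) (hγ : 𝒰.Producible γ.supertile)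
    (hw : R.onAssembly A = (chain N t k).translate (-dock τ N k, 0))
    (hv : R.onAssembly γ = (piece N t).translate v)
    (hv' : v ∈ Finset.Icc ((-2 : ℤ), (-2 : ℤ)) (2, 2)) (hd : Disjoint A.dom γ.dom)
    (hs : (A.union γ).Stable 𝒰.temp) :
    ∃ (r : Fin τ) (E : Finset (Pos × Pos)),
      (∀ e ∈ E, e.1 ∈ A.dom ∧ e.2 ∈ γ.dom ∧ ∃ s, s ≠ r ∧ InWindow m (tooth t s) e.2) ∧
      𝒰.temp ≤ ∑ e ∈ E, (A.union γ).bond e.1 e.2 := by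
  classical
  obtain ⟨E, hE', hw'⟩ := hs.exists_crossing hd hA.nonempty hγ.nonempty
  -- At most `𝒰.temp < τ` positive bonds suffice, so assigning a window to each of them misses some
  -- tooth.
  obtain ⟨E, hsub, hcard, hpos, hw'⟩ := exists_subset_card_le_sum E _ hw'
  have key : ∀ e : E, ∃ s, InWindow m (tooth t s) e.1.2 := by
    rintro ⟨e, h⟩
    obtain ⟨h1, h2, h3, h4⟩ := bond_pos_near (hpos e h)
    obtain ⟨s, -, hs⟩ := contact hτ hm hE ht ht hk hA hγ hw hv hv' (hE' e (hsub h)).1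
      (hE' e (hsub h)).2 h1 h2 h3 h4
    exact ⟨s, hs⟩
  choose f hf using key
  obtain ⟨r, hr⟩ : ∃ r, r ∉ Finset.univ.image f := by
    by_contra hall
    push Not at hall
    have h1 : (Finset.univ : Finset (Fin τ)).card ≤ (Finset.univ.image f).card :=
      Finset.card_le_card fun r _ => hall r
    have h2 : (Finset.univ.image f).card ≤ E.card := by
      simpa using Finset.card_image_le (s := (Finset.univ : Finset E)) (f := f)
    rw [Finset.card_univ, Fintype.card_fin] at h1
    omega
  refine ⟨r, E, fun e he => ⟨(hE' e (hsub he)).1, (hE' e (hsub he)).2, f ⟨e, he⟩, ?_, hf _⟩, hw'⟩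
  rintro rfl
  exact hr (Finset.mem_image_of_mem f (Finset.mem_univ _))

/-- The system at temperature `τ` cannot be simulated at a lower temperature. -/
theorem not_simulates (hτ : 2 ≤ τ) (hU : 𝒰.temp < τ) : ¬ Simulates 𝒰 (system τ) := by
  rintro ⟨m, hm, R, hE, hF, hW⟩
  have he := empty_block hE
  -- A color records the unneeded tooth, the offset of `γ` and the contents of all windows relative
  -- to their teeth. Its type does not involve `N`, so `N` can be chosen larger than the number of
  -- colors.
  let κ := Fin τ × (Finset.Icc ((-2 : ℤ), (-2 : ℤ)) (2, 2)) ×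
    (Fin τ → Fin (7 * m) × Fin (7 * m) → Option 𝒰.tiles)
  obtain ⟨N, hN1, hN2⟩ : ∃ N, (center m).ncard < N ∧ Fintype.card κ < N :=
    ⟨max (center m).ncard (Fintype.card κ) + 1, by omega, by omega⟩
  have data : ∀ t : Fin τ → Fin N, ∃ (k : ℕ) (A γ : Assembly)
      (v : Finset.Icc ((-2 : ℤ), (-2 : ℤ)) (2, 2)) (r : Fin τ) (E : Finset (Pos × Pos)),
      k < N ∧ 𝒰.Producible A.supertile ∧ 𝒰.Producible γ.supertile ∧
      R.onAssembly A = (chain N (fun s => t s) k).translate (-dock τ N k, 0) ∧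
      R.onAssembly γ = (piece N (fun s => t s)).translate v.1 ∧ Disjoint A.dom γ.dom ∧
      (∀ e ∈ E, e.1 ∈ A.dom ∧ e.2 ∈ γ.dom ∧
        ∃ s, s ≠ r ∧ InWindow m (tooth (fun s => (t s : ℕ)) s) e.2) ∧
      𝒰.temp ≤ ∑ e ∈ E, (A.union γ).bond e.1 e.2 := by
    intro t
    have ht : ∀ s, ((t s : ℕ)) < N := fun s => (t s).2
    obtain ⟨k, hk, A, γ, v, hA, hγ, hw, hv, hv', hd, hs⟩ :=
      exists_aligned_step hτ hm hE hF hW ht hN1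
    obtain ⟨r, E, hr, hE'⟩ :=
      exists_unneeded_tooth hτ hm hE hU ht hk hA hγ hw hv hv' hd hs
    exact ⟨k, A, γ, ⟨v, hv'⟩, r, E, hk, hA, hγ, hw, hv, hd, hr, hE'⟩
  choose k A γ v r E hk hA hγ hw hv hd hr hE' using data
  obtain ⟨t, t', hcol, hne, heq⟩ := exists_eq_color_differ_once
    (fun t => ((r t, v t, fun s => window 𝒰.tiles m (tooth (fun s => (t s : ℕ)) s) (γ t)) : κ))
    Prod.fst hN2
  simp only [Prod.mk.injEq] at hcol hne heq
  obtain ⟨-, hvv, hwin⟩ := hcol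
  have ht : ∀ s, ((t s : ℕ)) < N := fun s => (t s).2
  have ht' : ∀ s, ((t' s : ℕ)) < N := fun s => (t' s).2
  have hv' := hv t'
  rw [← hvv] at hv'
  have agree : ∀ s, s ≠ r t → ∀ q, InWindow m (tooth (fun s => (t s : ℕ)) s) q →
      γ t q = γ t' q := by
    intro s hs q hq
    refine apply_eq_of_window_eq hm (hγ t).over (hγ t').over ?_ hq
    have e : tooth (fun s => (t s : ℕ)) s = tooth (fun s => (t' s : ℕ)) s := by
      simp only [tooth, heq s hs]
    have := congrFun hwin s
    rwa [← e] at this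
  -- An overlap would lie in the window of a tooth common to `t` and `t'`, hence not `r t`. There `γ
  -- t'` coincides with `γ t`, which avoids `A t`.
  have hdisj : Disjoint (A t).dom (γ t').dom := by
    rw [Set.disjoint_left]
    intro p hp hp'
    obtain ⟨s, hs, hq⟩ := contact hτ hm hE ht ht' (hk t) (hA t) (hγ t') (hw t) hv' (v t).2 hp hp'
      (by omega) (by omega) (by omega) (by omega)
    have hsr : s ≠ r t := by
      rintro rfl
      exact hne (Fin.ext hs)
    obtain ⟨a, ha⟩ := hp'
    exact Set.disjoint_left.1 (hd t) hp ⟨a, (agree s hsr p hq).trans ha⟩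
  -- The bonds in `E t` avoid tooth `r t`, so they persist with the same strengths after `γ t` is
  -- replaced by `γ t'`.
  have hstab : ((A t).union (γ t')).Stable 𝒰.temp := by
    have hag : ∀ e ∈ E t, γ t e.2 = γ t' e.2 := by
      intro e he
      obtain ⟨-, -, s, hs, hq⟩ := hr t e he
      exact agree s hs _ hq
    have hmem : ∀ e ∈ E t, e.1 ∈ (A t).dom ∧ e.2 ∈ (γ t').dom := by
      intro e he
      obtain ⟨h1, ⟨a, h2⟩, -⟩ := hr t e he
      exact ⟨h1, a, hag e he ▸ h2⟩
    refine (hA t).stable.union (hγ t').stable hdisj (E t) hmem ((hE' t).trans ?_)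
    refine (Finset.sum_congr rfl fun e he => bond_congr ?_ ?_).le
    · rw [union_of_mem (hmem e he).1, union_of_mem (hmem e he).1]
    · rw [union_of_mem_right (hd t) (hr t e he).2.1, union_of_mem_right hdisj (hmem e he).2,
        hag e he]
  have hAR : R.onSupertile (A t).supertile = (chain N (fun s => (t s : ℕ)) (k t)).supertile := by
    rw [hE.onSupertile_eq (hA t), hw t, supertile_translate]
  have hγR : R.onSupertile (γ t').supertile = (piece N (fun s => (t' s : ℕ))).supertile := by
    rw [hE.onSupertile_eq (hγ t'), hv t', supertile_translate]
  -- Attachment is closed only on supertiles assembled in finitely many steps. Both parts are finite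
  -- because what they represent is finite and has at least two tiles.
  have hAr := (hA t).reachable (finite_of_represents hE he hm (chain_nontrivial _ _ _)
    (chain_finite ht (hk t).le) (hA t) hAR)
  have hγr := (hγ t').reachable (finite_of_represents hE he hm (piece_nontrivial hτ ht')
    (piece_finite ht') (hγ t') hγR)
  have hcomb := combine_mem hdisj hstab
  have hprod := (TAS.Reachable.attach hAr hγr hcomb).producible
  -- Read from either side, the mixed attachment gives the partially filled seed and the wrong piece
  -- a common successor.
  have h1 := hF _ _ (hA t) hprod ⟨_, hγ t', hcomb⟩
  have h2 := hF _ _ (hγ t') hprod ⟨_, hA t, combine_comm _ _ _ ▸ hcomb⟩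
  rw [hAR] at h1
  rw [hγR] at h2
  exact not_stepLE_both hτ ht (hk t).le ht' (r t) (fun h => hne (Fin.ext h))
    (fun s hs => congrArg Fin.val (heq s hs)) h1 h2

end Ladder

/-! ### The hierarchies -/

theorem not_classSimulates_of_lt {k l : ℕ} (hl : 2 ≤ l) (h : k < l) :
    ¬ ClassSimulates (TwoHAM k) (TwoHAM l) := by
  intro hc
  obtain ⟨𝒰, h𝒰, hs⟩ := hc (Ladder.system l) rfl
  have h𝒰' : 𝒰.temp = k := h𝒰
  exact Ladder.not_simulates hl (h𝒰' ▸ h) hs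

theorem isHierarchy_pow {c : ℕ} (hc : 4 ≤ c) : IsHierarchy fun i => TwoHAM (c ^ i) where
  temperature := ⟨fun i => c ^ i, pow_right_strictMono₀ (by omega), fun i => pow_pos (by omega) i,
    fun _ => rfl⟩
  power i j hij := by
    refine not_classSimulates_of_lt ?_ (Nat.pow_lt_pow_right (by omega) hij)
    calc 2 ≤ c ^ 1 := by rw [pow_one]; omega
      _ ≤ c ^ i := Nat.pow_le_pow_right (by omega) (by omega)
  downward i j hij := classSimulates_of_dvd (pow_pos (by omega) i) (pow_dvd_pow c hij)

theorem twoHAM_injective : Function.Injective TwoHAM := by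
  intro k l h
  -- The empty system at temperature `k` belongs to no other class.
  have : (⟨∅, ∅, k, fun _ h => h.elim⟩ : TAS) ∈ TwoHAM k := rfl
  rw [h] at this
  exact this

end TwoHanded

theorem mainTheorem4 :
    (∀ c : ℕ, 4 ≤ c → TwoHanded.IsHierarchy (fun i => TwoHanded.TwoHAM (c ^ i))) ∧
    {H : ℕ → Set TwoHanded.TAS | TwoHanded.IsHierarchy H ∧
      ∃ c : ℕ, 4 ≤ c ∧ H = fun i => TwoHanded.TwoHAM (c ^ i)}.Infinite := by
  refine ⟨fun c hc => TwoHanded.isHierarchy_pow hc, ?_⟩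
  refine Set.infinite_of_injective_forall_mem
    (f := fun (n : ℕ) (i : ℕ) => TwoHanded.TwoHAM ((n + 4) ^ i)) ?_ fun n =>
      ⟨TwoHanded.isHierarchy_pow (by omega), n + 4, by omega, rfl⟩
  intro n n' h
  -- Level one is the class at temperature `c` itself, so different bases give different
  -- hierarchies.
  have := TwoHanded.twoHAM_injective (congrFun h 1)
  simpa using this
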